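/- Let $d \ge 3$ and consider the standard graph on $\mathbb{Z}^d$: $k \sim l$ if and only if $|k-l| = 1$ ($|\cdot|$ the Euclidean norm), with edge weights $b(k,l)=1$ if $k\sim l$ and $b(k,l)=0$ otherwise, Laplacian $\Delta f(k) = \sum_{l} b(k,l)(f(k)-f(l))$ and $|\nabla f|^2(k) = \frac12 \sum_{l} b(k,l)(f(k)-f(l))^2$. For a weight $m$ let $\|f\|_m = \big(\sum_k m(k) f(k)^2\big)^{1/2}$, and let $1_\varphi$ be the indicator function of the support of $\varphi$. Let $p_n(k,l)$ be the matrix elements of the $n$-th power of the transition matrix with entries $p_1(k,l)=\frac{1}{2d}$ if $k\sim l$ and $0$ otherwise, and let $G(k,l)=\sum_{n\ge 0}p_n(k,l)$, $G(k)=G(k,0)$, $w=\Delta (G^{1/2})/G^{1/2}$. A Hardy weight on $Y \subseteq \mathbb{Z}^d$ is a function $w'$, strictly positive on $Y$, such that $\sum_k |\nabla\varphi|^2(k) \ge \|\varphi\|_{w'}^2$ for all finitely supported $\varphi$ vanishing outside $Y$. Then: 1. For all $k,l$, the series defining $G(k,l)$ converges and $G(k,l)>0$. 2. $w$ is a strictly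 positive Hardy weight on $\mathbb{Z}^d$, and it is optimal: (a) every Hardy weight $w'$ on $\mathbb{Z}^d$ with $w'\ge w$ equals $w$; (b) the strictly positive solution $G^{1/2}$ of $(\Delta-w)v=0$ satisfies $\sum_k w(k)G(k)=\infty$; (c) if $K$ is finite, $\lambda>0$ and $\lambda w$ is a Hardy weight on $\mathbb{Z}^d\setminus K$, then $\lambda\le 1$. 3. For all $0<\alpha<1$ and all finitely supported $\varphi:\mathbb{Z}^d\to\mathbb{R}$, $$\| 1_\varphi \Delta\varphi\|_{G^\alpha/w} \ \ge\ \left(1-\left(\frac{1-(2d)^{-\alpha/2}}{1-(2d)^{-1/2}}\right)^2\right)\|\varphi\|_{G^\alpha w}.$$ 4. As $|k|\to\infty$, $w(k) = \frac{(d-2)^2}{4}\frac{1}{|k|^2} + O(|k|^{-3})$, and there are constants $C_1, C_2>0$ depending only on $d$ with $$G(k)=\frac{C_1}{|k|^{d-2}}+C_2\left(\sum_{i=1}^d\Big(\frac{k_i}{|k|}\Big)^4-\frac{3}{d+2}\right)\frac1{|k|^d}+O\Big(\frac1{|k|^{d+2}}\Big).$$ 5. If $d\ge5$ and $\alpha=2/(d-2)$,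 then $\alpha<1$ and there are constants $C,C'>0$ such that, as $|k|\to\infty$, $G(k)^\alpha/w(k)\to C$ and $|k|^4\,G(k)^\alpha w(k)\to C'$. -/

import Mathlib

open scoped Asymptotics

noncomputable section

namespace GraphRellich

section Graph

variable {X : Type*}

/-- The formal Laplacian `Δ f (x) = ∑_y b(x,y) (f(x) - f(y))` of a graph with edge weights `b`. -/
def laplacian (b : X → X → ℝ) (f : X → ℝ) (x : X) : ℝ :=
  ∑' y, b x y * (f x - f y)

/-- `|∇ f|² (x) = 1/2 ∑_y b(x,y) (f(x) - f(y))²`. -/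
def gradSq (b : X → X → ℝ) (f : X → ℝ) (x : X) : ℝ :=
  (1 / 2) * ∑' y, b x y * (f x - f y) ^ 2

/-- The norm of `ℓ²(X, m)`, that is `‖f‖_m = (∑_x m(x) f(x)²)^{1/2}`. -/
def weightedNorm (m : X → ℝ) (f : X → ℝ) : ℝ :=
  Real.sqrt (∑' x, m x * f x ^ 2)

/-- `w` is a (strictly positive) Hardy weight of the graph `b` on `Y`: `w > 0` on `Y`, and
`∑_X |∇ φ|² ≥ ‖φ‖_w²` for every finitely supported `φ` that vanishes outside `Y`. -/
def IsHardyWeightOn (b : X → X → ℝ) (Y : Set X) (w : X → ℝ) : Prop :=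
  (∀ x ∈ Y, 0 < w x) ∧
    ∀ φ : X → ℝ, φ.support.Finite → φ.support ⊆ Y →
      weightedNorm w φ ^ 2 ≤ ∑' x, gradSq b φ x

/-- `Δ - w` is critical: no Hardy weight on `X` that dominates `w` differs from `w`. -/
def IsCritical (b : X → X → ℝ) (w : X → ℝ) : Prop :=
  ∀ w' : X → ℝ, IsHardyWeightOn b Set.univ w' → (∀ x, w x ≤ w' x) → w' = w

/-- `Δ - w` is null-critical with respect to `w`, with ground state `v`: `v` is a strictly
positive solution of `(Δ - w) v = 0` that is not in `ℓ²(X, w)`. -/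
def IsNullCriticalWith (b : X → X → ℝ) (w v : X → ℝ) : Prop :=
  (∀ x, 0 < v x) ∧ (∀ x, laplacian b v x = w x * v x) ∧ ¬ Summable fun x => w x * v x ^ 2

/-- `w` is optimal at infinity: if `lam • w`, `lam > 0`, is a Hardy weight on the complement of
a finite set, then `lam ≤ 1`. -/
def IsOptimalAtInfinity (b : X → X → ℝ) (w : X → ℝ) : Prop :=
  ∀ (K : Set X) (lam : ℝ), K.Finite → 0 < lam →
    IsHardyWeightOn b Kᶜ (fun x => lam * w x) → lam ≤ 1

end Graph

section Lattice

variable {d : ℕ}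

/-- The Euclidean norm `|k|` of a lattice point. -/
def latticeNorm (k : Fin d → ℤ) : ℝ :=
  ‖(WithLp.toLp 2 (fun i => (k i : ℝ)) : EuclideanSpace ℝ (Fin d))‖

open Classical in
/-- The standard weights on `ℤ^d`: `k` and `l` are joined by an edge of weight one
if and only if `|k - l| = 1`. -/
def latticeWeight (k l : Fin d → ℤ) : ℝ :=
  if latticeNorm (k - l) = 1 then 1 else 0

/-- The matrix elements `p_n(k,l)` of the `n`-th power of the transition matrix with entries
`1/(2d)` if `k ∼ l` and `0` otherwise. -/
def transition : ℕ → (Fin d → ℤ) → (Fin d → ℤ) → ℝ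
  | 0, k, l => if k = l then 1 else 0
  | n + 1, k, l => ∑' j, transition n k j * (latticeWeight j l / (2 * (d : ℝ)))

/-- The Green function `G(k,l) = ∑_n p_n(k,l)`. -/
def greenKernel (k l : Fin d → ℤ) : ℝ :=
  ∑' n, transition n k l

/-- `G(k) = G(k,0)`. -/
def green (k : Fin d → ℤ) : ℝ :=
  greenKernel k 0

/-- The weight `w = Δ(G^{1/2}) / G^{1/2}`. -/
def hardyWeight (k : Fin d → ℤ) : ℝ :=
  laplacian latticeWeight (fun l => Real.sqrt (green l)) k / Real.sqrt (green k)

/-- The filter `|k| → ∞` on `ℤ^d`. -/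
def latticeAtInfinity (d : ℕ) : Filter (Fin d → ℤ) :=
  Filter.comap latticeNorm Filter.atTop

end Lattice

end GraphRellich

end

/-! ### Unit steps, neighbour sums and the transition matrix on the lattice. -/

namespace GraphRellich

variable {d : ℕ}

/-! All information on G comes from one integral representation. A walk making a Poisson number of
steps has independent coordinates, so with `besselKernel t n` = e^{-t} I_n(t) one gets G(k) = d
∫_0^∞ ∏_i `besselKernel t (k i)` dt (`hasSum_transition_of_integrableOn`). Shifting the Fourier
contour by 1/√t gives a one-dimensional Edgeworth expansion whose error carries the factor
e^{-|n|/√t} (`abs_besselKernel_sub_le`). After multiplication over the coordinates and integration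
in time, the Gaussian terms become Gamma functions and the error becomes O(|k|^{-d-2})
(`abs_green_sub_le`).

The Hardy weight is governed by √a(√a - √b) = (√a - √b)²/2 + (a - b)/2, which turns the definition
of w into wG = |∇√G|² + ΔG/2 with ΔG = 2d·1_{0} (`hardyWeight_mul_green`). Thus w ≥ 0, and w > 0
because G separates k - e_i from k + e_i whenever k_i ≠ 0 (`green_step_ne`). The ground state
transform by √G (`tsum_gradSq_mul`) is then the Hardy inequality with an explicit nonnegative
remainder.

Optimality is tested on ψ_M = (log G + M)₊, which has finite support since G tends to 0. The
inequality √a√b(log a - log b) ≤ a - b and Green's formula bound the remainder by 2d·ψ_M(0) = O(M),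
while ψ_M/M tends to 1 pointwise; so ψ_M/M is a null sequence and w is critical. Since neighbouring
values of G have bounded ratio, a reverse comparison bounds 2d·ψ_M(0) by a multiple of Σ wG, which
must therefore diverge. If λw with λ > 1 were a Hardy weight off a finite set K, erasing ψ_M on K
would cost only O(M²), and dividing by M² would make Σ wG finite, a contradiction.

For the Rellich inequality, f = G^{α/2} satisfies |∇f|² ≤ γ f² w by concavity of s^α. The Hardy
inequality for fφ then gives ⟨Δφ, f²φ⟩ ≥ (1 - γ)‖fφ‖_w² (`le_tsum_mul_laplacian`), and
Cauchy–Schwarz concludes. For the asymptotics of w, off the origin w(k) is half the sum of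
(√G(l)/√G(k) - 1)² over neighbours l, so first-order expansions of these ratios suffice
(`sqrt_green_step_isBigO`). -/

/-- The `2d` unit steps of the lattice. -/
def unitStep (p : Fin d × Bool) : Fin d → ℤ := Pi.single p.1 (if p.2 then 1 else -1)

lemma unitStep_injective : Function.Injective (unitStep (d := d)) := by
  rintro ⟨i, a⟩ ⟨j, b⟩ h
  have hi := congrFun h i
  by_cases hij : i = j
  · subst hij
    cases a <;> cases b <;> simp [unitStep] at hi ⊢
  · cases a <;> cases b <;> simp [unitStep, hij] at hi

lemma unitStep_neg (p : Fin d × Bool) : unitStep (p.1, !p.2) = -unitStep p := by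
  rcases p with ⟨i, a⟩
  cases a <;> simp [unitStep, ← Pi.single_neg]

lemma latticeNorm_nonneg (k : Fin d → ℤ) : 0 ≤ latticeNorm k := norm_nonneg _

lemma latticeNorm_sq (k : Fin d → ℤ) : latticeNorm k ^ 2 = ∑ i, (k i : ℝ) ^ 2 := by
  simp [latticeNorm, EuclideanSpace.norm_sq_eq]

lemma latticeNorm_eq_one_iff (k : Fin d → ℤ) :
    latticeNorm k = 1 ↔ ∃ p : Fin d × Bool, k = unitStep p := by
  have h1 : latticeNorm k = 1 ↔ ∑ i, k i ^ 2 = 1 := by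
    rw [← sq_eq_sq₀ (latticeNorm_nonneg k) zero_le_one, latticeNorm_sq]
    constructor
    · intro h; rw [one_pow] at h; exact_mod_cast h
    · intro h; have : ((∑ i, k i ^ 2 : ℤ) : ℝ) = 1 := by rw [h]; simp
      simpa using this
  rw [h1]
  constructor
  · intro h
    obtain ⟨i, hi⟩ : ∃ i, k i ≠ 0 := by
      by_contra! hc
      simp [hc] at h
    have h2 := Finset.add_sum_erase Finset.univ (fun i => k i ^ 2) (Finset.mem_univ i)
    have h3 : 0 ≤ ∑ j ∈ Finset.univ.erase i, k j ^ 2 := Finset.sum_nonneg fun _ _ => sq_nonneg _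
    have h4 : 1 ≤ k i ^ 2 := by have := sq_pos_of_ne_zero hi; omega
    simp only [h] at h2
    have h5 : ∑ j ∈ Finset.univ.erase i, k j ^ 2 = 0 := by omega
    have h6 := (Finset.sum_eq_zero_iff_of_nonneg (fun _ _ => sq_nonneg _)).1 h5
    have h7 : k i = 1 ∨ k i = -1 := sq_eq_one_iff.1 (by omega)
    refine ⟨(i, decide (k i = 1)), ?_⟩
    ext j
    by_cases hj : j = i
    · subst hj
      rcases h7 with h7 | h7 <;> simp [unitStep, h7]
    · have := h6 j (by simp [hj])
      simp [unitStep, hj]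
      simpa using this
  · rintro ⟨⟨i, a⟩, rfl⟩
    rw [Finset.sum_eq_single i]
    · cases a <;> simp [unitStep]
    · intro j _ hj; simp [unitStep, hj]
    · simp

lemma latticeWeight_add_unitStep (k : Fin d → ℤ) (p : Fin d × Bool) :
    latticeWeight k (k + unitStep p) = 1 := by
  unfold latticeWeight
  rw [if_pos]
  rw [latticeNorm_eq_one_iff]
  exact ⟨(p.1, !p.2), by rw [unitStep_neg]; abel⟩

lemma latticeWeight_eq_zero (k l : Fin d → ℤ) (h : ∀ p, l ≠ k + unitStep p) :
    latticeWeight k l = 0 := by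
  unfold latticeWeight
  rw [if_neg]
  rw [latticeNorm_eq_one_iff]
  rintro ⟨p, hp⟩
  refine h (p.1, !p.2) ?_
  rw [unitStep_neg, ← hp]; abel

lemma latticeWeight_comm (k l : Fin d → ℤ) : latticeWeight k l = latticeWeight l k := by
  have : latticeNorm (k - l) = latticeNorm (l - k) := by
    unfold latticeNorm
    rw [← norm_neg]
    congr 1
    ext i; simp
  simp [latticeWeight, this]

lemma tsum_latticeWeight_mul (k : Fin d → ℤ) (F : (Fin d → ℤ) → ℝ) :
    ∑' l, latticeWeight k l * F l = ∑ p, F (k + unitStep p) := by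
  have hinj : Function.Injective fun p : Fin d × Bool => k + unitStep p :=
    fun p q h => unitStep_injective (add_left_cancel h)
  rw [tsum_eq_sum (s := Finset.univ.map ⟨_, hinj⟩), Finset.sum_map]
  · simp [latticeWeight_add_unitStep]
  · intro l hl
    rw [latticeWeight_eq_zero, zero_mul]
    rintro p rfl
    simp at hl

lemma laplacian_latticeWeight (f : (Fin d → ℤ) → ℝ) (k : Fin d → ℤ) :
    laplacian latticeWeight f k = ∑ p, (f k - f (k + unitStep p)) :=
  tsum_latticeWeight_mul k _

lemma gradSq_latticeWeight (f : (Fin d → ℤ) → ℝ) (k : Fin d → ℤ) :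
    gradSq latticeWeight f k = (1 / 2) * ∑ p, (f k - f (k + unitStep p)) ^ 2 := by
  rw [gradSq, tsum_latticeWeight_mul k (fun l => (f k - f l) ^ 2)]

lemma transition_succ (n : ℕ) (k l : Fin d → ℤ) :
    transition (n + 1) k l = ∑ p, transition n k (l + unitStep p) / (2 * (d : ℝ)) := by
  rw [transition, ← tsum_latticeWeight_mul l (fun j => transition n k j / (2 * (d : ℝ)))]
  congr 1; ext j
  rw [latticeWeight_comm j l]; ring

lemma transition_nonneg (n : ℕ) (k l : Fin d → ℤ) : 0 ≤ transition n k l := by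
  induction n generalizing l with
  | zero => unfold transition; split_ifs <;> simp
  | succ n ih =>
    rw [transition_succ]
    exact Finset.sum_nonneg fun p _ => div_nonneg (ih _) (by positivity)

lemma transition_eq_sub (n : ℕ) (k l : Fin d → ℤ) :
    transition n k l = transition n (k - l) 0 := by
  have key : ∀ n (k l m : Fin d → ℤ), transition n (k + m) (l + m) = transition n k l := by
    intro n
    induction n with
    | zero => intro k l m; simp [transition]
    | succ n ih =>
      intro k l m
      rw [transition_succ, transition_succ]
      refine Finset.sum_congr rfl fun p _ => ?_
      rw [show l + m + unitStep p = l + unitStep p + m by abel, ih]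
  rw [← key n (k - l) 0 l]; simp

lemma greenKernel_eq_green (k l : Fin d → ℤ) : greenKernel k l = green (k - l) := by
  unfold green greenKernel
  congr 1; ext n; exact transition_eq_sub n k l

/-- `transition_succ` decomposes at the second argument. Translation invariance and the symmetry of
the steps move the decomposition to the first argument, which is the variable of G. -/
lemma transition_zero_succ (n : ℕ) (k : Fin d → ℤ) :
    transition (n + 1) k 0 = ∑ p, transition n (k + unitStep p) 0 / (2 * (d : ℝ)) := by
  rw [transition_succ]
  refine Fintype.sum_equiv ((Equiv.refl _).prodCongr Equiv.boolNot) _ _ fun p => ?_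
  have : unitStep ((Equiv.prodCongr (Equiv.refl (Fin d)) Equiv.boolNot) p) = -unitStep p :=
    unitStep_neg p
  rw [this, transition_eq_sub]; congr 2; abel

end GraphRellich

/-! ### Fourier representation, Poissonization, and G as a time integral. -/

namespace GraphRellich

open MeasureTheory Real

/-- The uniform probability measure on `(-π, π]`. -/
noncomputable def circleMeasure : Measure ℝ :=
  ENNReal.ofReal (2 * π)⁻¹ • volume.restrict (Set.Ioc (-π) π)

lemma integral_circleMeasure {E : Type*} [NormedAddCommGroup E] [NormedSpace ℝ E] (f : ℝ → E) :
    ∫ θ, f θ ∂circleMeasure = (2 * π)⁻¹ • ∫ θ in (-π)..π, f θ := by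
  rw [circleMeasure, integral_smul_measure, intervalIntegral.integral_of_le (by linarith [pi_pos]),
    ENNReal.toReal_ofReal (by positivity)]

instance : IsProbabilityMeasure circleMeasure := by
  constructor
  simp only [circleMeasure, Measure.smul_apply, Measure.restrict_apply_univ, volume_Ioc,
    smul_eq_mul]
  rw [← ENNReal.ofReal_mul (by positivity), ← ENNReal.ofReal_one]
  congr 1
  field_simp; ring

/-- The transition density `e^{-t} I_n(t)` of the continuous-time simple random walk on `ℤ`. -/
noncomputable def besselKernel (t : ℝ) (n : ℤ) : ℝ :=
  ∫ θ, Real.cos (n * θ) * Real.exp (t * (Real.cos θ - 1)) ∂circleMeasure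

lemma integrable_circleMeasure {E : Type*} [NormedAddCommGroup E] {f : ℝ → E}
    (hf : Continuous f) : Integrable f circleMeasure := by
  refine Integrable.smul_measure ?_ (by simp)
  exact (hf.integrableOn_Icc).mono_set Set.Ioc_subset_Icc_self

lemma integral_cexp_mul_circleMeasure (t : ℝ) (n : ℤ) :
    ∫ θ : ℝ, Complex.exp (-(n * θ * Complex.I)) * (Real.exp (t * (Real.cos θ - 1)) : ℝ)
      ∂circleMeasure = besselKernel t n := by
  have hodd : ∫ θ, Real.sin (n * θ) * Real.exp (t * (Real.cos θ - 1)) ∂circleMeasure = 0 := by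
    rw [integral_circleMeasure]
    have := intervalIntegral.integral_comp_neg (a := -π) (b := π)
      (fun θ => Real.sin (n * θ) * Real.exp (t * (Real.cos θ - 1)))
    simp only [mul_neg, Real.sin_neg, neg_mul, Real.cos_neg, neg_neg,
      intervalIntegral.integral_neg] at this
    have h0 : ∫ θ in (-π)..π, Real.sin (n * θ) * Real.exp (t * (Real.cos θ - 1)) = 0 := by
      linarith
    simp [h0]
  have hpt : ∀ θ : ℝ, Complex.exp (-(n * θ * Complex.I)) * (Real.exp (t * (Real.cos θ - 1)) : ℝ)
      = ((Real.cos (n * θ) * Real.exp (t * (Real.cos θ - 1)) : ℝ) : ℂ)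
        - ((Real.sin (n * θ) * Real.exp (t * (Real.cos θ - 1)) : ℝ) : ℂ) * Complex.I := by
    intro θ
    rw [← neg_mul, Complex.exp_mul_I, Complex.cos_neg, Complex.sin_neg]
    push_cast; ring
  simp_rw [hpt]
  rw [integral_sub, integral_mul_const, integral_complex_ofReal, integral_complex_ofReal, hodd]
  · simp [besselKernel]
  · exact integrable_circleMeasure (by fun_prop)
  · exact integrable_circleMeasure (by fun_prop)

lemma integral_cexp_circleMeasure (n : ℤ) :
    ∫ θ : ℝ, Complex.exp (-(n * θ * Complex.I)) ∂circleMeasure = if n = 0 then 1 else 0 := by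
  split_ifs with h
  · simp [h]
  · rw [integral_circleMeasure]
    have hc : (-(n * Complex.I) : ℂ) ≠ 0 := by simp [h]
    have := integral_exp_mul_complex (a := -π) (b := π) hc
    have e : ∀ θ : ℝ, Complex.exp (-(n * θ * Complex.I)) = Complex.exp (-(n * Complex.I) * θ) := by
      intro θ; congr 1; ring
    simp_rw [e]
    rw [this]
    have : Complex.exp (-(n * Complex.I) * (π : ℝ)) = Complex.exp (-(n * Complex.I) * (-π : ℝ)) := by
      rw [Complex.exp_eq_exp_iff_exists_int]
      exact ⟨-n, by push_cast; ring⟩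
    rw [this, sub_self, zero_div, smul_zero]

variable {d : ℕ}

lemma norm_prod_cexp (k : Fin d → ℤ) (θ : Fin d → ℝ) :
    ‖∏ i, Complex.exp (-(k i * θ i * Complex.I))‖ = 1 := by
  rw [norm_prod]
  refine Finset.prod_eq_one fun i _ => ?_
  have : (-(k i * θ i * Complex.I) : ℂ) = ((-(k i * θ i) : ℝ) : ℂ) * Complex.I := by
    push_cast; ring
  rw [this, Complex.norm_exp_ofReal_mul_I]

lemma abs_sum_cos_div_le (θ : Fin d → ℝ) : |(∑ i, Real.cos (θ i)) / d| ≤ 1 := by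
  rw [abs_div, Nat.abs_cast]
  refine div_le_one_of_le₀ ?_ (Nat.cast_nonneg d)
  refine (Finset.abs_sum_le_sum_abs _ _).trans ?_
  refine (Finset.sum_le_sum fun i _ => Real.abs_cos_le_one (θ i)).trans ?_
  simp

/-- On the Fourier side one step of the walk is multiplication by the mean of the cosines, since
opposite steps contribute conjugate phases. -/
lemma transition_eq_integral (n : ℕ) (k : Fin d → ℤ) :
    (transition n k 0 : ℂ) = ∫ θ : Fin d → ℝ, (((∑ i, Real.cos (θ i)) / d : ℝ) : ℂ) ^ n *
      ∏ i, Complex.exp (-(k i * θ i * Complex.I)) ∂(Measure.pi fun _ => circleMeasure) := by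
  induction n generalizing k with
  | zero =>
    simp only [pow_zero, one_mul]
    rw [integral_fintype_prod_eq_prod (f := fun i (x : ℝ) => Complex.exp (-(k i * x * Complex.I)))]
    simp_rw [integral_cexp_circleMeasure]
    rw [transition]
    split_ifs with h
    · simp [h]
    · obtain ⟨i, hi⟩ : ∃ i, k i ≠ 0 := by
        by_contra! hc; exact h (funext hc)
      rw [Finset.prod_eq_zero (Finset.mem_univ i)] <;> simp [hi]
  | succ n ih =>
    rw [transition_zero_succ]
    push_cast
    simp_rw [ih, div_eq_mul_inv, ← integral_mul_const]
    rw [← integral_finsetSum]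
    · congr 1; ext θ
      have h1 : ∀ p : Fin d × Bool, ∏ i, Complex.exp (-(((k + unitStep p) i : ℤ) * θ i * Complex.I))
          = (∏ i, Complex.exp (-(k i * θ i * Complex.I))) *
            Complex.exp (-((if p.2 then 1 else -1) * θ p.1 * Complex.I)) := by
        intro p
        rw [← Complex.exp_sum, ← Complex.exp_sum, ← Complex.exp_add]
        congr 1
        rw [← sub_eq_iff_eq_add', ← Finset.sum_sub_distrib, Finset.sum_eq_single p.1]
        · rcases p with ⟨i, a⟩
          cases a <;> simp [unitStep] <;> ring
        · intro j _ hj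
          simp [unitStep, hj]
        · simp
      simp_rw [h1]
      rw [← Finset.sum_mul]
      have h2 : ∀ A B : ℂ, ∑ p : Fin d × Bool, A * (B *
          Complex.exp (-((if p.2 then 1 else -1) * θ p.1 * Complex.I)))
          = A * B * (2 * ∑ i, Complex.cos (θ i)) := by
        intro A B
        rw [Fintype.sum_prod_type, Finset.mul_sum, Finset.mul_sum]
        refine Finset.sum_congr rfl fun i _ => ?_
        rw [Complex.cos]
        simp
        ring
      rw [h2]
      push_cast
      rw [pow_succ]
      ring
    · intro p _
      refine Integrable.of_bound (C := ‖((2 : ℂ) * d)⁻¹‖) ?_ ?_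
      · exact Continuous.aestronglyMeasurable (by fun_prop)
      · refine Filter.Eventually.of_forall fun θ => ?_
        have h := abs_sum_cos_div_le θ
        rw [norm_mul, norm_mul, norm_pow, norm_prod_cexp, ← div_eq_mul_inv, Complex.norm_real,
          Real.norm_eq_abs, mul_one]
        exact mul_le_of_le_one_left (norm_nonneg _) (pow_le_one₀ (abs_nonneg _) h)

/-- The n-th powers of the symbol sum to an exponential of Σ (cos θ_i - 1)τ/d, which factors over
the coordinates; each coordinate walks at rate 1/d. -/
lemma hasSum_poisson_transition (hd : 0 < d) (k : Fin d → ℤ) {τ : ℝ} (hτ : 0 ≤ τ) :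
    HasSum (fun n : ℕ => Real.exp (-τ) * τ ^ n / n.factorial * transition n k 0)
      (∏ i, besselKernel (τ / d) (k i)) := by
  have hd' : (d : ℂ) ≠ 0 := by exact_mod_cast hd.ne'
  let E : (Fin d → ℝ) → ℂ := fun θ => ∏ i, Complex.exp (-(k i * θ i * Complex.I))
  let φ : (Fin d → ℝ) → ℝ := fun θ => (∑ i, Real.cos (θ i)) / d
  let F : ℕ → (Fin d → ℝ) → ℂ := fun n θ =>
    ((Real.exp (-τ) * τ ^ n / n.factorial : ℝ) : ℂ) * ((φ θ : ℂ) ^ n * E θ)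
  have hFn : ∀ n θ, ‖F n θ‖ ≤ Real.exp (-τ) * τ ^ n / n.factorial := by
    intro n θ
    have h0 : 0 ≤ Real.exp (-τ) * τ ^ n / n.factorial := by positivity
    simp only [F, E]
    rw [norm_mul, norm_mul, norm_pow, norm_prod_cexp, Complex.norm_real, Complex.norm_real,
      Real.norm_of_nonneg h0, mul_one]
    exact mul_le_of_le_one_right h0 (pow_le_one₀ (norm_nonneg _) (abs_sum_cos_div_le θ))
  have hFc : ∀ n, Continuous (F n) := by
    intro n; simp only [F, φ, E]; fun_prop
  have hFi : ∀ n, Integrable (F n) (Measure.pi fun _ => circleMeasure) := fun n =>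
    Integrable.of_bound (hFc n).aestronglyMeasurable _ (Filter.Eventually.of_forall (hFn n))
  have hsum : Summable fun n : ℕ => Real.exp (-τ) * τ ^ n / n.factorial := by
    simp_rw [mul_div_assoc]
    exact (Real.summable_pow_div_factorial τ).mul_left _
  have key := hasSum_integral_of_summable_integral_norm hFi <| by
    refine Summable.of_nonneg_of_le (fun n => integral_nonneg fun _ => norm_nonneg _)
      (fun n => ?_) hsum
    refine (integral_mono (hFi n).norm (integrable_const _) (hFn n)).trans ?_
    simp
  have hL : ∀ n, ∫ θ, F n θ ∂(Measure.pi fun _ => circleMeasure)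
      = ((Real.exp (-τ) * τ ^ n / n.factorial * transition n k 0 : ℝ) : ℂ) := by
    intro n
    rw [integral_const_mul, Complex.ofReal_mul, transition_eq_integral]
  have hR : ∀ θ, ∑' n, F n θ = ∏ i, Complex.exp (-(k i * θ i * Complex.I)) *
      (Real.exp (τ / d * (Real.cos (θ i) - 1)) : ℝ) := by
    intro θ
    have h1 : ∀ n, F n θ = (Complex.exp (-τ) * E θ) * ((τ * φ θ : ℂ) ^ n / n.factorial) := by
      intro n; simp only [F]; push_cast; rw [mul_pow]; ring
    simp_rw [h1]
    rw [tsum_mul_left, ← congrFun (NormedSpace.exp_eq_tsum_div (𝔸 := ℂ)) _, ← Complex.exp_eq_exp_ℂ,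
      Finset.prod_mul_distrib, mul_right_comm, ← Complex.exp_add, mul_comm]
    congr 1
    push_cast
    rw [← Complex.exp_sum]
    congr 1
    simp only [φ]
    rw [← Finset.mul_sum, Finset.sum_sub_distrib]
    simp
    field_simp
    ring
  simp_rw [hL, hR] at key
  rw [integral_fintype_prod_eq_prod (f := fun i (x : ℝ) => Complex.exp (-(k i * x * Complex.I)) *
      (Real.exp (τ / d * (Real.cos x - 1)) : ℝ))] at key
  simp_rw [integral_cexp_mul_circleMeasure] at key
  rw [← Complex.ofReal_prod] at key
  exact Complex.hasSum_ofReal.1 key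

/-- The sign is invisible in the oscillating integrals, but the Poisson series at time d·t has
nonnegative terms. -/
lemma prod_besselKernel_nonneg (hd : 0 < d) (k : Fin d → ℤ) {t : ℝ} (ht : 0 ≤ t) :
    0 ≤ ∏ i, besselKernel t (k i) := by
  have h := hasSum_poisson_transition hd k (τ := d * t) (by positivity)
  have hd' : (d : ℝ) ≠ 0 := by exact_mod_cast hd.ne'
  rw [mul_div_cancel_left₀ _ hd'] at h
  exact h.nonneg fun n => mul_nonneg (by positivity) (transition_nonneg _ _ _)

lemma lintegral_poisson (n : ℕ) :
    ∫⁻ τ in Set.Ioi (0 : ℝ), ENNReal.ofReal (Real.exp (-τ) * τ ^ n / n.factorial) = 1 := by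
  have h := Real.Gamma_nat_eq_factorial n
  have hc := Real.GammaIntegral_convergent (s := n + 1) (by positivity)
  rw [Real.Gamma_eq_integral (by positivity)] at h
  rw [← ofReal_integral_eq_lintegral_ofReal]
  · simp only [add_sub_cancel_right, Real.rpow_natCast] at h
    rw [integral_div, h, div_self (by positivity), ENNReal.ofReal_one]
  · simp only [add_sub_cancel_right, Real.rpow_natCast] at hc
    exact hc.div_const _
  · refine (ae_restrict_mem measurableSet_Ioi).mono fun τ hτ => ?_
    have : (0 : ℝ) < τ := hτ
    show 0 ≤ _
    positivity

/-- Each Poisson weight e^{-τ}τ^n/n! has integral one over τ > 0. Exchanging sum and integral in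
extended nonnegative reals therefore yields convergence and the value at once; the factor d comes
from τ = d·t. -/
theorem hasSum_transition_of_integrableOn (hd : 0 < d) (k : Fin d → ℤ)
    (hi : IntegrableOn (fun t => ∏ i, besselKernel t (k i)) (Set.Ioi 0)) :
    HasSum (fun n => transition n k 0) (d * ∫ t in Set.Ioi (0 : ℝ), ∏ i, besselKernel t (k i)) := by
  have hd' : (0 : ℝ) < d := by exact_mod_cast hd
  have hi' : IntegrableOn (fun τ => ∏ i, besselKernel (τ / d) (k i)) (Set.Ioi 0) := by
    have := (integrableOn_Ioi_comp_mul_right_iff (fun t => ∏ i, besselKernel t (k i)) 0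
      (inv_pos.2 hd')).2 (by simpa using hi)
    simpa [div_eq_mul_inv] using this
  have hint : ∫ τ in Set.Ioi (0 : ℝ), ∏ i, besselKernel (τ / d) (k i)
      = d * ∫ t in Set.Ioi (0 : ℝ), ∏ i, besselKernel t (k i) := by
    have := integral_comp_mul_right_Ioi (fun t => ∏ i, besselKernel t (k i)) 0 (inv_pos.2 hd')
    simpa [div_eq_mul_inv] using this
  have hl : ∑' n, ENNReal.ofReal (transition n k 0)
      = ENNReal.ofReal (∫ τ in Set.Ioi (0 : ℝ), ∏ i, besselKernel (τ / d) (k i)) := by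
    rw [ofReal_integral_eq_lintegral_ofReal hi']
    · have h1 : ∀ n : ℕ, ENNReal.ofReal (transition n k 0) = ∫⁻ τ in Set.Ioi (0 : ℝ),
          ENNReal.ofReal (Real.exp (-τ) * τ ^ n / n.factorial * transition n k 0) := by
        intro n
        rw [setLIntegral_congr_fun measurableSet_Ioi (g := fun τ =>
          ENNReal.ofReal (Real.exp (-τ) * τ ^ n / n.factorial) * ENNReal.ofReal (transition n k 0))]
        · rw [lintegral_mul_const _ (by fun_prop), lintegral_poisson, one_mul]
        · intro τ hτ
          have : (0 : ℝ) < τ := hτ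
          exact ENNReal.ofReal_mul (by positivity)
      simp_rw [h1]
      rw [← lintegral_tsum (fun n => by fun_prop)]
      refine setLIntegral_congr_fun measurableSet_Ioi fun τ hτ => ?_
      have hτ' : (0 : ℝ) < τ := hτ
      have := hasSum_poisson_transition hd k hτ'.le
      rw [← this.tsum_eq, ENNReal.ofReal_tsum_of_nonneg _ this.summable]
      exact fun n => mul_nonneg (by positivity) (transition_nonneg _ _ _)
    · refine (ae_restrict_mem measurableSet_Ioi).mono fun τ hτ => ?_
      have : (0 : ℝ) < τ := hτ
      exact prod_besselKernel_nonneg hd k (by positivity)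
  have hs : Summable fun n => transition n k 0 := by
    have := ENNReal.summable_toReal (hl.trans_ne ENNReal.ofReal_ne_top)
    simpa [ENNReal.toReal_ofReal (transition_nonneg _ _ _)] using this
  rw [← ENNReal.ofReal_tsum_of_nonneg (fun n => transition_nonneg _ _ _) hs,
    ENNReal.ofReal_eq_ofReal_iff (tsum_nonneg fun n => transition_nonneg _ _ _)] at hl
  · rw [← hint, ← hl]; exact hs.hasSum
  · refine setIntegral_nonneg measurableSet_Ioi fun τ hτ => ?_
    have : (0 : ℝ) < τ := hτ
    exact prod_besselKernel_nonneg hd k (by positivity)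

end GraphRellich

/-! ### Contour shift and tilted Gaussian integrals. -/

namespace GraphRellich

open MeasureTheory Real

lemma besselKernel_abs (t : ℝ) (n : ℤ) : besselKernel t |n| = besselKernel t n := by
  unfold besselKernel
  congr 1; ext θ
  rcases abs_choice n with h | h <;> simp [h]

/-- Cauchy's theorem on the rectangle between Re z = 0 and Re z = lam: the horizontal sides cancel
because the integrand is 2πi-periodic, n being an integer. -/
lemma besselKernel_eq_integral_tilted (t lam : ℝ) (n : ℤ) :
    (besselKernel t n : ℂ) = (2 * π)⁻¹ • ∫ θ in (-π)..π,
      Complex.exp (-(n * (lam + θ * Complex.I))) *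
        Complex.exp (t * (Complex.cosh (lam + θ * Complex.I) - 1)) := by
  let f : ℂ → ℂ := fun z => Complex.exp (-(n * z)) * Complex.exp (t * (Complex.cosh z - 1))
  have hper : ∀ x : ℝ, f (x + (-π : ℝ) * Complex.I) = f (x + (π : ℝ) * Complex.I) := by
    intro x
    have e : (x + (-π : ℝ) * Complex.I : ℂ) = (x + (π : ℝ) * Complex.I) - 2 * π * Complex.I := by
      push_cast; ring
    have h1 : Complex.cosh (x + (-π : ℝ) * Complex.I) = Complex.cosh (x + (π : ℝ) * Complex.I) := by
      rw [Complex.cosh_add, Complex.cosh_add]; simp [Complex.sinh_mul_I]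
    have h2 : Complex.exp (-(n * (x + (-π : ℝ) * Complex.I)))
        = Complex.exp (-(n * (x + (π : ℝ) * Complex.I))) := by
      rw [Complex.exp_eq_exp_iff_exists_int]
      exact ⟨n, by push_cast; ring⟩
    simp only [f, h1, h2]
  have hd : Differentiable ℂ f := by simp only [f]; fun_prop
  have key := Complex.integral_boundary_rect_eq_zero_of_differentiableOn f
    (⟨0, -π⟩ : ℂ) (⟨lam, π⟩ : ℂ) hd.differentiableOn
  simp only [hper, sub_self, zero_add] at key
  rw [← smul_sub, smul_eq_zero] at key
  have key' := sub_eq_zero.1 (key.resolve_left Complex.I_ne_zero)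
  have : (∫ θ in (-π)..π, Complex.exp (-(n * (lam + θ * Complex.I))) *
        Complex.exp (t * (Complex.cosh (lam + θ * Complex.I) - 1)))
        = ∫ θ in (-π)..π, f ((0 : ℝ) + θ * Complex.I) := key'
  rw [this, ← integral_cexp_mul_circleMeasure, integral_circleMeasure]
  congr 1
  refine intervalIntegral.integral_congr fun θ _ => ?_
  simp [f, Complex.cosh_mul_I, mul_assoc]

/-- The Gaussian density of variance `t`. -/
noncomputable def gaussKernel (t x : ℝ) : ℝ := (√(2 * π * t))⁻¹ * Real.exp (-x ^ 2 / (2 * t))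

/-- The first Edgeworth correction to `gaussKernel`. -/
noncomputable def gaussCorrection (t x : ℝ) : ℝ :=
  gaussKernel t x * (1 / 8 * (1 / t - 2 * x ^ 2 / t ^ 2 + x ^ 4 / (3 * t ^ 3)))

/-- The tilted Gaussian integrand `z ^ j e^{-xz + tz²/2}` on the line `z = λ + iθ`. -/
noncomputable def tiltedGauss (t lam x : ℝ) (j : ℕ) (θ : ℝ) : ℂ :=
  (lam + θ * Complex.I) ^ j * (Complex.exp (-(x * (lam + θ * Complex.I))) *
    Complex.exp (t * (lam + θ * Complex.I) ^ 2 / 2))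

lemma normSq_tilt (lam θ : ℝ) : ‖(lam + θ * Complex.I : ℂ)‖ ^ 2 = lam ^ 2 + θ ^ 2 := by
  rw [Complex.sq_norm, Complex.normSq_add_mul_I]

lemma norm_exp_half_sq (t lam θ : ℝ) : ‖Complex.exp (t * (lam + θ * Complex.I) ^ 2 / 2)‖ =
    Real.exp (t * (lam ^ 2 - θ ^ 2) / 2) := by
  rw [Complex.norm_exp]
  congr 1
  have : (t * (lam + θ * Complex.I) ^ 2 / 2 : ℂ)
      = ((t * (lam ^ 2 - θ ^ 2) / 2 : ℝ) : ℂ) + ((t * lam * θ : ℝ) : ℂ) * Complex.I := by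
    push_cast
    linear_combination (t * θ ^ 2 / 2 : ℂ) * Complex.I_sq
  rw [this, Complex.add_re, Complex.ofReal_re, Complex.re_ofReal_mul, Complex.I_re]; ring

lemma norm_exp_neg_mul_tilt (x lam θ : ℝ) : ‖Complex.exp (-(x * (lam + θ * Complex.I)))‖ =
    Real.exp (-(x * lam)) := by
  rw [Complex.norm_exp]; simp

lemma pow_le_factorial_mul_exp (n : ℕ) {c y : ℝ} (hc : 0 < c) (hy : 0 ≤ y) :
    y ^ n ≤ n.factorial / c ^ n * Real.exp (c * y) := by
  have := Real.pow_div_factorial_le_exp (c * y) (by positivity) n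
  rw [mul_pow, div_le_iff₀ (by positivity)] at this
  rw [div_mul_eq_mul_div, le_div_iff₀ (by positivity)]
  linarith

lemma integrable_tiltedGauss {t : ℝ} (ht : 0 < t) (lam x : ℝ) (j : ℕ) :
    Integrable (tiltedGauss t lam x j) := by
  have hg := ((integrable_exp_neg_mul_sq (b := t / 4) (by positivity)).const_mul
    ((1 + j.factorial / (t / 4) ^ j * Real.exp (t / 4 * lam ^ 2)) *
      (Real.exp (-(x * lam)) * Real.exp (t * lam ^ 2 / 2))))
  refine hg.mono' (Continuous.aestronglyMeasurable ?_) (Filter.Eventually.of_forall fun θ => ?_)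
  · unfold tiltedGauss; fun_prop
  rw [tiltedGauss, norm_mul, norm_mul, norm_exp_half_sq, norm_exp_neg_mul_tilt, norm_pow]
  set r := ‖(lam + θ * Complex.I : ℂ)‖
  have hr : r ^ 2 = lam ^ 2 + θ ^ 2 := normSq_tilt lam θ
  have h1 : r ^ j ≤ 1 + (r ^ 2) ^ j := by
    rw [← pow_mul, mul_comm 2 j, pow_mul]
    nlinarith [sq_nonneg (r ^ j - 1)]
  have h2 := pow_le_factorial_mul_exp j (c := t / 4) (by positivity) (sq_nonneg r)
  rw [hr, mul_add, Real.exp_add] at h2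
  have h3 : Real.exp (t * (lam ^ 2 - θ ^ 2) / 2)
      = Real.exp (t * lam ^ 2 / 2) * (Real.exp (-(t / 4) * θ ^ 2) * Real.exp (-(t / 4) * θ ^ 2)) := by
    rw [← Real.exp_add, ← Real.exp_add]; congr 1; ring
  have h4 : Real.exp (t / 4 * θ ^ 2) * Real.exp (-(t / 4) * θ ^ 2) = 1 := by
    rw [← Real.exp_add]; simp
  have h5 : Real.exp (-(t / 4) * θ ^ 2) ≤ 1 := Real.exp_le_one_iff.2 (by nlinarith [sq_nonneg θ])
  have h6 : r ^ j * Real.exp (-(t / 4) * θ ^ 2)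
      ≤ 1 + j.factorial / (t / 4) ^ j * Real.exp (t / 4 * lam ^ 2) := by
    rw [hr] at h1
    calc _ ≤ (1 + j.factorial / (t / 4) ^ j * (Real.exp (t / 4 * lam ^ 2) *
            Real.exp (t / 4 * θ ^ 2))) * Real.exp (-(t / 4) * θ ^ 2) := by gcongr; linarith
      _ = Real.exp (-(t / 4) * θ ^ 2) + j.factorial / (t / 4) ^ j * Real.exp (t / 4 * lam ^ 2) *
            (Real.exp (t / 4 * θ ^ 2) * Real.exp (-(t / 4) * θ ^ 2)) := by ring
      _ ≤ _ := by rw [h4, mul_one]; gcongr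
  rw [h3]
  calc _ = (r ^ j * Real.exp (-(t / 4) * θ ^ 2)) * (Real.exp (-(x * lam)) *
        Real.exp (t * lam ^ 2 / 2)) * Real.exp (-(t / 4) * θ ^ 2) := by ring
    _ ≤ _ := by gcongr

lemma integral_tiltedGauss_zero {t : ℝ} (ht : 0 < t) (lam x : ℝ) :
    ∫ θ, tiltedGauss t lam x 0 θ = ((2 * π * gaussKernel t x : ℝ) : ℂ) := by
  have hb : ((-(t / 2) : ℝ) : ℂ).re < 0 := by simp; positivity
  have h := integral_cexp_quadratic hb ((t * lam - x) * Complex.I) (t * lam ^ 2 / 2 - x * lam)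
  have e : ∀ θ : ℝ, tiltedGauss t lam x 0 θ = Complex.exp (((-(t / 2) : ℝ) : ℂ) * θ ^ 2 +
      (t * lam - x) * Complex.I * θ + (t * lam ^ 2 / 2 - x * lam)) := by
    intro θ
    rw [tiltedGauss, pow_zero, one_mul, ← Complex.exp_add]
    congr 1
    push_cast
    linear_combination (t * θ ^ 2 / 2 : ℂ) * Complex.I_sq
  simp_rw [e]
  rw [h]
  have ht' : (t : ℂ) ≠ 0 := by exact_mod_cast ht.ne'
  have e1 : ((π : ℂ) / -((-(t / 2) : ℝ) : ℂ)) ^ (1 / 2 : ℂ) = ((√(2 * π / t) : ℝ) : ℂ) := by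
    rw [Real.sqrt_eq_rpow, Complex.ofReal_cpow (by positivity)]
    push_cast
    congr 1
    field_simp
  have e2 : (t * lam ^ 2 / 2 - x * lam - ((t * lam - x) * Complex.I) ^ 2 /
      (4 * ((-(t / 2) : ℝ) : ℂ)) : ℂ) = ((-x ^ 2 / (2 * t) : ℝ) : ℂ) := by
    push_cast
    rw [mul_pow, Complex.I_sq]
    field_simp
    ring
  rw [e1, e2, gaussKernel, ← Complex.ofReal_exp, ← Complex.ofReal_mul, ← mul_assoc]
  congr 2
  rw [← div_eq_mul_inv, eq_div_iff (by positivity), ← Real.sqrt_mul (by positivity),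
    show 2 * π / t * (2 * π * t) = (2 * π) ^ 2 by field_simp, Real.sqrt_sq (by positivity)]

/-- Integration by parts: the derivative of an integrable function has zero integral. At j = 0 the
truncated index j - 1 is harmless, as its coefficient vanishes. -/
lemma integral_tiltedGauss_succ {t : ℝ} (ht : 0 < t) (lam x : ℝ) (j : ℕ) :
    t * ∫ θ, tiltedGauss t lam x (j + 1) θ =
      x * (∫ θ, tiltedGauss t lam x j θ) - j * ∫ θ, tiltedGauss t lam x (j - 1) θ := by
  have hder : ∀ θ, HasDerivAt (tiltedGauss t lam x j)
      (Complex.I * (t * tiltedGauss t lam x (j + 1) θ - x * tiltedGauss t lam x j θ +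
        j * tiltedGauss t lam x (j - 1) θ)) θ := by
    intro θ
    have hz : HasDerivAt (fun θ : ℝ => (lam + θ * Complex.I : ℂ)) Complex.I θ := by
      simpa using ((Complex.ofRealCLM.hasDerivAt (x := θ)).mul_const Complex.I).const_add (lam : ℂ)
    have h1 := (hz.const_mul (x : ℂ)).neg.cexp
    have h2 := (((hz.pow 2).const_mul (t : ℂ)).div_const 2).cexp
    have h3 := (hz.pow j).mul (h1.mul h2)
    refine h3.congr_deriv ?_
    simp only [tiltedGauss]
    push_cast
    simp
    ring
  have hint := integral_eq_zero_of_hasDerivAt_of_integrable hder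
    (((((integrable_tiltedGauss ht lam x (j + 1)).const_mul (t : ℂ)).sub
      ((integrable_tiltedGauss ht lam x j).const_mul (x : ℂ))).add
      ((integrable_tiltedGauss ht lam x (j - 1)).const_mul (j : ℂ))).const_mul Complex.I)
    (integrable_tiltedGauss ht lam x j)
  rw [integral_const_mul, integral_add, integral_sub, integral_const_mul, integral_const_mul,
    integral_const_mul] at hint
  · have := (mul_eq_zero.1 hint).resolve_left Complex.I_ne_zero
    linear_combination this
  · exact (integrable_tiltedGauss ht lam x (j + 1)).const_mul (t : ℂ)
  · exact (integrable_tiltedGauss ht lam x j).const_mul (x : ℂ)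
  · exact ((integrable_tiltedGauss ht lam x (j + 1)).const_mul (t : ℂ)).sub
      ((integrable_tiltedGauss ht lam x j).const_mul (x : ℂ))
  · exact (integrable_tiltedGauss ht lam x (j - 1)).const_mul (j : ℂ)

/-- Four uses of the recursion produce the Hermite factor x⁴/t⁴ - 6x²/t³ + 3/t². -/
lemma integral_tiltedGauss_four {t : ℝ} (ht : 0 < t) (lam x : ℝ) :
    t / 24 * ∫ θ, tiltedGauss t lam x 4 θ = ((2 * π * gaussCorrection t x : ℝ) : ℂ) := by
  have ht' : (t : ℂ) ≠ 0 := by exact_mod_cast ht.ne'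
  have h0 := integral_tiltedGauss_zero ht lam x
  have h1 := integral_tiltedGauss_succ ht lam x 0
  have h2 := integral_tiltedGauss_succ ht lam x 1
  have h3 := integral_tiltedGauss_succ ht lam x 2
  have h4 := integral_tiltedGauss_succ ht lam x 3
  simp only [zero_add, Nat.reduceAdd, Nat.reduceSub, Nat.sub_self] at h1 h2 h3 h4
  have hdiv : ∀ a b : ℂ, t * a = b → a = b / t := fun a b h => by
    rw [← h, mul_div_cancel_left₀ _ ht']
  rw [hdiv _ _ h4, hdiv _ _ h3, hdiv _ _ h2, hdiv _ _ h1, h0, gaussCorrection]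
  push_cast
  field_simp
  ring

/-- The bound involves Re w instead of ‖w‖: after multiplication by e^B with w = A - B it gives
max(|e^B|, |e^A|), so no Gaussian decay is lost even when ‖w‖ is large. -/
lemma norm_exp_sub_one_sub_le (w : ℂ) :
    ‖Complex.exp w - 1 - w‖ ≤ ‖w‖ ^ 2 * max 1 (Real.exp w.re) := by
  have hle : ∀ s ∈ Set.Icc (0 : ℝ) 1, ‖Complex.exp (s * w)‖ ≤ max 1 (Real.exp w.re) := by
    intro s hs
    rw [Complex.norm_exp]
    have : ((s : ℂ) * w).re = s * w.re := by simp
    rw [this]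
    rcases le_total 0 w.re with h | h
    · exact (Real.exp_le_exp.2 (mul_le_of_le_one_left h hs.2)).trans (le_max_right _ _)
    · exact (Real.exp_le_one_iff.2 (mul_nonpos_of_nonneg_of_nonpos hs.1 h)).trans (le_max_left _ _)
  have hd1 : ∀ s : ℝ, HasDerivAt (fun s : ℝ => Complex.exp (s * w)) (w * Complex.exp (s * w)) s := by
    intro s
    have := ((Complex.ofRealCLM.hasDerivAt (x := s)).mul_const w).cexp
    refine this.congr_deriv ?_
    simp [mul_comm]
  have step1 : ∀ s ∈ Set.Icc (0 : ℝ) 1,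
      ‖Complex.exp (s * w) - 1‖ ≤ ‖w‖ * max 1 (Real.exp w.re) := by
    intro s hs
    have := norm_image_sub_le_of_norm_deriv_le_segment' (f := fun s : ℝ => Complex.exp (s * w))
      (f' := fun s => w * Complex.exp (s * w)) (a := 0) (b := 1)
      (C := ‖w‖ * max 1 (Real.exp w.re)) (fun x _ => (hd1 x).hasDerivWithinAt)
      (fun x hx => by
        rw [norm_mul]
        exact mul_le_mul_of_nonneg_left (hle x ⟨hx.1, hx.2.le⟩) (norm_nonneg _)) s hs
    simp only [Complex.ofReal_zero, zero_mul, Complex.exp_zero, sub_zero] at this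
    exact this.trans (mul_le_of_le_one_right (by positivity) hs.2)
  have hd2 : ∀ s : ℝ, HasDerivAt (fun s : ℝ => Complex.exp (s * w) - s * w)
      (w * (Complex.exp (s * w) - 1)) s := by
    intro s
    have h2 : HasDerivAt (fun s : ℝ => (s : ℂ) * w) w s := by
      simpa using (Complex.ofRealCLM.hasDerivAt (x := s)).mul_const w
    refine ((hd1 s).sub h2).congr_deriv (by ring)
  have := norm_image_sub_le_of_norm_deriv_le_segment_01'
    (f := fun s : ℝ => Complex.exp (s * w) - s * w)
    (C := ‖w‖ * (‖w‖ * max 1 (Real.exp w.re)))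
    (fun x _ => (hd2 x).hasDerivWithinAt) (fun x hx => by
      rw [norm_mul]
      exact mul_le_mul_of_nonneg_left (step1 x ⟨hx.1, hx.2.le⟩) (norm_nonneg _))
  simp only [Complex.ofReal_one, one_mul, Complex.ofReal_zero, zero_mul, Complex.exp_zero,
    sub_zero] at this
  rw [pow_two, mul_assoc, sub_right_comm]
  exact this

lemma norm_cosh_sub_le (z : ℂ) :
    ‖Complex.cosh z - 1 - z ^ 2 / 2 - z ^ 4 / 24‖ ≤ ‖z‖ ^ 6 * Real.exp ‖z‖ := by
  have h1 := Complex.norm_exp_sub_sum_le_norm_mul_exp z 6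
  have h2 := Complex.norm_exp_sub_sum_le_norm_mul_exp (-z) 6
  rw [norm_neg] at h2
  have e : Complex.cosh z - 1 - z ^ 2 / 2 - z ^ 4 / 24 =
      ((Complex.exp z - ∑ m ∈ Finset.range 6, z ^ m / m.factorial) +
        (Complex.exp (-z) - ∑ m ∈ Finset.range 6, (-z) ^ m / m.factorial)) / 2 := by
    simp only [Complex.cosh, Finset.sum_range_succ, Finset.sum_range_zero, Nat.factorial]
    push_cast
    ring
  rw [e, norm_div]
  simp only [Complex.norm_ofNat]
  have := norm_add_le (Complex.exp z - ∑ m ∈ Finset.range 6, z ^ m / m.factorial)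
        (Complex.exp (-z) - ∑ m ∈ Finset.range 6, (-z) ^ m / m.factorial)
  linarith

end GraphRellich

/-! ### Edgeworth expansion of the one-dimensional heat kernel. -/

namespace GraphRellich

open MeasureTheory Real

/-- The real part is cosh lam · cos θ - 1. It is controlled by cosh lam ≤ 1 + lam² and cos θ ≤ 1 -
2θ²/π², with 2/π² ≥ 1/5. -/
lemma re_cosh_tilt_sub_one_le {lam θ : ℝ} (hl : |lam| ≤ 1) (hθ : |θ| ≤ π) :
    (Complex.cosh (lam + θ * Complex.I) - 1).re ≤ lam ^ 2 - θ ^ 2 / 5 := by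
  have hre : (Complex.cosh (lam + θ * Complex.I) - 1).re = Real.cosh lam * Real.cos θ - 1 := by
    rw [Complex.cosh_add, Complex.cosh_mul_I, Complex.sinh_mul_I, ← Complex.ofReal_cosh,
      ← Complex.ofReal_sinh, ← Complex.ofReal_cos, ← Complex.ofReal_sin]
    simp [-Complex.ofReal_cos, -Complex.ofReal_sin, -Complex.ofReal_cosh, -Complex.ofReal_sinh]
  rw [hre]
  have h1 := Real.cos_le_one_sub_mul_cos_sq hθ
  have h2 : Real.cosh lam ≤ 1 + lam ^ 2 := by
    refine (Real.cosh_le_exp_half_sq lam).trans ?_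
    have h := Real.exp_bound_div_one_sub_of_interval (x := lam ^ 2 / 2) (by positivity)
      (by nlinarith [abs_nonneg lam, sq_abs lam])
    have hl2 : lam ^ 2 ≤ 1 := by nlinarith [abs_nonneg lam, sq_abs lam]
    refine h.trans ?_
    rw [div_le_iff₀ (by linarith)]
    nlinarith [sq_nonneg lam]
  have h3 : 1 ≤ Real.cosh lam := Real.one_le_cosh lam
  have h4 : (1 : ℝ) / 5 ≤ 2 / π ^ 2 := by
    rw [div_le_div_iff₀ (by norm_num) (by positivity)]
    nlinarith [pi_lt_d2, pi_pos]
  have h5 := Real.cos_le_one θ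
  nlinarith [sq_nonneg θ, mul_le_mul_of_nonneg_right h4 (sq_nonneg θ)]

/-- Half of the exponential decay pays for the polynomial. -/
lemma one_add_pow_mul_exp_le {y : ℝ} (hy : 0 ≤ y) :
    (1 + y) ^ 4 * Real.exp (-(y / 5)) ≤ 240000 * Real.exp (1 / 10) * Real.exp (-(y / 10)) := by
  have h := pow_le_factorial_mul_exp 4 (c := 1 / 10) (y := 1 + y) (by norm_num) (by linarith)
  have h2 : (Nat.factorial 4 : ℝ) / (1 / 10) ^ 4 = 240000 := by norm_num [Nat.factorial]
  rw [h2] at h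
  calc _ ≤ 240000 * Real.exp (1 / 10 * (1 + y)) * Real.exp (-(y / 5)) := by gcongr
    _ = _ := by
      rw [mul_assoc, mul_assoc, ← Real.exp_add, ← Real.exp_add]; congr 2; ring

/-- The constant in the pointwise estimate of the tilted symbols. -/
noncomputable def symbolConst : ℝ :=
  Real.exp 1 * ((1 + 17 * Real.exp 4) ^ 2 + Real.exp 4 + 2) * (240000 * Real.exp (1 / 10))

lemma symbol_sub_le_of_abs_le {t lam θ : ℝ} (ht : 1 ≤ t) (hl : t * lam ^ 2 = 1) (hθ : |θ| ≤ π) :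
    ‖Complex.exp (t * (Complex.cosh (lam + θ * Complex.I) - 1)) -
      Complex.exp (t * (lam + θ * Complex.I) ^ 2 / 2) * (1 + t * (lam + θ * Complex.I) ^ 4 / 24)‖ ≤
      symbolConst / t ^ 2 * Real.exp (-(t * θ ^ 2 / 10)) := by
  have ht0 : 0 < t := by linarith
  have hl1 : lam ^ 2 ≤ 1 := by nlinarith [sq_nonneg lam]
  have hl2 : |lam| ≤ 1 := abs_le_one_iff_mul_self_le_one.2 (by nlinarith)
  have hAre := re_cosh_tilt_sub_one_le hl2 hθ
  have hr2 := normSq_tilt lam θ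
  have hBn := norm_exp_half_sq t lam θ
  set z : ℂ := lam + θ * Complex.I with hz
  set r := ‖z‖ with hr
  have hr0 : 0 ≤ r := norm_nonneg _
  set A : ℂ := t * (Complex.cosh z - 1) with hA
  set B : ℂ := t * z ^ 2 / 2 with hB
  set D : ℂ := t * z ^ 4 / 24 with hD
  have hθ2 : θ ^ 2 ≤ 10 := by
    have : θ ^ 2 ≤ π ^ 2 := by rw [← sq_abs θ]; gcongr
    nlinarith [pi_lt_d2, pi_pos]
  have hr4 : r ≤ 4 := by nlinarith
  -- With t·lam² = 1 this is 1 + tθ², the natural scale: the quartic term D is O(Y²/t) and the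
  -- remaining Taylor error is O(Y³/t²). Both the square of the first and the second then fit under
  -- Y⁴/t².
  set Y := t * r ^ 2 with hY
  have hYe : Y = 1 + t * θ ^ 2 := by rw [hY, hr2, mul_add, hl]
  have hY1 : 1 ≤ Y := by rw [hYe]; nlinarith [sq_nonneg θ]
  have hwD : ‖A - B - D‖ ≤ Real.exp 4 * Y ^ 3 / t ^ 2 := by
    have e : A - B - D = t * (Complex.cosh z - 1 - z ^ 2 / 2 - z ^ 4 / 24) := by
      rw [hA, hB, hD]; ring
    rw [e, norm_mul, Complex.norm_real, Real.norm_of_nonneg ht0.le]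
    have := norm_cosh_sub_le z
    calc _ ≤ t * (r ^ 6 * Real.exp 4) := by
            gcongr; exact this.trans (by gcongr)
      _ = _ := by rw [hY]; field_simp
  have hDn : ‖D‖ ≤ Y ^ 2 / t := by
    rw [hD, norm_div, norm_mul, norm_pow, Complex.norm_real, Real.norm_of_nonneg ht0.le, ← hr]
    have : Y ^ 2 / t = t * r ^ 4 := by rw [hY]; field_simp
    rw [this]
    simp only [Complex.norm_ofNat]
    have : 0 ≤ t * r ^ 4 := by positivity
    linarith
  have hYt : Y ≤ 16 * t := by rw [hY]; nlinarith
  have hw : ‖A - B‖ ≤ (1 + 17 * Real.exp 4) * Y ^ 2 / t := by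
    have h1 : ‖A - B‖ ≤ ‖A - B - D‖ + ‖D‖ := by
      have := norm_add_le (A - B - D) D
      rwa [sub_add_cancel] at this
    have h2 : Real.exp 4 * Y ^ 3 / t ^ 2 ≤ 16 * Real.exp 4 * Y ^ 2 / t := by
      rw [div_le_div_iff₀ (by positivity) ht0]
      have : Real.exp 4 * Y ^ 2 * t * Y ≤ Real.exp 4 * Y ^ 2 * t * (16 * t) := by gcongr
      nlinarith
    have h3 : (1 + 17 * Real.exp 4) * Y ^ 2 / t
        = 16 * Real.exp 4 * Y ^ 2 / t + Y ^ 2 / t + Real.exp 4 * Y ^ 2 / t := by ring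
    have h4 : 0 ≤ Real.exp 4 * Y ^ 2 / t := by positivity
    linarith
  have hExpA : ‖Complex.exp A‖ ≤ Real.exp 1 * Real.exp (-(t * θ ^ 2 / 5)) := by
    rw [Complex.norm_exp, ← Real.exp_add, hA, Complex.re_ofReal_mul]
    gcongr
    nlinarith [mul_le_mul_of_nonneg_left hAre ht0.le]
  have hExpB : ‖Complex.exp B‖ ≤ Real.exp 1 * Real.exp (-(t * θ ^ 2 / 5)) := by
    rw [hBn, ← Real.exp_add]
    gcongr
    nlinarith [sq_nonneg θ, mul_nonneg ht0.le (sq_nonneg θ)]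
  set M := Real.exp 1 * Real.exp (-(t * θ ^ 2 / 5))
  -- The product is max(|e^B|, |e^A|), and both exponentials have been given the same Gaussian
  -- majorant.
  have hmax : ‖Complex.exp B‖ * max 1 (Real.exp (A - B).re) ≤ M := by
    rw [mul_max_of_nonneg _ _ (norm_nonneg _), mul_one, ← Complex.norm_exp, ← norm_mul,
      ← Complex.exp_add, add_sub_cancel]
    exact max_le hExpB hExpA
  have e : Complex.exp A - Complex.exp B * (1 + D) =
      Complex.exp B * (Complex.exp (A - B) - 1 - (A - B)) + Complex.exp B * (A - B - D) := by
    have : Complex.exp A = Complex.exp B * Complex.exp (A - B) := by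
      rw [← Complex.exp_add, add_sub_cancel]
    rw [this]; ring
  rw [e]
  have hY4 : Y ^ 3 ≤ Y ^ 4 := pow_le_pow_right₀ hY1 (by norm_num)
  calc _ ≤ ‖Complex.exp B‖ * (‖A - B‖ ^ 2 * max 1 (Real.exp (A - B).re)) +
        ‖Complex.exp B‖ * ‖A - B - D‖ := by
        refine (norm_add_le _ _).trans ?_
        rw [norm_mul, norm_mul]
        gcongr
        exact norm_exp_sub_one_sub_le _
    _ = ‖A - B‖ ^ 2 * (‖Complex.exp B‖ * max 1 (Real.exp (A - B).re)) +
        ‖Complex.exp B‖ * ‖A - B - D‖ := by ring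
    _ ≤ ((1 + 17 * Real.exp 4) * Y ^ 2 / t) ^ 2 * M + M * (Real.exp 4 * Y ^ 4 / t ^ 2) := by
        gcongr
        exact hwD.trans (by gcongr)
    _ = Real.exp 1 * ((1 + 17 * Real.exp 4) ^ 2 + Real.exp 4) / t ^ 2 *
        ((1 + t * θ ^ 2) ^ 4 * Real.exp (-(t * θ ^ 2 / 5))) := by
        simp only [M]; rw [hYe]; field_simp
    _ ≤ Real.exp 1 * ((1 + 17 * Real.exp 4) ^ 2 + Real.exp 4 + 2) / t ^ 2 *
        (240000 * Real.exp (1 / 10) * Real.exp (-(t * θ ^ 2 / 10))) := by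
        refine mul_le_mul ?_ (one_add_pow_mul_exp_le (by positivity)) (by positivity)
          (by positivity)
        exact div_le_div_of_nonneg_right
          (mul_le_mul_of_nonneg_left (by linarith) (by positivity)) (by positivity)
    _ = _ := by rw [symbolConst]; ring

/-- Beyond the period only the Gaussian side remains. There t ≤ Y = 1 + tθ², so inserting Y²/t² ≥ 1
produces the required factor t^{-2}. -/
lemma gauss_symbol_le_of_lt_abs {t lam θ : ℝ} (ht : 1 ≤ t) (hl : t * lam ^ 2 = 1) (hθ : π < |θ|) :
    ‖Complex.exp (t * (lam + θ * Complex.I) ^ 2 / 2) * (1 + t * (lam + θ * Complex.I) ^ 4 / 24)‖ ≤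
      symbolConst / t ^ 2 * Real.exp (-(t * θ ^ 2 / 10)) := by
  have ht0 : 0 < t := by linarith
  have hr2 := normSq_tilt lam θ
  rw [norm_mul, norm_exp_half_sq]
  set z : ℂ := lam + θ * Complex.I with hz
  set r := ‖z‖ with hr
  set Y := t * r ^ 2 with hY
  have hYe : Y = 1 + t * θ ^ 2 := by rw [hY, hr2, mul_add, hl]
  have hθ2 : 1 ≤ θ ^ 2 := by
    rw [← sq_abs θ]; nlinarith [pi_gt_three]
  have hY1 : 1 ≤ Y := by rw [hYe]; nlinarith
  have hYt : t ≤ Y := by rw [hYe]; nlinarith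
  have hD : ‖1 + t * z ^ 4 / 24‖ ≤ 2 * Y ^ 2 := by
    refine (norm_add_le _ _).trans ?_
    rw [norm_one, norm_div, norm_mul, norm_pow, Complex.norm_real, Real.norm_of_nonneg ht0.le, ← hr]
    have h : t * r ^ 4 ≤ Y ^ 2 := by
      have : Y ^ 2 = t * (t * r ^ 4) := by rw [hY]; ring
      rw [this]
      exact le_mul_of_one_le_left (by positivity) ht
    simp only [Complex.norm_ofNat]
    have : 0 ≤ t * r ^ 4 := by positivity
    nlinarith
  have hB : Real.exp (t * (lam ^ 2 - θ ^ 2) / 2) ≤ Real.exp 1 * Real.exp (-(t * θ ^ 2 / 5)) := by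
    rw [← Real.exp_add]
    gcongr
    nlinarith [mul_nonneg ht0.le (sq_nonneg θ)]
  have h1 : 2 * Y ^ 2 ≤ 2 / t ^ 2 * Y ^ 4 := by
    rw [div_mul_eq_mul_div, le_div_iff₀ (by positivity)]
    have : t ^ 2 ≤ Y ^ 2 := by gcongr
    nlinarith [sq_nonneg Y]
  calc _ ≤ (Real.exp 1 * Real.exp (-(t * θ ^ 2 / 5))) * (2 / t ^ 2 * Y ^ 4) := by
        gcongr; exact hD.trans h1
    _ = Real.exp 1 * 2 / t ^ 2 * ((1 + t * θ ^ 2) ^ 4 * Real.exp (-(t * θ ^ 2 / 5))) := by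
        rw [hYe]; ring
    _ ≤ Real.exp 1 * ((1 + 17 * Real.exp 4) ^ 2 + Real.exp 4 + 2) / t ^ 2 *
        (240000 * Real.exp (1 / 10) * Real.exp (-(t * θ ^ 2 / 10))) := by
        refine mul_le_mul ?_ (one_add_pow_mul_exp_le (by positivity)) (by positivity)
          (by positivity)
        gcongr
        have : 0 ≤ (1 + 17 * Real.exp 4) ^ 2 + Real.exp 4 := by positivity
        linarith
    _ = _ := by rw [symbolConst]; ring

lemma gaussKernel_abs (t x : ℝ) : gaussKernel t |x| = gaussKernel t x := by
  simp [gaussKernel]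

lemma gaussCorrection_abs (t x : ℝ) : gaussCorrection t |x| = gaussCorrection t x := by
  simp only [gaussCorrection, gaussKernel_abs, sq_abs, Even.pow_abs (show Even 4 by decide)]

/-- First-order Edgeworth expansion of the heat kernel on `ℤ`, with an exponential tail. -/
theorem abs_besselKernel_sub_le : ∃ C : ℝ, 0 ≤ C ∧ ∀ t : ℝ, 1 ≤ t → ∀ n : ℤ,
    |besselKernel t n - gaussKernel t n - gaussCorrection t n| ≤
      C / √t ^ 5 * Real.exp (-(|(n : ℝ)| / √t)) := by
  have hC0 : 0 ≤ symbolConst := by unfold symbolConst; positivity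
  refine ⟨symbolConst * √(10 * π), by positivity, fun t ht n => ?_⟩
  have ht0 : 0 < t := by linarith
  have hs : 0 < √t := Real.sqrt_pos.2 ht0
  -- This tilt keeps e^{t·lam²} bounded while e^{-lam·|n|} supplies the tail e^{-|n|/√t}.
  set lam : ℝ := 1 / √t with hlam
  have hl : t * lam ^ 2 = 1 := by
    rw [hlam, div_pow, Real.sq_sqrt ht0.le]; field_simp
  -- All terms are even in n; passing to |n| makes the positive tilt decay for both signs.
  rw [← gaussKernel_abs t n, ← gaussCorrection_abs t n]
  set x : ℝ := |(n : ℝ)| with hx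
  have hxn : (x : ℂ) = ((|n| : ℤ) : ℂ) := by
    rw [hx, ← Int.cast_abs, Complex.ofReal_intCast]
  let A : ℝ → ℂ := fun θ => Complex.exp (-(x * (lam + θ * Complex.I))) *
    Complex.exp (t * (Complex.cosh (lam + θ * Complex.I) - 1))
  let F : ℝ → ℂ := fun θ => (Set.Icc (-π) π).indicator A θ - tiltedGauss t lam x 0 θ -
    t / 24 * tiltedGauss t lam x 4 θ
  have hFb : ∀ θ, ‖F θ‖ ≤ Real.exp (-(x / √t)) * (symbolConst / t ^ 2) *
      Real.exp (-(t / 10) * θ ^ 2) := by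
    intro θ
    have hxl : x * lam = x / √t := by rw [hlam]; ring
    have e : t * θ ^ 2 / 10 = (t / 10) * θ ^ 2 := by ring
    rw [mul_assoc, neg_mul, ← e, ← hxl, ← norm_exp_neg_mul_tilt x lam θ]
    by_cases hθ : θ ∈ Set.Icc (-π) π
    · have e : F θ = Complex.exp (-(x * (lam + θ * Complex.I))) *
          (Complex.exp (t * (Complex.cosh (lam + θ * Complex.I) - 1)) -
          Complex.exp (t * (lam + θ * Complex.I) ^ 2 / 2) *
            (1 + t * (lam + θ * Complex.I) ^ 4 / 24)) := by
        simp only [F, A, Set.indicator_of_mem hθ, tiltedGauss]; ring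
      rw [e, norm_mul]
      gcongr
      exact symbol_sub_le_of_abs_le ht hl (abs_le.2 hθ)
    · have e : F θ = -(Complex.exp (-(x * (lam + θ * Complex.I))) *
          (Complex.exp (t * (lam + θ * Complex.I) ^ 2 / 2) *
            (1 + t * (lam + θ * Complex.I) ^ 4 / 24))) := by
        simp only [F, A, Set.indicator_of_notMem hθ, tiltedGauss]; ring
      rw [e, norm_neg, norm_mul]
      gcongr
      exact gauss_symbol_le_of_lt_abs ht hl (not_le.1 fun h => hθ (abs_le.1 h))
  have hAi : Integrable ((Set.Icc (-π) π).indicator A) := by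
    rw [integrable_indicator_iff measurableSet_Icc]
    exact Continuous.integrableOn_Icc (by simp only [A]; fun_prop)
  have hint : ∫ θ, F θ = ((2 * π * (besselKernel t n - gaussKernel t x - gaussCorrection t x) : ℝ) :
      ℂ) := by
    simp only [F]
    have h0 : Integrable fun θ => (Set.Icc (-π) π).indicator A θ - tiltedGauss t lam x 0 θ :=
      hAi.sub (integrable_tiltedGauss ht0 lam x 0)
    rw [integral_sub h0
      ((integrable_tiltedGauss ht0 lam x 4).const_mul _), integral_sub hAi
      (integrable_tiltedGauss ht0 lam x 0), integral_const_mul, integral_tiltedGauss_four ht0,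
      integral_tiltedGauss_zero ht0, integral_indicator measurableSet_Icc,
      integral_Icc_eq_integral_Ioc, ← intervalIntegral.integral_of_le (by linarith [pi_pos])]
    have h := besselKernel_eq_integral_tilted t lam |n|
    rw [besselKernel_abs, ← hxn] at h
    have h2 : ∫ θ in (-π)..π, A θ = ((2 * π * besselKernel t n : ℝ) : ℂ) := by
      rw [Complex.ofReal_mul, h, Complex.real_smul, ← mul_assoc, ← Complex.ofReal_mul,
        mul_inv_cancel₀ (by positivity), Complex.ofReal_one, one_mul]
    rw [h2]
    push_cast
    ring
  have hnorm := norm_integral_le_of_norm_le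
    ((integrable_exp_neg_mul_sq (b := t / 10) (by positivity)).const_mul _)
    (Filter.Eventually.of_forall hFb)
  rw [hint, Complex.norm_real, Real.norm_eq_abs, abs_mul, abs_of_pos (by positivity : 0 < 2 * π),
    integral_const_mul, integral_gaussian] at hnorm
  have hpi : π / (t / 10) = 10 * π / t := by field_simp
  have hs5 : √t ^ 5 = t ^ 2 * √t := by
    rw [show √t ^ 5 = (√t ^ 2) ^ 2 * √t by ring, Real.sq_sqrt ht0.le]
  rw [hpi, Real.sqrt_div (by positivity)] at hnorm
  have h2 : 1 ≤ 2 * π := by linarith [pi_gt_three]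
  refine (le_mul_of_one_le_left (abs_nonneg _) h2).trans (hnorm.trans_eq ?_)
  rw [hs5]
  field_simp

end GraphRellich

/-! ### Products over coordinates: the heat kernel on the lattice. -/

namespace GraphRellich

open MeasureTheory Real

section Products

variable {ι : Type*} {a b h u : ι → ℝ} {K ε : ℝ}

lemma abs_prod_mul_sum_le (hK : 1 ≤ K) (hε : 0 ≤ ε)
    (hu : ∀ i, 0 ≤ u i) (hb : ∀ i, |b i| ≤ K * u i) (hc : ∀ i, |b i * h i| ≤ K * ε * u i)
    (s : Finset ι) :
    |∏ i ∈ s, b i| ≤ (6 * K) ^ s.card * ∏ i ∈ s, u i ∧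
    |(∏ i ∈ s, b i) * ∑ i ∈ s, h i| ≤ (6 * K) ^ s.card * ε * ∏ i ∈ s, u i := by
  classical
  induction s using Finset.induction_on with
  | empty => simp [hε]
  | insert i s hi ih =>
    obtain ⟨ih1, ih2⟩ := ih
    rw [Finset.prod_insert hi, Finset.prod_insert hi, Finset.sum_insert hi,
      Finset.card_insert_of_notMem hi, pow_succ]
    set B := ∏ i ∈ s, b i
    set U := ∏ i ∈ s, u i
    set H := ∑ i ∈ s, h i
    set C := (6 * K) ^ s.card
    have hU : 0 ≤ U := Finset.prod_nonneg fun i _ => hu i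
    have hC : 0 ≤ C := by positivity
    have h0 := hu i
    constructor
    · rw [abs_mul]
      calc _ ≤ (K * u i) * (C * U) := mul_le_mul (hb i) ih1 (abs_nonneg _) (by positivity)
        _ ≤ C * (6 * K) * (u i * U) := by
          have : 0 ≤ K * C * (u i * U) := by positivity
          nlinarith
    · have e : b i * B * (h i + H) = (b i * h i) * B + b i * (B * H) := by ring
      rw [e]
      refine (abs_add_le _ _).trans ?_
      rw [abs_mul (b i * h i), abs_mul (b i) (B * H)]
      calc _ ≤ (K * ε * u i) * (C * U) + (K * u i) * (C * ε * U) :=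
            add_le_add (mul_le_mul (hc i) ih1 (abs_nonneg _) (by positivity))
              (mul_le_mul (hb i) ih2 (abs_nonneg _) (by positivity))
        _ ≤ C * (6 * K) * ε * (u i * U) := by
          have : 0 ≤ K * C * ε * (u i * U) := by positivity
          nlinarith

/-- The relative corrections h_i are of size ε, so the product expands to first order with error ε².
Adding a factor creates four error terms with weights 3, 1, 1, 1, which explains the 6 in (6K)^card.
-/
lemma abs_prod_sub_le (hK : 1 ≤ K) (hε : 0 ≤ ε) (hε1 : ε ≤ 1)
    (hu : ∀ i, 0 ≤ u i) (hb : ∀ i, |b i| ≤ K * u i) (hc : ∀ i, |b i * h i| ≤ K * ε * u i)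
    (ha : ∀ i, |a i - b i - b i * h i| ≤ K * ε ^ 2 * u i) (s : Finset ι) :
    |∏ i ∈ s, a i - (∏ i ∈ s, b i) * (1 + ∑ i ∈ s, h i)| ≤
      (6 * K) ^ s.card * ε ^ 2 * ∏ i ∈ s, u i := by
  classical
  induction s using Finset.induction_on with
  | empty => simp; positivity
  | insert i s hi ih =>
    obtain ⟨h1, h2⟩ := abs_prod_mul_sum_le hK hε hu hb hc s
    rw [Finset.prod_insert hi, Finset.prod_insert hi, Finset.prod_insert hi, Finset.sum_insert hi,
      Finset.card_insert_of_notMem hi, pow_succ]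
    set A := ∏ i ∈ s, a i
    set B := ∏ i ∈ s, b i
    set U := ∏ i ∈ s, u i
    set H := ∑ i ∈ s, h i
    set C := (6 * K) ^ s.card
    have hU : 0 ≤ U := Finset.prod_nonneg fun i _ => hu i
    have hC : 0 ≤ C := by positivity
    have h0 := hu i
    set R := A - B * (1 + H) with hR
    have hA : |A| ≤ 3 * C * U := by
      have e : A = B + B * H + R := by rw [hR]; ring
      rw [e]
      refine (abs_add_le _ _).trans ((add_le_add_left (abs_add_le _ _) _).trans ?_)
      have h3 : C * ε * U ≤ C * U := by
        have : 0 ≤ C * U := by positivity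
        nlinarith
      have h4 : C * ε ^ 2 * U ≤ C * U := by
        have : 0 ≤ C * U := by positivity
        nlinarith [pow_le_one₀ (n := 2) hε hε1]
      linarith
    have e : a i * A - b i * B * (1 + (h i + H)) =
        (a i - b i - b i * h i) * A + (b i * h i) * (B * H) + b i * R + (b i * h i) * R := by
      rw [hR]; ring
    rw [e]
    refine (abs_add_le _ _).trans ((add_le_add_left (abs_add_le _ _) _).trans
      ((add_le_add_left (add_le_add_left (abs_add_le _ _) _) _).trans ?_))
    rw [abs_mul, abs_mul (b i * h i), abs_mul (b i) R, abs_mul (b i * h i)]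
    calc _ ≤ (K * ε ^ 2 * u i) * (3 * C * U) + (K * ε * u i) * (C * ε * U) +
          (K * u i) * (C * ε ^ 2 * U) + (K * ε * u i) * (C * ε ^ 2 * U) := by
          gcongr
          · exact ha i
          · exact hc i
          · exact hb i
          · exact hc i
      _ ≤ (K * ε ^ 2 * u i) * (3 * C * U) + (K * ε * u i) * (C * ε * U) +
          (K * u i) * (C * ε ^ 2 * U) + (K * 1 * u i) * (C * ε ^ 2 * U) := by gcongr
      _ = C * (6 * K) * ε ^ 2 * (u i * U) := by ring

end Products

/-- The polynomial factor of the Edgeworth correction: `gaussCorrection = gaussKernel * gaussPoly`. -/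
noncomputable def gaussPoly (t x : ℝ) : ℝ :=
  1 / 8 * (1 / t - 2 * x ^ 2 / t ^ 2 + x ^ 4 / (3 * t ^ 3))

lemma gaussKernel_nonneg (t x : ℝ) : 0 ≤ gaussKernel t x := by unfold gaussKernel; positivity

lemma gaussKernel_le {t : ℝ} (ht : 0 < t) (x : ℝ) :
    gaussKernel t x ≤ 1 / √t * Real.exp (-(x ^ 2 / t) / 2) := by
  unfold gaussKernel
  rw [one_div, show -x ^ 2 / (2 * t) = -(x ^ 2 / t) / 2 by field_simp]
  refine mul_le_mul_of_nonneg_right ?_ (Real.exp_nonneg _)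
  exact inv_anti₀ (Real.sqrt_pos.2 ht) (Real.sqrt_le_sqrt (by nlinarith [pi_gt_three]))

lemma abs_gaussKernel_le {t : ℝ} (ht : 0 < t) (x : ℝ) :
    |gaussKernel t x| ≤ (32 * Real.exp 2) * (1 / √t * Real.exp (-(|x| / √t))) := by
  rw [abs_of_nonneg (gaussKernel_nonneg t x)]
  refine (gaussKernel_le ht x).trans ?_
  have hy : x ^ 2 / t = (|x| / √t) ^ 2 := by rw [div_pow, sq_abs, Real.sq_sqrt ht.le]
  rw [hy]
  set y := |x| / √t
  have h1 : Real.exp (-y ^ 2 / 2) ≤ Real.exp 2 * Real.exp (-y) := by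
    rw [← Real.exp_add]; gcongr; nlinarith [sq_nonneg (y - 1)]
  calc _ ≤ 1 / √t * (Real.exp 2 * Real.exp (-y)) := by gcongr
    _ ≤ _ := by
      have : 0 ≤ 1 / √t * (Real.exp 2 * Real.exp (-y)) := by positivity
      nlinarith

lemma abs_gaussKernel_mul_poly_le {t : ℝ} (ht : 0 < t) (x : ℝ) :
    |gaussKernel t x * gaussPoly t x| ≤
      (32 * Real.exp 2) * (1 / t) * (1 / √t * Real.exp (-(|x| / √t))) := by
  rw [abs_mul, abs_of_nonneg (gaussKernel_nonneg t x)]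
  have hy : x ^ 2 / t = (|x| / √t) ^ 2 := by rw [div_pow, sq_abs, Real.sq_sqrt ht.le]
  have hK := gaussKernel_le ht x
  have hp : gaussPoly t x = 1 / 8 * (1 / t) * (1 - 2 * (x ^ 2 / t) + (x ^ 2 / t) ^ 2 / 3) := by
    unfold gaussPoly; field_simp
  rw [hp]
  rw [hy] at hK ⊢
  set y := |x| / √t
  have hpoly : |1 / 8 * (1 / t) * (1 - 2 * y ^ 2 + (y ^ 2) ^ 2 / 3)| ≤ (1 / t) * (1 + y ^ 2) ^ 2 := by
    rw [abs_mul, abs_of_pos (by positivity : 0 < 1 / 8 * (1 / t))]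
    have : |1 - 2 * y ^ 2 + (y ^ 2) ^ 2 / 3| ≤ (1 + y ^ 2) ^ 2 := by
      rw [abs_le]; constructor <;> nlinarith [sq_nonneg y, sq_nonneg (y ^ 2)]
    calc _ ≤ 1 / 8 * (1 / t) * (1 + y ^ 2) ^ 2 := by gcongr
      _ ≤ _ := by
        have : 0 ≤ 1 / t * (1 + y ^ 2) ^ 2 := by positivity
        nlinarith
  have hq := pow_le_factorial_mul_exp 2 (c := 1 / 4) (y := 1 + y ^ 2) (by norm_num) (by positivity)
  have h32 : (Nat.factorial 2 : ℝ) / (1 / 4) ^ 2 = 32 := by norm_num [Nat.factorial]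
  rw [h32] at hq
  have h1 : Real.exp (1 / 4 * (1 + y ^ 2)) * Real.exp (-y ^ 2 / 2) ≤
      Real.exp 2 * Real.exp (-y) := by
    rw [← Real.exp_add, ← Real.exp_add, Real.exp_le_exp]; nlinarith [sq_nonneg (y - 2)]
  calc _ ≤ (1 / √t * Real.exp (-y ^ 2 / 2)) * ((1 / t) * (32 * Real.exp (1 / 4 * (1 + y ^ 2)))) := by
        gcongr
        exact hpoly.trans (by gcongr)
    _ = 1 / √t * (1 / t) * 32 * (Real.exp (1 / 4 * (1 + y ^ 2)) * Real.exp (-y ^ 2 / 2)) := by ring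
    _ ≤ 1 / √t * (1 / t) * 32 * (Real.exp 2 * Real.exp (-y)) := by gcongr
    _ = _ := by ring

lemma continuous_besselKernel (n : ℤ) : Continuous fun t => besselKernel t n := by
  simp only [besselKernel, integral_circleMeasure]
  exact (intervalIntegral.continuous_parametric_intervalIntegral_of_continuous' (μ := volume)
    (f := fun t θ : ℝ => Real.cos (n * θ) * Real.exp (t * (Real.cos θ - 1)))
    (by fun_prop) (-π) π).const_smul (2 * π)⁻¹

/-- For small times, where the expansion is unavailable, the contour is shifted by 1 instead of
1/√t. -/
lemma abs_besselKernel_le_exp {t : ℝ} (ht : 0 ≤ t) (ht1 : t ≤ 1) (n : ℤ) :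
    |besselKernel t n| ≤ Real.exp 1 * Real.exp (-|(n : ℝ)|) := by
  have h := besselKernel_eq_integral_tilted t 1 |n|
  rw [besselKernel_abs] at h
  have hn := congrArg norm h
  rw [Complex.norm_real, Real.norm_eq_abs, norm_smul, Real.norm_of_nonneg (by positivity)] at hn
  rw [hn]
  have hb := intervalIntegral.norm_integral_le_of_norm_le_const (a := -π) (b := π)
    (C := Real.exp 1 * Real.exp (-|(n : ℝ)|))
    (f := fun θ : ℝ => Complex.exp (-((|n| : ℤ) * ((1 : ℝ) + θ * Complex.I))) *
        Complex.exp (t * (Complex.cosh ((1 : ℝ) + θ * Complex.I) - 1))) (by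
    intro θ hθ
    rw [Set.uIoc_of_le (by linarith [pi_pos])] at hθ
    have h1 := norm_exp_neg_mul_tilt |(n : ℝ)| 1 θ
    have h2 := re_cosh_tilt_sub_one_le (lam := 1) (θ := θ) (by simp) (abs_le.2 ⟨hθ.1.le, hθ.2⟩)
    rw [norm_mul, mul_comm]
    have e : (((|n| : ℤ) : ℂ)) = ((|(n : ℝ)| : ℝ) : ℂ) := by
      rw [← Int.cast_abs, Complex.ofReal_intCast]
    rw [e, h1, mul_one]
    gcongr
    rw [Complex.norm_exp, Complex.re_ofReal_mul]
    gcongr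
    nlinarith [sq_nonneg θ])
  calc _ ≤ (2 * π)⁻¹ * (Real.exp 1 * Real.exp (-|(n : ℝ)|) * |π - -π|) := by gcongr
    _ = _ := by
      rw [show π - -π = 2 * π by ring, abs_of_pos two_pi_pos]
      field_simp

variable {d : ℕ}

lemma latticeNorm_le_sum_abs (k : Fin d → ℤ) : latticeNorm k ≤ ∑ i, |(k i : ℝ)| := by
  refine abs_le_of_sq_le_sq' ?_ (Finset.sum_nonneg fun _ _ => abs_nonneg _) |>.2
  rw [latticeNorm_sq]
  calc _ = ∑ i, |(k i : ℝ)| ^ 2 := by simp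
    _ ≤ _ := Finset.sum_sq_le_sq_sum_of_nonneg fun _ _ => abs_nonneg _

/-- The leading terms of the heat kernel on `ℤ^d`. -/
noncomputable def heatApprox (k : Fin d → ℤ) (t : ℝ) : ℝ :=
  (∏ i, gaussKernel t (k i)) * (1 + ∑ i, gaussPoly t (k i))

lemma prod_envelope_le (k : Fin d → ℤ) (t : ℝ) :
    ∏ i, (1 / √t * Real.exp (-(|(k i : ℝ)| / √t))) ≤
      1 / √t ^ d * Real.exp (-(latticeNorm k / √t)) := by
  rw [Finset.prod_mul_distrib, ← Real.exp_sum, Finset.sum_neg_distrib, ← Finset.sum_div]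
  simp only [Finset.prod_const, Finset.card_univ, Fintype.card_fin, one_div, inv_pow]
  gcongr
  exact latticeNorm_le_sum_abs k

/-- The product expansion is used with ε = 1/t. For t ≤ 1 the approximation is not compared with the
kernel but fits under the same envelope by itself, since 1 and 1/t are then at most 1/t². -/
theorem abs_prod_besselKernel_sub_heatApprox_le (d : ℕ) : ∃ C : ℝ, 0 ≤ C ∧
    (∀ t : ℝ, 1 ≤ t → ∀ k : Fin d → ℤ, |∏ i, besselKernel t (k i) - heatApprox k t| ≤
      C * (1 / t ^ 2 * (1 / √t ^ d) * Real.exp (-(latticeNorm k / √t)))) ∧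
    (∀ t : ℝ, 0 < t → t ≤ 1 → ∀ k : Fin d → ℤ, |heatApprox k t| ≤
      C * (1 / t ^ 2 * (1 / √t ^ d) * Real.exp (-(latticeNorm k / √t)))) := by
  obtain ⟨C, hC, h⟩ := abs_besselKernel_sub_le
  set K := 32 * Real.exp 2 + C with hK
  have hexp : 1 ≤ Real.exp 2 := Real.one_le_exp (by norm_num)
  have hK1 : 1 ≤ K := by rw [hK]; linarith
  have hle : 32 * Real.exp 2 ≤ K := by rw [hK]; linarith
  have hb : ∀ (k : Fin d → ℤ) {t : ℝ} (ht : 0 < t) i, |gaussKernel t (k i)| ≤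
      K * (1 / √t * Real.exp (-(|(k i : ℝ)| / √t))) := fun k t ht i =>
    (abs_gaussKernel_le ht _).trans (by gcongr)
  have hc : ∀ (k : Fin d → ℤ) {t : ℝ} (ht : 0 < t) i, |gaussKernel t (k i) * gaussPoly t (k i)| ≤
      K * (1 / t) * (1 / √t * Real.exp (-(|(k i : ℝ)| / √t))) := fun k t ht i =>
    (abs_gaussKernel_mul_poly_le ht _).trans (by gcongr)
  refine ⟨2 * (6 * K) ^ d, by positivity, fun t ht k => ?_, fun t ht ht1 k => ?_⟩
  · have ht0 : 0 < t := by linarith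
    have := abs_prod_sub_le (a := fun i => besselKernel t (k i)) (h := fun i => gaussPoly t (k i))
      hK1 (by positivity : 0 ≤ 1 / t) (by rw [div_le_one ht0]; exact ht)
      (fun i => by positivity) (hb k ht0) (hc k ht0) (fun i => by
        refine (h t ht (k i)).trans ?_
        have hs5 : √t ^ 5 = t ^ 2 * √t := by
          rw [show √t ^ 5 = (√t ^ 2) ^ 2 * √t by ring, Real.sq_sqrt ht0.le]
        have e : C / √t ^ 5 * Real.exp (-(|(k i : ℝ)| / √t)) =
            C * (1 / t) ^ 2 * (1 / √t * Real.exp (-(|(k i : ℝ)| / √t))) := by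
          rw [hs5]; field_simp
        rw [e]
        gcongr
        rw [hK]; linarith [Real.exp_nonneg 2]) Finset.univ
    refine this.trans ?_
    have h2 := prod_envelope_le k t
    simp only [Finset.card_univ, Fintype.card_fin]
    calc _ ≤ (6 * K) ^ d * (1 / t) ^ 2 * (1 / √t ^ d * Real.exp (-(latticeNorm k / √t))) := by gcongr
      _ ≤ _ := by
        have : 0 ≤ (6 * K) ^ d * (1 / t) ^ 2 *
          (1 / √t ^ d * Real.exp (-(latticeNorm k / √t))) := by positivity
        rw [div_pow, one_pow] at this ⊢
        nlinarith
  · obtain ⟨h1, h2⟩ := abs_prod_mul_sum_le hK1 (by positivity : 0 ≤ 1 / t)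
      (fun i => by positivity) (hb k ht) (hc k ht) Finset.univ
    have h3 := prod_envelope_le k t
    simp only [Finset.card_univ, Fintype.card_fin] at h1 h2
    rw [heatApprox, mul_add, mul_one]
    refine (abs_add_le _ _).trans ((add_le_add h1 h2).trans ?_)
    have ht2 : 1 ≤ 1 / t ^ 2 := by rw [le_div_iff₀ (by positivity)]; nlinarith
    have ht3 : 1 / t ≤ 1 / t ^ 2 := by
      apply one_div_le_one_div_of_le (by positivity); nlinarith
    set U := ∏ i, (1 / √t * Real.exp (-(|(k i : ℝ)| / √t)))
    have hU : 0 ≤ U := Finset.prod_nonneg fun i _ => by positivity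
    calc _ ≤ (6 * K) ^ d * (1 / t ^ 2) * U + (6 * K) ^ d * (1 / t ^ 2) * U := by
          gcongr
          exact le_mul_of_one_le_right (by positivity) ht2
      _ = 2 * (6 * K) ^ d * (1 / t ^ 2) * U := by ring
      _ ≤ 2 * (6 * K) ^ d * (1 / t ^ 2) * (1 / √t ^ d * Real.exp (-(latticeNorm k / √t))) := by gcongr
      _ = _ := by ring

end GraphRellich

/-! ### Integration in time and the expansion of G. -/

namespace GraphRellich

open MeasureTheory Real

/-- Substituting u = x^p gives Euler's integral. The case p = -1 serves the Gaussian terms, the case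
p = -1/2 the envelope e^{-R/√t}. -/
lemma integral_rpow_mul_exp_neg_mul_rpow_Ioi {p a r : ℝ} (hp : p ≠ 0) (ha : 0 < a) (hr : 0 < r) :
    ∫ x in Set.Ioi (0 : ℝ), x ^ (p * a - 1) * Real.exp (-(r * x ^ p)) =
      |p|⁻¹ * ((1 / r) ^ a * Real.Gamma a) := by
  rw [← Real.integral_rpow_mul_exp_neg_mul_Ioi ha hr,
    ← integral_comp_rpow_Ioi (fun u => u ^ (a - 1) * Real.exp (-(r * u))) hp, ← integral_const_mul]
  refine setIntegral_congr_fun measurableSet_Ioi fun x hx => ?_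
  have hx0 : (0 : ℝ) < x := hx
  have hp' : |p| ≠ 0 := abs_ne_zero.2 hp
  simp only [smul_eq_mul]
  rw [← Real.rpow_mul hx0.le, show p * a - 1 = (p - 1) + p * (a - 1) by ring, Real.rpow_add hx0]
  field_simp

/-- The integral of a non-integrable function is zero by convention, whereas the value just computed
is positive. -/
lemma integrableOn_rpow_mul_exp_neg_mul_rpow_Ioi {p a r : ℝ} (hp : p ≠ 0) (ha : 0 < a)
    (hr : 0 < r) :
    IntegrableOn (fun x : ℝ => x ^ (p * a - 1) * Real.exp (-(r * x ^ p))) (Set.Ioi 0) := by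
  by_contra h
  have h1 := integral_rpow_mul_exp_neg_mul_rpow_Ioi hp ha hr
  rw [integral_undef h] at h1
  have hp' : 0 < |p| := abs_pos.2 hp
  have := Real.Gamma_pos_of_pos ha
  have : 0 < |p|⁻¹ * ((1 / r) ^ a * Real.Gamma a) := by positivity
  linarith

variable {d : ℕ}

lemma latticeNorm_pos {k : Fin d → ℤ} (hk : k ≠ 0) : 0 < latticeNorm k := by
  refine lt_of_le_of_ne (latticeNorm_nonneg k) fun h => hk ?_
  have h2 := latticeNorm_sq k
  rw [← h, zero_pow two_ne_zero] at h2
  ext i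
  have := (Finset.sum_eq_zero_iff_of_nonneg (fun i _ => sq_nonneg ((k i : ℝ)))).1 h2.symm i
    (Finset.mem_univ i)
  simpa using this

lemma heatApprox_eq (k : Fin d → ℤ) {t : ℝ} (ht : 0 < t) :
    heatApprox k t = (√(2 * π) ^ d)⁻¹ *
      (t ^ (-1 * ((d : ℝ) / 2 - 1) - 1) * Real.exp (-(latticeNorm k ^ 2 / 2 * t ^ (-1 : ℝ))) +
        1 / 8 * (d * (t ^ (-1 * ((d : ℝ) / 2) - 1) *
          Real.exp (-(latticeNorm k ^ 2 / 2 * t ^ (-1 : ℝ)))) -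
        2 * latticeNorm k ^ 2 * (t ^ (-1 * ((d : ℝ) / 2 + 1) - 1) *
          Real.exp (-(latticeNorm k ^ 2 / 2 * t ^ (-1 : ℝ)))) +
        (∑ i, (k i : ℝ) ^ 4) / 3 * (t ^ (-1 * ((d : ℝ) / 2 + 2) - 1) *
          Real.exp (-(latticeNorm k ^ 2 / 2 * t ^ (-1 : ℝ)))))) := by
  have h1 : ∏ i, gaussKernel t (k i) =
      (√(2 * π) ^ d)⁻¹ * t ^ (-((d : ℝ) / 2)) *
        Real.exp (-(latticeNorm k ^ 2 / 2 * t ^ (-1 : ℝ))) := by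
    unfold gaussKernel
    rw [Finset.prod_mul_distrib, ← Real.exp_sum]
    simp only [Finset.prod_const, Finset.card_univ, Fintype.card_fin]
    rw [Real.sqrt_mul (by positivity), mul_inv, mul_pow, Real.rpow_neg ht.le, inv_pow, inv_pow]
    congr 2
    · rw [Real.sqrt_eq_rpow t, ← Real.rpow_natCast, ← Real.rpow_mul ht.le]
      congr 2; ring
    · rw [latticeNorm_sq, Real.rpow_neg_one, ← Finset.sum_div, Finset.sum_neg_distrib]
      field_simp
  have h2 : ∑ i, gaussPoly t (k i) = 1 / 8 * (d * (1 / t) - 2 * latticeNorm k ^ 2 * (1 / t ^ 2) +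
      (∑ i, (k i : ℝ) ^ 4) / 3 * (1 / t ^ 3)) := by
    unfold gaussPoly
    rw [← Finset.mul_sum, Finset.sum_add_distrib, Finset.sum_sub_distrib, ← Finset.sum_div,
      ← Finset.sum_div, ← Finset.sum_div, ← Finset.mul_sum, latticeNorm_sq]
    simp
    field_simp
  rw [heatApprox, h1, h2]
  have e : ∀ m : ℕ, t ^ (-((d : ℝ) / 2) - m) = t ^ (-((d : ℝ) / 2)) * (1 / t ^ m) := by
    intro m
    rw [Real.rpow_sub ht, Real.rpow_natCast]; ring
  have e0 := e 0
  have e1 := e 1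
  have e2 := e 2
  have e3 := e 3
  push_cast at e0 e1 e2 e3
  rw [show -1 * ((d : ℝ) / 2 - 1) - 1 = -((d : ℝ) / 2) - 0 by ring, e0,
    show -1 * ((d : ℝ) / 2) - 1 = -((d : ℝ) / 2) - 1 by ring, e1,
    show -1 * ((d : ℝ) / 2 + 1) - 1 = -((d : ℝ) / 2) - 2 by ring, e2,
    show -1 * ((d : ℝ) / 2 + 2) - 1 = -((d : ℝ) / 2) - 3 by ring, e3]
  ring

lemma integrableOn_heatApprox (hd : 3 ≤ d) {k : Fin d → ℤ} (hk : k ≠ 0) :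
    IntegrableOn (heatApprox k) (Set.Ioi 0) := by
  have hR := latticeNorm_pos hk
  have hr : 0 < latticeNorm k ^ 2 / 2 := by positivity
  have hd' : (3 : ℝ) ≤ d := by exact_mod_cast hd
  have hp : (-1 : ℝ) ≠ 0 := by norm_num
  have i0 := integrableOn_rpow_mul_exp_neg_mul_rpow_Ioi (a := (d : ℝ) / 2 - 1) hp (by linarith) hr
  have i1 := integrableOn_rpow_mul_exp_neg_mul_rpow_Ioi (a := (d : ℝ) / 2) hp (by linarith) hr
  have i2 := integrableOn_rpow_mul_exp_neg_mul_rpow_Ioi (a := (d : ℝ) / 2 + 1) hp (by linarith) hr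
  have i3 := integrableOn_rpow_mul_exp_neg_mul_rpow_Ioi (a := (d : ℝ) / 2 + 2) hp (by linarith) hr
  refine IntegrableOn.congr_fun ?_ (fun t ht => (heatApprox_eq k ht).symm) measurableSet_Ioi
  exact (i0.add ((((i1.const_mul _).sub (i2.const_mul _)).add (i3.const_mul _)).const_mul _)).const_mul _

/-- The leading coefficient of the Green function. -/
noncomputable def greenCoeff (d : ℕ) : ℝ :=
  (√(2 * π) ^ d)⁻¹ * (2 ^ ((d : ℝ) / 2 - 1) * Real.Gamma ((d : ℝ) / 2 - 1))

/-- The second coefficient of the Green function. -/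
noncomputable def greenCoeff' (d : ℕ) : ℝ :=
  (√(2 * π) ^ d)⁻¹ * (1 / 8 * (2 ^ ((d : ℝ) / 2) * Real.Gamma ((d : ℝ) / 2)) * (d * (d + 2) / 3))

lemma integral_linear_combination {α : Type*} [MeasurableSpace α] {μ : Measure α}
    {f₀ f₁ f₂ f₃ : α → ℝ} (h₀ : Integrable f₀ μ) (h₁ : Integrable f₁ μ) (h₂ : Integrable f₂ μ)
    (h₃ : Integrable f₃ μ) (c a b e : ℝ) :
    ∫ t, (f₀ t + c * (a * f₁ t - b * f₂ t + e * f₃ t)) ∂μ =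
      ∫ t, f₀ t ∂μ + c * (a * ∫ t, f₁ t ∂μ - b * ∫ t, f₂ t ∂μ + e * ∫ t, f₃ t ∂μ) := by
  have h12 : Integrable (fun t => a * f₁ t - b * f₂ t) μ := (h₁.const_mul a).sub (h₂.const_mul b)
  have h123 : Integrable (fun t => a * f₁ t - b * f₂ t + e * f₃ t) μ := h12.add (h₃.const_mul e)
  rw [integral_add h₀ (h123.const_mul c), integral_const_mul, integral_add h12 (h₃.const_mul e),
    integral_sub (h₁.const_mul a) (h₂.const_mul b), integral_const_mul, integral_const_mul,
    integral_const_mul]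

/-- The functional equation of Γ reduces the three correction terms to a common factor times d - 2d
+ (d(d+2)/3)·Σ(k_i/|k|)⁴, which is d(d+2)/3 times the stated angular factor. -/
lemma integral_heatApprox (hd : 3 ≤ d) {k : Fin d → ℤ} (hk : k ≠ 0) :
    ∫ t in Set.Ioi (0 : ℝ), heatApprox k t = greenCoeff d / latticeNorm k ^ (d - 2) +
      greenCoeff' d * ((∑ i, ((k i : ℝ) / latticeNorm k) ^ 4) - 3 / ((d : ℝ) + 2)) *
        (1 / latticeNorm k ^ d) := by
  have hR := latticeNorm_pos hk
  have hr : 0 < latticeNorm k ^ 2 / 2 := by positivity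
  have hd' : (3 : ℝ) ≤ d := by exact_mod_cast hd
  have hp : (-1 : ℝ) ≠ 0 := by norm_num
  have i0 := integrableOn_rpow_mul_exp_neg_mul_rpow_Ioi (a := (d : ℝ) / 2 - 1) hp (by linarith) hr
  have i1 := integrableOn_rpow_mul_exp_neg_mul_rpow_Ioi (a := (d : ℝ) / 2) hp (by linarith) hr
  have i2 := integrableOn_rpow_mul_exp_neg_mul_rpow_Ioi (a := (d : ℝ) / 2 + 1) hp (by linarith) hr
  have i3 := integrableOn_rpow_mul_exp_neg_mul_rpow_Ioi (a := (d : ℝ) / 2 + 2) hp (by linarith) hr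
  rw [setIntegral_congr_fun measurableSet_Ioi fun t ht => heatApprox_eq k ht, integral_const_mul,
    integral_linear_combination i0 i1 i2 i3, integral_rpow_mul_exp_neg_mul_rpow_Ioi hp (by linarith) hr,
    integral_rpow_mul_exp_neg_mul_rpow_Ioi hp (by linarith) hr,
    integral_rpow_mul_exp_neg_mul_rpow_Ioi hp (by linarith) hr,
    integral_rpow_mul_exp_neg_mul_rpow_Ioi hp (by linarith) hr]
  have g1 : Real.Gamma ((d : ℝ) / 2 + 1) = d / 2 * Real.Gamma ((d : ℝ) / 2) :=
    Real.Gamma_add_one (by positivity)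
  have g2 : Real.Gamma ((d : ℝ) / 2 + 2) = (d / 2 + 1) * (d / 2 * Real.Gamma ((d : ℝ) / 2)) := by
    rw [← g1, ← Real.Gamma_add_one (by positivity)]; congr 1; ring
  set R := latticeNorm k with hRdef
  have hx : 0 < 1 / (R ^ 2 / 2) := by positivity
  have p2 : (1 / (R ^ 2 / 2)) ^ ((d : ℝ) / 2 + 2) =
      (1 / (R ^ 2 / 2)) ^ ((d : ℝ) / 2) * (1 / (R ^ 2 / 2)) ^ 2 := by
    rw [Real.rpow_add hx]; norm_num
  have p1 : (1 / (R ^ 2 / 2)) ^ ((d : ℝ) / 2 + 1) =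
      (1 / (R ^ 2 / 2)) ^ ((d : ℝ) / 2) * (1 / (R ^ 2 / 2)) := by
    rw [Real.rpow_add hx, Real.rpow_one]
  have q : ∀ m : ℕ, ∀ s : ℝ, s = (m : ℝ) / 2 → (1 / (R ^ 2 / 2)) ^ s = 2 ^ s / R ^ m := by
    intro m s hs
    rw [show 1 / (R ^ 2 / 2) = 2 / R ^ 2 by field_simp, Real.div_rpow (by norm_num) (by positivity),
      ← Real.rpow_natCast R 2, ← Real.rpow_mul hR.le, ← Real.rpow_natCast R m, hs]
    congr 2; push_cast; ring
  rw [p2, p1, g1, g2, q d _ rfl, q (d - 2) _ (by rw [Nat.cast_sub (by omega)]; push_cast; ring)]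
  have hS : ∑ i, ((k i : ℝ) / R) ^ 4 = (∑ i, (k i : ℝ) ^ 4) / R ^ 4 := by
    rw [Finset.sum_div]; simp_rw [div_pow]
  rw [hS, greenCoeff, greenCoeff']
  have : (d : ℝ) + 2 ≠ 0 := by positivity
  have habs : |(-1 : ℝ)| = 1 := by simp
  rw [habs, inv_one, one_mul, one_mul, one_mul, one_mul]
  field_simp
  ring

lemma inv_sqrt_pow {t : ℝ} (ht : 0 < t) (d : ℕ) : 1 / √t ^ d = t ^ (-((d : ℝ) / 2)) := by
  rw [Real.rpow_neg ht.le, one_div, Real.sqrt_eq_rpow, ← Real.rpow_natCast, ← Real.rpow_mul ht.le]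
  congr 2; ring

/-- Each factor is O(t^{-1/2}) at infinity, so the product is O(t^{-d/2}). This is where d ≥ 3,
transience, enters. -/
lemma integrableOn_prod_besselKernel (hd : 3 ≤ d) (k : Fin d → ℤ) :
    IntegrableOn (fun t => ∏ i, besselKernel t (k i)) (Set.Ioi 0) := by
  have hcont : Continuous fun t => ∏ i, besselKernel t (k i) :=
    continuous_finsetProd _ fun i _ => continuous_besselKernel (k i)
  rw [← Set.Ioc_union_Ioi_eq_Ioi (zero_le_one (α := ℝ)), integrableOn_union]
  refine ⟨hcont.integrableOn_Icc.mono_set Set.Ioc_subset_Icc_self, ?_⟩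
  obtain ⟨C, hC, h⟩ := abs_besselKernel_sub_le
  set K := 32 * Real.exp 2 + 32 * Real.exp 2 + C with hK
  have hb : ∀ t : ℝ, 1 ≤ t → ∀ n : ℤ, |besselKernel t n| ≤ K * (1 / √t) := by
    intro t ht n
    have ht0 : 0 < t := by linarith
    have h1 := h t ht n
    have h2 := abs_gaussKernel_le ht0 n
    have h3 := abs_gaussKernel_mul_poly_le ht0 n
    have hE : Real.exp (-(|(n : ℝ)| / √t)) ≤ 1 :=
      Real.exp_le_one_iff.2 (neg_nonpos.2 (by positivity))
    have hU : 1 / √t * Real.exp (-(|(n : ℝ)| / √t)) ≤ 1 / √t :=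
      mul_le_of_le_one_right (by positivity) hE
    have ht1 : 1 / t ≤ 1 := by rw [div_le_one ht0]; exact ht
    have hs1 : 1 ≤ √t := Real.one_le_sqrt.2 ht
    have e : besselKernel t n = (besselKernel t n - gaussKernel t n - gaussCorrection t n) +
      gaussKernel t n + gaussKernel t n * gaussPoly t n := by
      rw [gaussCorrection, gaussPoly]; ring
    rw [e]
    refine (abs_add_le _ _).trans ((add_le_add_left (abs_add_le _ _) _).trans ?_)
    have b1 : C / √t ^ 5 * Real.exp (-(|(n : ℝ)| / √t)) ≤ C * (1 / √t) := by
      calc _ ≤ C / √t ^ 5 * 1 := by gcongr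
        _ ≤ C / √t ^ 1 := by rw [mul_one]; gcongr; norm_num
        _ = _ := by ring
    have b2 : 32 * Real.exp 2 * (1 / √t * Real.exp (-(|(n : ℝ)| / √t))) ≤
      32 * Real.exp 2 * (1 / √t) := by gcongr
    have b3 : 32 * Real.exp 2 * (1 / t) * (1 / √t * Real.exp (-(|(n : ℝ)| / √t))) ≤
      32 * Real.exp 2 * 1 * (1 / √t) := by gcongr
    rw [hK]
    linarith
  have hd' : (3 : ℝ) ≤ d := by exact_mod_cast hd
  refine ((integrableOn_Ioi_rpow_of_lt (a := -((d : ℝ) / 2)) (by linarith) one_pos).const_mul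
    (K ^ d)).mono' hcont.aestronglyMeasurable.restrict ?_
  refine (ae_restrict_mem measurableSet_Ioi).mono fun t ht => ?_
  have ht1 : (1 : ℝ) < t := ht
  have ht0 : 0 < t := by linarith
  rw [Real.norm_eq_abs, Finset.abs_prod, ← inv_sqrt_pow ht0, ← one_div_pow, ← mul_pow]
  refine (Finset.prod_le_prod (fun _ _ => abs_nonneg _) fun i _ => hb t ht1.le (k i)).trans_eq ?_
  simp

theorem hasSum_transition (hd : 3 ≤ d) (k : Fin d → ℤ) :
    HasSum (fun n => transition n k 0) (d * ∫ t in Set.Ioi (0 : ℝ), ∏ i, besselKernel t (k i)) :=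
  hasSum_transition_of_integrableOn (by omega) k (integrableOn_prod_besselKernel hd k)

lemma green_eq_integral (hd : 3 ≤ d) (k : Fin d → ℤ) :
    green k = d * ∫ t in Set.Ioi (0 : ℝ), ∏ i, besselKernel t (k i) :=
  (hasSum_transition hd k).tsum_eq

/-- The second-order asymptotic expansion of the Green function of `ℤ^d`. -/
theorem abs_green_sub_le (hd : 3 ≤ d) : ∃ C₁ C₂ C : ℝ, 0 < C₁ ∧ 0 < C₂ ∧ 0 ≤ C ∧
    ∀ k : Fin d → ℤ, k ≠ 0 → |green k - (C₁ / latticeNorm k ^ (d - 2) +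
      C₂ * ((∑ i, ((k i : ℝ) / latticeNorm k) ^ 4) - 3 / ((d : ℝ) + 2)) *
        (1 / latticeNorm k ^ d))| ≤ C / latticeNorm k ^ (d + 2) := by
  have hd' : (3 : ℝ) ≤ d := by exact_mod_cast hd
  have hd0 : (0 : ℝ) < d := by linarith
  obtain ⟨C, hC, hlarge, hsmall⟩ := abs_prod_besselKernel_sub_heatApprox_le d
  have hG1 : 0 < Real.Gamma ((d : ℝ) / 2 - 1) := Real.Gamma_pos_of_pos (by linarith)
  have hG2 : 0 < Real.Gamma ((d : ℝ) / 2) := Real.Gamma_pos_of_pos (by linarith)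
  have hG3 : 0 < Real.Gamma ((d : ℝ) + 2) := Real.Gamma_pos_of_pos (by linarith)
  refine ⟨d * greenCoeff d, d * greenCoeff' d,
    d * (C * (2 * Real.Gamma ((d : ℝ) + 2)) + Real.exp 1 ^ d * (d + 2).factorial),
    by unfold greenCoeff; positivity, by unfold greenCoeff'; positivity, by positivity,
    fun k hk => ?_⟩
  have hR := latticeNorm_pos hk
  have hM := integral_heatApprox hd hk
  have e : green k - (d * greenCoeff d / latticeNorm k ^ (d - 2) +
      d * greenCoeff' d * ((∑ i, ((k i : ℝ) / latticeNorm k) ^ 4) - 3 / ((d : ℝ) + 2)) *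
        (1 / latticeNorm k ^ d)) =
      d * ∫ t in Set.Ioi (0 : ℝ), (∏ i, besselKernel t (k i) - heatApprox k t) := by
    rw [integral_sub (integrableOn_prod_besselKernel hd k) (integrableOn_heatApprox hd hk), hM,
      green_eq_integral hd]
    ring
  rw [e, abs_mul, abs_of_pos hd0, mul_div_assoc]
  gcongr
  set R := latticeNorm k with hRd
  have hp : (-(1 / 2) : ℝ) ≠ 0 := by norm_num
  -- The envelope t^{-2-d/2} e^{-R/√t} integrates to 2Γ(d+2)/R^{d+2}, which fixes the order of the
  -- error.
  have hE := integrableOn_rpow_mul_exp_neg_mul_rpow_Ioi (a := (d : ℝ) + 2) hp (by linarith) hR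
  have hEv := integral_rpow_mul_exp_neg_mul_rpow_Ioi (a := (d : ℝ) + 2) hp (by linarith) hR
  have hEt : ∀ t : ℝ, 0 < t → t ^ (-(1 / 2) * ((d : ℝ) + 2) - 1) *
      Real.exp (-(R * t ^ (-(1 / 2) : ℝ))) =
      1 / t ^ 2 * (1 / √t ^ d) * Real.exp (-(R / √t)) := by
    intro t ht
    rw [inv_sqrt_pow ht, Real.rpow_neg ht.le, ← Real.sqrt_eq_rpow, ← div_eq_mul_inv,
      show -(1 / 2) * ((d : ℝ) + 2) - 1 = -((d : ℝ) / 2) - (2 : ℕ) by push_cast; ring,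
      Real.rpow_sub ht, Real.rpow_natCast]
    ring
  have hI : IntegrableOn ((Set.Ioc (0 : ℝ) 1).indicator fun _ => Real.exp 1 ^ d * Real.exp (-R))
      (Set.Ioi 0) := by
    refine Integrable.integrableOn ?_
    rw [integrable_indicator_iff measurableSet_Ioc]
    exact continuous_const.integrableOn_Ioc
  have hIv : ∫ t in Set.Ioi (0 : ℝ), (Set.Ioc (0 : ℝ) 1).indicator
      (fun _ => Real.exp 1 ^ d * Real.exp (-R)) t = Real.exp 1 ^ d * Real.exp (-R) := by
    rw [setIntegral_indicator measurableSet_Ioc,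
      Set.inter_eq_self_of_subset_right Set.Ioc_subset_Ioi_self]
    simp
  have hbound : ∀ᵐ t ∂(volume.restrict (Set.Ioi (0 : ℝ))),
      ‖∏ i, besselKernel t (k i) - heatApprox k t‖ ≤
      C * (t ^ (-(1 / 2) * ((d : ℝ) + 2) - 1) * Real.exp (-(R * t ^ (-(1 / 2) : ℝ)))) +
        (Set.Ioc (0 : ℝ) 1).indicator (fun _ => Real.exp 1 ^ d * Real.exp (-R)) t := by
    refine (ae_restrict_mem measurableSet_Ioi).mono fun t ht => ?_
    have ht0 : (0 : ℝ) < t := ht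
    rw [hEt t ht0, Real.norm_eq_abs]
    by_cases ht1 : t ≤ 1
    · rw [Set.indicator_of_mem (show t ∈ Set.Ioc (0 : ℝ) 1 from ⟨ht0, ht1⟩)]
      have h1 := hsmall t ht0 ht1 k
      have h2 : |∏ i, besselKernel t (k i)| ≤ Real.exp 1 ^ d * Real.exp (-R) := by
        rw [Finset.abs_prod]
        refine (Finset.prod_le_prod (fun _ _ => abs_nonneg _) fun i _ =>
          abs_besselKernel_le_exp ht0.le ht1 (k i)).trans ?_
        rw [Finset.prod_mul_distrib, Finset.prod_const, Finset.card_univ, Fintype.card_fin,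
          ← Real.exp_sum, Finset.sum_neg_distrib]
        gcongr
        exact latticeNorm_le_sum_abs k
      have := abs_sub (∏ i, besselKernel t (k i)) (heatApprox k t)
      linarith
    · have h1 : t ∉ Set.Ioc (0 : ℝ) 1 := fun h => ht1 h.2
      rw [Set.indicator_of_notMem h1, add_zero]
      exact hlarge t (not_le.1 ht1).le k
  have hfin := norm_integral_le_of_norm_le ((hE.const_mul C).add hI) hbound
  rw [Real.norm_eq_abs] at hfin
  refine hfin.trans ?_
  have hfac := Real.pow_div_factorial_le_exp R hR.le (d + 2)
  -- The kernel on 0 < t ≤ 1 contributes an exponentially small amount, absorbed into the same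
  -- power.
  have hexp : Real.exp (-R) ≤ (d + 2).factorial / R ^ (d + 2) := by
    rw [Real.exp_neg, ← inv_div]
    exact inv_anti₀ (by positivity) hfac
  have hadd := integral_add (hE.const_mul C) hI
  rw [integral_const_mul, hEv, hIv] at hadd
  refine hadd.le.trans ?_
  have hpow : (1 / R) ^ ((d : ℝ) + 2) = 1 / R ^ (d + 2) := by
    rw [← one_div_pow, ← Real.rpow_natCast]; push_cast; rfl
  rw [hpow, show |(-(1 / 2) : ℝ)|⁻¹ = 2 by norm_num [abs_of_neg]]
  calc _ ≤ C * (2 * (1 / R ^ (d + 2) * Real.Gamma (d + 2))) +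
        Real.exp 1 ^ d * ((d + 2).factorial / R ^ (d + 2)) := by gcongr
    _ = _ := by ring

end GraphRellich

/-! ### Strict positivity of G and w. -/

namespace GraphRellich

open MeasureTheory Real

variable {d : ℕ}

lemma summable_transition (hd : 3 ≤ d) (k l : Fin d → ℤ) :
    Summable fun n => transition n k l := by
  simp_rw [transition_eq_sub _ k l]
  exact (hasSum_transition hd (k - l)).summable

lemma green_eq_average (hd : 3 ≤ d) (k : Fin d → ℤ) :
    green k = (if k = 0 then 1 else 0) + (∑ p, green (k + unitStep p)) / (2 * (d : ℝ)) := by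
  have hs := summable_transition hd
  rw [green, greenKernel, (hs k 0).tsum_eq_zero_add]
  congr 1
  simp_rw [transition_zero_succ]
  rw [Summable.tsum_finsetSum fun p _ => (hs _ 0).div_const _, Finset.sum_div]
  exact Finset.sum_congr rfl fun p _ => tsum_div_const

lemma sum_green_sub (hd : 3 ≤ d) (k : Fin d → ℤ) :
    ∑ p, (green k - green (k + unitStep p)) = if k = 0 then 2 * (d : ℝ) else 0 := by
  have h := green_eq_average hd k
  have hd0 : (0 : ℝ) < d := by exact_mod_cast (by omega : 0 < d)
  rw [Finset.sum_sub_distrib]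
  simp only [Finset.sum_const, Finset.card_univ, Fintype.card_prod, Fintype.card_fin,
    Fintype.card_bool, nsmul_eq_mul]
  push_cast
  have h2 : 2 * (d : ℝ) * green k = 2 * d * (if k = 0 then 1 else 0) +
      ∑ p, green (k + unitStep p) := by
    rw [h, mul_add]; field_simp
  have h3 : 2 * (d : ℝ) * (if k = 0 then 1 else 0) = if k = 0 then 2 * (d : ℝ) else 0 := by
    split_ifs <;> simp
  rw [← h3]; linarith

lemma green_nonneg (k : Fin d → ℤ) : 0 ≤ green k := tsum_nonneg fun n => transition_nonneg n k 0

/-- G is nonnegative and superharmonic, so 2d·G(k) dominates the sum over all neighbours, hence each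
of them. This Harnack bound is the source of every 2d in the later constants. -/
lemma green_step_le (hd : 3 ≤ d) (k : Fin d → ℤ) (p : Fin d × Bool) :
    green (k + unitStep p) ≤ 2 * d * green k := by
  have h := sum_green_sub hd k
  have h1 := Finset.single_le_sum (f := fun p => green (k + unitStep p))
    (fun p _ => green_nonneg _) (Finset.mem_univ p)
  rw [Finset.sum_sub_distrib] at h
  simp only [Finset.sum_const, Finset.card_univ, Fintype.card_prod, Fintype.card_fin,
    Fintype.card_bool, nsmul_eq_mul] at h
  push_cast at h
  have : (0 : ℝ) ≤ if k = 0 then 2 * (d : ℝ) else 0 := by split_ifs <;> positivity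
  nlinarith

lemma one_le_green_zero (hd : 3 ≤ d) : 1 ≤ green (0 : Fin d → ℤ) := by
  rw [green_eq_average hd 0, if_pos rfl]
  have : 0 ≤ (∑ p, green ((0 : Fin d → ℤ) + unitStep p)) / (2 * (d : ℝ)) :=
    div_nonneg (Finset.sum_nonneg fun p _ => green_nonneg _) (by positivity)
  linarith

lemma exists_unitStep_sum_natAbs_lt {k : Fin d → ℤ} (hk : k ≠ 0) :
    ∃ p, ∑ i, ((k + unitStep p : Fin d → ℤ) i).natAbs < ∑ i, (k i).natAbs := by
  obtain ⟨i, hi⟩ : ∃ i, k i ≠ 0 := by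
    by_contra! hc; exact hk (funext hc)
  refine ⟨(i, decide (k i < 0)), Finset.sum_lt_sum (fun j _ => ?_) ⟨i, Finset.mem_univ i, ?_⟩⟩
  · by_cases hj : j = i
    · subst hj
      by_cases h : k j < 0 <;> simp [unitStep, h] <;> omega
    · simp [unitStep, hj]
  · by_cases h : k i < 0 <;> simp [unitStep, h] <;> omega

/-- Positivity propagates from the origin by `green_step_le`, along steps that decrease the ℓ¹ norm.
-/
lemma green_pos (hd : 3 ≤ d) (k : Fin d → ℤ) : 0 < green k := by
  induction hN : ∑ i, (k i).natAbs using Nat.strong_induction_on generalizing k with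
  | _ N ih =>
    by_cases hk : k = 0
    · subst hk; linarith [one_le_green_zero hd]
    · obtain ⟨p, hp⟩ := exists_unitStep_sum_natAbs_lt hk
      have h1 := ih _ (hN ▸ hp) _ rfl
      have h2 := green_step_le hd k p
      have hd0 : (0 : ℝ) < d := by exact_mod_cast (by omega : 0 < d)
      by_contra hc
      nlinarith

/-- The recurrence I_{n-1} - I_{n+1} = (2n/t) I_n, from integrating the derivative of
sin(nθ)e^{t(cos θ - 1)} over a period. -/
lemma mul_besselKernel (t : ℝ) (n : ℤ) :
    n * besselKernel t n = t / 2 * (besselKernel t (n - 1) - besselKernel t (n + 1)) := by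
  have hder : ∀ θ ∈ Set.uIcc (-π) π,
      HasDerivAt (fun θ => Real.sin (n * θ) * Real.exp (t * (Real.cos θ - 1)))
      (n * (Real.cos (n * θ) * Real.exp (t * (Real.cos θ - 1))) - t / 2 *
        (Real.cos ((n - 1 : ℤ) * θ) * Real.exp (t * (Real.cos θ - 1)) -
          Real.cos ((n + 1 : ℤ) * θ) * Real.exp (t * (Real.cos θ - 1)))) θ := by
    intro θ _
    have h1 := ((hasDerivAt_id θ).const_mul (n : ℝ)).sin
    have h2 := (((Real.hasDerivAt_cos θ).sub_const 1).const_mul t).exp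
    refine (h1.mul h2).congr_deriv ?_
    push_cast
    rw [sub_mul, add_mul, one_mul, Real.cos_sub, Real.cos_add]
    simp only [id]
    ring
  have hint := intervalIntegral.integral_eq_sub_of_hasDerivAt hder
    (Continuous.intervalIntegrable (by fun_prop) _ _)
  have hs : Real.sin (n * -π) = 0 := by rw [mul_neg, Real.sin_neg, Real.sin_int_mul_pi, neg_zero]
  rw [Real.sin_int_mul_pi, hs, zero_mul, zero_mul, sub_zero, intervalIntegral.integral_sub,
    intervalIntegral.integral_const_mul, intervalIntegral.integral_const_mul,
    intervalIntegral.integral_sub] at hint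
  · simp only [besselKernel, integral_circleMeasure, smul_eq_mul]
    linear_combination (2 * π)⁻¹ * hint
  all_goals exact Continuous.intervalIntegrable (by fun_prop) _ _

lemma prod_besselKernel_sub (t : ℝ) (k : Fin d → ℤ) (i : Fin d) :
    t * (∏ j, besselKernel t ((k + unitStep (i, false)) j) -
      ∏ j, besselKernel t ((k + unitStep (i, true)) j)) =
      2 * k i * ∏ j, besselKernel t (k j) := by
  have h := mul_besselKernel t (k i)
  have e : ∀ b, ∏ j ∈ Finset.univ.erase i, besselKernel t ((k + unitStep (i, b)) j) =
      ∏ j ∈ Finset.univ.erase i, besselKernel t (k j) := by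
    intro b
    refine Finset.prod_congr rfl fun j hj => ?_
    have : j ≠ i := Finset.ne_of_mem_erase hj
    simp [unitStep, this]
  rw [← Finset.mul_prod_erase _ _ (Finset.mem_univ i), e false,
    ← Finset.mul_prod_erase _ _ (Finset.mem_univ i), e true,
    ← Finset.mul_prod_erase _ (fun j => besselKernel t (k j)) (Finset.mem_univ i)]
  have e1 : (k + unitStep (i, false)) i = k i - 1 := by simp [unitStep]; ring
  have e2 : (k + unitStep (i, true)) i = k i + 1 := by simp [unitStep]
  rw [e1, e2]
  linear_combination (-2 * ∏ j ∈ Finset.univ.erase i, besselKernel t (k j)) * h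

/-- By the Bessel recurrence the difference of the two values is 2d·k_i times the integral of
t^{-1}∏ over the kernel at k. The integrand is nonnegative, so equality would force G(k) = 0. -/
lemma green_step_ne (hd : 3 ≤ d) {k : Fin d → ℤ} {i : Fin d} (hi : k i ≠ 0) :
    green (k + unitStep (i, false)) ≠ green (k + unitStep (i, true)) := by
  intro heq
  have hd0 : (0 : ℝ) < d := by exact_mod_cast (by omega : 0 < d)
  have hi' : (k i : ℝ) ≠ 0 := by exact_mod_cast hi
  have i1 := integrableOn_prod_besselKernel hd (k + unitStep (i, false))
  have i2 := integrableOn_prod_besselKernel hd (k + unitStep (i, true))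
  rw [green_eq_integral hd, green_eq_integral hd] at heq
  have h0 : ∫ t in Set.Ioi (0 : ℝ), (∏ j, besselKernel t ((k + unitStep (i, false)) j) -
      ∏ j, besselKernel t ((k + unitStep (i, true)) j)) = 0 := by
    rw [integral_sub i1 i2, mul_left_cancel₀ hd0.ne' heq, sub_self]
  have hpt : ∀ t ∈ Set.Ioi (0 : ℝ), (2 * (k i : ℝ))⁻¹ *
      (∏ j, besselKernel t ((k + unitStep (i, false)) j) -
        ∏ j, besselKernel t ((k + unitStep (i, true)) j)) =
      t⁻¹ * ∏ j, besselKernel t (k j) := by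
    intro t ht
    have ht0 : t ≠ 0 := ne_of_gt ht
    have := prod_besselKernel_sub t k i
    field_simp
    linear_combination this
  have hf : IntegrableOn (fun t => t⁻¹ * ∏ j, besselKernel t (k j)) (Set.Ioi 0) :=
    IntegrableOn.congr_fun ((i1.sub i2).const_mul _) hpt measurableSet_Ioi
  have hf0 : ∫ t in Set.Ioi (0 : ℝ), t⁻¹ * ∏ j, besselKernel t (k j) = 0 := by
    rw [← setIntegral_congr_fun measurableSet_Ioi hpt, integral_const_mul, h0, mul_zero]
  have hnn : 0 ≤ᵐ[volume.restrict (Set.Ioi (0 : ℝ))] fun t => t⁻¹ * ∏ j, besselKernel t (k j) := by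
    refine (ae_restrict_mem measurableSet_Ioi).mono fun t ht => ?_
    have ht0 : (0 : ℝ) < t := ht
    exact mul_nonneg (by positivity) (prod_besselKernel_nonneg (by omega) k ht0.le)
  have hz := (setIntegral_eq_zero_iff_of_nonneg_ae hnn hf).1 hf0
  have hz' : (fun t => ∏ j, besselKernel t (k j)) =ᵐ[volume.restrict (Set.Ioi (0 : ℝ))] 0 := by
    filter_upwards [hz, ae_restrict_mem measurableSet_Ioi] with t h1 ht
    have ht0 : t ≠ 0 := ne_of_gt ht
    exact (mul_eq_zero.1 h1).resolve_left (inv_ne_zero ht0)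
  have := green_pos hd k
  rw [green_eq_integral hd, integral_congr_ae hz'] at this
  simp at this

lemma latticeWeight_laplacian_sqrt_green (hd : 3 ≤ d) (k : Fin d → ℤ) :
    laplacian latticeWeight (fun l => √(green l)) k = hardyWeight k * √(green k) := by
  rw [hardyWeight, div_mul_cancel₀ _ (Real.sqrt_pos.2 (green_pos hd k)).ne']

/-- Summing √a(√a - √b) = (√a - √b)²/2 + (a - b)/2 over the neighbours; the second part is half of
ΔG, supported at the origin. -/
lemma hardyWeight_mul_green (hd : 3 ≤ d) (k : Fin d → ℤ) :
    hardyWeight k * green k = 1 / 2 * ∑ p, (√(green k) - √(green (k + unitStep p))) ^ 2 +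
      1 / 2 * if k = 0 then 2 * (d : ℝ) else 0 := by
  have h := latticeWeight_laplacian_sqrt_green hd k
  rw [laplacian_latticeWeight] at h
  have h2 : hardyWeight k * green k =
      (∑ p, (√(green k) - √(green (k + unitStep p)))) * √(green k) := by
    rw [h, mul_assoc, Real.mul_self_sqrt (green_nonneg k)]
  rw [h2, ← sum_green_sub hd k, ← mul_add, ← Finset.sum_add_distrib, Finset.sum_mul,
    Finset.mul_sum]
  refine Finset.sum_congr rfl fun p _ => ?_
  have e1 := Real.sq_sqrt (green_nonneg k)
  have e2 := Real.sq_sqrt (green_nonneg (k + unitStep p))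
  nlinarith

lemma half_sum_sq_le (hd : 3 ≤ d) (k : Fin d → ℤ) :
    1 / 2 * ∑ p, (√(green k) - √(green (k + unitStep p))) ^ 2 ≤ hardyWeight k * green k := by
  rw [hardyWeight_mul_green hd]
  have : (0 : ℝ) ≤ if k = 0 then 2 * (d : ℝ) else 0 := by split_ifs <;> positivity
  linarith

lemma hardyWeight_pos (hd : 3 ≤ d) (k : Fin d → ℤ) : 0 < hardyWeight k := by
  have hG := green_pos hd k
  suffices 0 < hardyWeight k * green k from pos_of_mul_pos_left this hG.le
  by_cases hk : k = 0
  · rw [hardyWeight_mul_green hd, if_pos hk]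
    have : 0 ≤ ∑ p, (√(green k) - √(green (k + unitStep p))) ^ 2 :=
      Finset.sum_nonneg fun _ _ => sq_nonneg _
    have hd0 : (0 : ℝ) < d := by exact_mod_cast (by omega : 0 < d)
    linarith
  · refine lt_of_lt_of_le ?_ (half_sum_sq_le hd k)
    obtain ⟨i, hi⟩ : ∃ i, k i ≠ 0 := by
      by_contra! hc; exact hk (funext hc)
    have hne := green_step_ne hd hi
    obtain ⟨p, hp⟩ : ∃ p, green k ≠ green (k + unitStep p) := by
      by_contra! hc
      exact hne ((hc _).symm.trans (hc _))
    have : 0 < (√(green k) - √(green (k + unitStep p))) ^ 2 := by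
      refine sq_pos_of_ne_zero (sub_ne_zero.2 fun h => hp ?_)
      exact (Real.sqrt_inj (green_nonneg _) (green_nonneg _)).1 h
    have h2 := Finset.single_le_sum
      (f := fun p => (√(green k) - √(green (k + unitStep p))) ^ 2)
      (fun _ _ => sq_nonneg _) (Finset.mem_univ p)
    linarith

end GraphRellich

/-! ### Summation by parts, the ground state transform and the Hardy inequality. -/

namespace GraphRellich

open Real

variable {d : ℕ}

/-- Reversal of directed edges, through the involution on steps and a translation of the summation
variable. -/
lemma tsum_sum_unitStep_comm (F : (Fin d → ℤ) → (Fin d → ℤ) → ℝ)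
    (hF : ∀ p, Summable fun k => F k (k + unitStep p)) :
    (∀ p, Summable fun k => F (k + unitStep p) k) ∧
    ∑' k, ∑ p, F (k + unitStep p) k = ∑' k, ∑ p, F k (k + unitStep p) := by
  obtain ⟨σ, hσ⟩ : ∃ σ : Fin d × Bool ≃ Fin d × Bool, ∀ p, unitStep (σ p) = -unitStep p :=
    ⟨(Equiv.refl _).prodCongr Equiv.boolNot, unitStep_neg⟩
  have key : ∀ p, (fun k => F (k + unitStep p) k) =
      (fun k => F k (k + unitStep (σ p))) ∘ Equiv.addRight (unitStep p) := by
    intro p; ext k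
    simp [hσ]
  have hs : ∀ p, Summable fun k => F (k + unitStep p) k := by
    intro p
    rw [key p]
    exact (Equiv.addRight (unitStep p)).summable_iff.2 (hF (σ p))
  refine ⟨hs, ?_⟩
  rw [Summable.tsum_finsetSum fun p _ => hs p, Summable.tsum_finsetSum fun p _ => hF p]
  refine Fintype.sum_equiv σ _ _ fun p => ?_
  rw [key p]
  exact Equiv.tsum_eq (Equiv.addRight (unitStep p)) (fun k => F k (k + unitStep (σ p)))

lemma summable_of_support {f φ : (Fin d → ℤ) → ℝ} (hφ : φ.support.Finite)
    (h : ∀ k, φ k = 0 → f k = 0) : Summable f := by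
  refine summable_of_hasFiniteSupport (hφ.subset fun k hk => ?_)
  exact fun h0 => hk (h k h0)

lemma summable_of_support_step {f φ : (Fin d → ℤ) → ℝ} (hφ : φ.support.Finite)
    (p : Fin d × Bool) (h : ∀ k, φ k = 0 → φ (k + unitStep p) = 0 → f k = 0) : Summable f := by
  have hfin : (fun k => φ (k + unitStep p)).support.Finite :=
    hφ.preimage (f := fun k => k + unitStep p) (add_left_injective _).injOn
  refine summable_of_hasFiniteSupport ((hφ.union hfin).subset fun k hk => ?_)
  by_contra hc
  rw [Set.mem_union, not_or] at hc
  exact hk (h k (Function.notMem_support.1 hc.1) (Function.notMem_support.1 hc.2))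

/-- Green's formula on `ℤ^d`. -/
lemma tsum_grad_mul_grad (g : (Fin d → ℤ) → ℝ) {τ : (Fin d → ℤ) → ℝ} (hτ : τ.support.Finite) :
    1 / 2 * ∑' k, ∑ p, (g k - g (k + unitStep p)) * (τ k - τ (k + unitStep p)) =
      ∑' k, τ k * ∑ p, (g k - g (k + unitStep p)) := by
  obtain ⟨h1, h2⟩ := tsum_sum_unitStep_comm (fun k l => (g k - g l) * τ k) fun p =>
    summable_of_support hτ fun k hk => by simp [hk]
  have h0 : ∀ p, Summable fun k => (g k - g (k + unitStep p)) * τ k := fun p =>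
    summable_of_support hτ fun k hk => by simp [hk]
  have e : ∀ k, ∑ p, (g k - g (k + unitStep p)) * (τ k - τ (k + unitStep p)) =
      ∑ p, (g k - g (k + unitStep p)) * τ k +
        ∑ p, (g (k + unitStep p) - g k) * τ (k + unitStep p) := by
    intro k
    rw [← Finset.sum_add_distrib]
    exact Finset.sum_congr rfl fun p _ => by ring
  simp_rw [e]
  rw [Summable.tsum_add (summable_sum fun p _ => h0 p) (summable_sum fun p _ => h1 p), h2,
    ← two_mul, ← mul_assoc, one_div, inv_mul_cancel₀ two_ne_zero, one_mul]
  congr 1; ext k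
  rw [Finset.mul_sum]
  exact Finset.sum_congr rfl fun p _ => by ring

/-- The energy form of `ψ` after the ground state transform by `v`. -/
noncomputable def transformedEnergy (v ψ : (Fin d → ℤ) → ℝ) : ℝ :=
  1 / 2 * ∑' k, ∑ p, v k * v (k + unitStep p) * (ψ k - ψ (k + unitStep p)) ^ 2

lemma tsum_gradSq (φ : (Fin d → ℤ) → ℝ) :
    ∑' k, gradSq latticeWeight φ k = 1 / 2 * ∑' k, ∑ p, (φ k - φ (k + unitStep p)) ^ 2 := by
  simp_rw [gradSq_latticeWeight]
  rw [tsum_mul_left]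

lemma summable_transformedEnergy (v : (Fin d → ℤ) → ℝ) {ψ : (Fin d → ℤ) → ℝ}
    (hψ : ψ.support.Finite) (p : Fin d × Bool) :
    Summable fun k => v k * v (k + unitStep p) * (ψ k - ψ (k + unitStep p)) ^ 2 :=
  summable_of_support_step hψ p fun k h1 h2 => by simp [h1, h2]

/-- The ground state transform. -/
theorem tsum_gradSq_mul {v w ψ : (Fin d → ℤ) → ℝ}
    (hw : ∀ k, laplacian latticeWeight v k = w k * v k) (hψ : ψ.support.Finite) :
    ∑' k, gradSq latticeWeight (fun k => v k * ψ k) k =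
      ∑' k, w k * (v k * ψ k) ^ 2 + transformedEnergy v ψ := by
  simp_rw [laplacian_latticeWeight] at hw
  have h0 : ∀ p, Summable fun k => v k * ψ k ^ 2 * (v k - v (k + unitStep p)) := fun p =>
    summable_of_support hψ fun k hk => by simp [hk]
  obtain ⟨h1, h2⟩ := tsum_sum_unitStep_comm (fun k l => v k * ψ k ^ 2 * (v k - v l)) h0
  have h3 : ∀ p, Summable fun k => v k * v (k + unitStep p) * (ψ k - ψ (k + unitStep p)) ^ 2 :=
    summable_transformedEnergy v hψ
  -- Edgewise the square splits into two reversed copies of a diagonal term, which assemble to Δv,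
  -- and the weighted square of ψ's difference.
  have e : ∀ k, ∑ p, (v k * ψ k - v (k + unitStep p) * ψ (k + unitStep p)) ^ 2 =
      (∑ p, v k * ψ k ^ 2 * (v k - v (k + unitStep p)) +
        ∑ p, v (k + unitStep p) * ψ (k + unitStep p) ^ 2 * (v (k + unitStep p) - v k)) +
      ∑ p, v k * v (k + unitStep p) * (ψ k - ψ (k + unitStep p)) ^ 2 := by
    intro k
    rw [← Finset.sum_add_distrib, ← Finset.sum_add_distrib]
    exact Finset.sum_congr rfl fun p _ => by ring
  rw [tsum_gradSq]
  simp_rw [e]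
  rw [Summable.tsum_add ((summable_sum fun p _ => h0 p).add (summable_sum fun p _ => h1 p))
    (summable_sum fun p _ => h3 p), Summable.tsum_add (summable_sum fun p _ => h0 p)
    (summable_sum fun p _ => h1 p), h2, mul_add, ← two_mul, ← mul_assoc, transformedEnergy, one_div,
    inv_mul_cancel₀ two_ne_zero, one_mul]
  refine congrArg₂ _ (tsum_congr fun k => ?_) rfl
  rw [← Finset.mul_sum, hw]; ring

lemma transformedEnergy_nonneg {v ψ : (Fin d → ℤ) → ℝ} (hv : ∀ k, 0 ≤ v k) :
    0 ≤ transformedEnergy v ψ := by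
  unfold transformedEnergy
  have : 0 ≤ ∑' k, ∑ p, v k * v (k + unitStep p) * (ψ k - ψ (k + unitStep p)) ^ 2 :=
    tsum_nonneg fun k => Finset.sum_nonneg fun p _ =>
      mul_nonneg (mul_nonneg (hv _) (hv _)) (sq_nonneg _)
  linarith

lemma weightedNorm_sq {X : Type*} {w φ : X → ℝ} (hw : ∀ k, 0 ≤ w k) :
    weightedNorm w φ ^ 2 = ∑' k, w k * φ k ^ 2 :=
  Real.sq_sqrt (tsum_nonneg fun k => mul_nonneg (hw k) (sq_nonneg _))

theorem isHardyWeightOn_hardyWeight (hd : 3 ≤ d) :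
    IsHardyWeightOn (latticeWeight (d := d)) Set.univ hardyWeight := by
  refine ⟨fun k _ => hardyWeight_pos hd k, fun φ hφ _ => ?_⟩
  have hv : ∀ k : Fin d → ℤ, 0 < √(green k) := fun k => Real.sqrt_pos.2 (green_pos hd k)
  have hψ : (fun k => φ k / √(green k)).support.Finite :=
    hφ.subset fun k hk h => hk (by simp only [h, zero_div])
  have h := tsum_gradSq_mul (latticeWeight_laplacian_sqrt_green hd) hψ
  have e : (fun k => √(green k) * (φ k / √(green k))) = φ := by
    ext k; rw [mul_div_cancel₀ _ (hv k).ne']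
  have e' : ∀ k, √(green k) * (φ k / √(green k)) = φ k := fun k => congrFun e k
  rw [e] at h
  simp_rw [e'] at h
  rw [weightedNorm_sq fun k => (hardyWeight_pos hd k).le, h]
  have := transformedEnergy_nonneg (ψ := fun k => φ k / √(green k)) fun k => (hv k).le
  linarith

end GraphRellich

/-! ### Logarithmic cutoffs, criticality and null-criticality. -/

namespace GraphRellich

open Real

variable {d : ℕ}

lemma one_le_latticeNorm {k : Fin d → ℤ} (hk : k ≠ 0) : 1 ≤ latticeNorm k := by
  obtain ⟨i, hi⟩ : ∃ i, k i ≠ 0 := by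
    by_contra! hc; exact hk (funext hc)
  have h1 : 1 ≤ k i ^ 2 := by have := sq_pos_of_ne_zero hi; omega
  have h2 := Finset.single_le_sum (f := fun i => (k i : ℝ) ^ 2) (fun _ _ => sq_nonneg _)
    (Finset.mem_univ i)
  rw [← latticeNorm_sq] at h2
  have h3 : (1 : ℝ) ≤ (k i : ℝ) ^ 2 := by exact_mod_cast h1
  have h4 : (k i : ℝ) ^ 2 ≤ latticeNorm k ^ 2 := h2
  nlinarith [latticeNorm_nonneg k]

lemma abs_coord_le_latticeNorm (k : Fin d → ℤ) (i : Fin d) : |(k i : ℝ)| ≤ latticeNorm k := by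
  refine abs_le_of_sq_le_sq ?_ (latticeNorm_nonneg k)
  rw [latticeNorm_sq]
  exact Finset.single_le_sum (f := fun i => (k i : ℝ) ^ 2) (fun _ _ => sq_nonneg _)
    (Finset.mem_univ i)

lemma finite_latticeNorm_le (A : ℝ) : {k : Fin d → ℤ | latticeNorm k ≤ A}.Finite := by
  refine (Set.finite_Icc (fun _ : Fin d => -⌈A⌉) (fun _ => ⌈A⌉)).subset fun k hk => ?_
  have h : ∀ i, -⌈A⌉ ≤ k i ∧ k i ≤ ⌈A⌉ := by
    intro i
    have h1 := abs_le.1 (((abs_coord_le_latticeNorm k i).trans hk).trans (Int.le_ceil A))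
    exact ⟨by exact_mod_cast h1.1, by exact_mod_cast h1.2⟩
  exact ⟨fun i => (h i).1, fun i => (h i).2⟩

/-- The leading-order asymptotics of the Green function. -/
theorem abs_green_sub_leading_le (hd : 3 ≤ d) : ∃ C₁ C : ℝ, 0 < C₁ ∧ 0 ≤ C ∧
    ∀ k : Fin d → ℤ, k ≠ 0 → |green k - C₁ / latticeNorm k ^ (d - 2)| ≤ C / latticeNorm k ^ d := by
  obtain ⟨C₁, C₂, C, h1, h2, hC, h⟩ := abs_green_sub_le hd
  refine ⟨C₁, C + C₂ * (d + 1), h1, by positivity, fun k hk => ?_⟩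
  have hR := one_le_latticeNorm hk
  have hR0 := latticeNorm_pos hk
  have h3 := h k hk
  set R := latticeNorm k
  set S := ∑ i, ((k i : ℝ) / R) ^ 4
  have hS0 : 0 ≤ S := Finset.sum_nonneg fun i _ => by positivity
  have hS1 : S ≤ d := by
    calc S ≤ ∑ i : Fin d, (1 : ℝ) := by
          refine Finset.sum_le_sum fun i _ => ?_
          rw [← Even.pow_abs (show Even 4 by decide)]
          refine pow_le_one₀ (abs_nonneg _) ?_
          rw [abs_div, abs_of_pos hR0, div_le_one hR0]
          exact abs_coord_le_latticeNorm k i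
      _ = d := by simp
  have hq : (3 : ℝ) / (d + 2) ≤ 1 := by
    rw [div_le_one (by positivity)]
    have : (3 : ℝ) ≤ d := by exact_mod_cast hd
    linarith
  have hq0 : (0 : ℝ) ≤ 3 / (d + 2) := by positivity
  have habs : |S - 3 / ((d : ℝ) + 2)| ≤ d + 1 := by rw [abs_le]; constructor <;> linarith
  have e : green k - C₁ / R ^ (d - 2) = (green k - (C₁ / R ^ (d - 2) +
      C₂ * (S - 3 / ((d : ℝ) + 2)) * (1 / R ^ d))) + C₂ * (S - 3 / ((d : ℝ) + 2)) * (1 / R ^ d) := by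
    ring
  rw [e]
  refine (abs_add_le _ _).trans ?_
  rw [abs_mul, abs_mul, abs_of_pos h2, abs_of_pos (by positivity : 0 < 1 / R ^ d)]
  calc _ ≤ C / R ^ (d + 2) + C₂ * (d + 1) * (1 / R ^ d) := by gcongr
    _ ≤ C / R ^ d + C₂ * (d + 1) * (1 / R ^ d) := by gcongr; omega
    _ = _ := by ring

lemma finite_lt_green (hd : 3 ≤ d) {ε : ℝ} (hε : 0 < ε) : {k : Fin d → ℤ | ε < green k}.Finite := by
  obtain ⟨C₁, C, h1, hC, h⟩ := abs_green_sub_leading_le hd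
  refine (finite_latticeNorm_le ((C₁ + C) / ε)).subset fun k hk => ?_
  have hk' : ε < green k := hk
  by_cases h0 : k = 0
  · subst h0
    have : latticeNorm (0 : Fin d → ℤ) = 0 := by
      rw [← sq_eq_zero_iff, latticeNorm_sq]; simp
    rw [Set.mem_ofPred_eq, this]; positivity
  · have hR := one_le_latticeNorm h0
    have hR0 := latticeNorm_pos h0
    have h2 := (abs_le.1 (h k h0)).2
    rw [Set.mem_ofPred_eq, le_div_iff₀ hε]
    set R := latticeNorm k
    have h3 : C₁ / R ^ (d - 2) ≤ C₁ / R := by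
      gcongr; exact le_self_pow₀ hR (by omega)
    have h4 : C / R ^ d ≤ C / R := by
      gcongr; exact le_self_pow₀ hR (by omega)
    have h5 : green k ≤ (C₁ + C) / R := by rw [add_div]; linarith
    rw [le_div_iff₀ hR0] at h5
    nlinarith

/-- The logarithmic cutoff `(log G + M)₊`. -/
noncomputable def logCutoff (M : ℝ) (k : Fin d → ℤ) : ℝ := max 0 (Real.log (green k) + M)

lemma finite_support_logCutoff (hd : 3 ≤ d) (M : ℝ) :
    (logCutoff M : (Fin d → ℤ) → ℝ).support.Finite := by
  refine (finite_lt_green hd (Real.exp_pos (-M))).subset fun k hk => ?_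
  by_contra hc
  apply hk
  have : green k ≤ Real.exp (-M) := not_lt.1 hc
  have := (Real.log_le_log_iff (green_pos hd k) (Real.exp_pos _)).2 this
  rw [Real.log_exp] at this
  exact max_eq_left (by linarith)

lemma tsum_grad_green_mul_grad_logCutoff (hd : 3 ≤ d) (M : ℝ) :
    1 / 2 * ∑' k : Fin d → ℤ, ∑ p, (green k - green (k + unitStep p)) *
      (logCutoff M k - logCutoff M (k + unitStep p)) = 2 * d * logCutoff M (0 : Fin d → ℤ) := by
  rw [tsum_grad_mul_grad green (finite_support_logCutoff hd M)]
  simp_rw [sum_green_sub hd]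
  rw [tsum_eq_single 0]
  · simp; ring
  · intro k hk; simp [hk]

/-- With u = (log a - log b)/2 one has a - b = 2√a√b·sinh u, and u ≤ sinh u. -/
lemma sqrt_mul_sqrt_mul_log_sub_le {a b : ℝ} (hb : 0 < b) (hab : b ≤ a) :
    √a * √b * (Real.log a - Real.log b) ≤ a - b := by
  have ha : 0 < a := by linarith
  have hx : 0 < √a := Real.sqrt_pos.2 ha
  have hy : 0 < √b := Real.sqrt_pos.2 hb
  have hxy : √b ≤ √a := Real.sqrt_le_sqrt hab
  have ha2 := Real.sq_sqrt ha.le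
  have hb2 := Real.sq_sqrt hb.le
  set u := Real.log a / 2 - Real.log b / 2 with hu
  have hu0 : 0 ≤ u := by rw [hu]; have := Real.log_le_log hb hab; linarith
  have hra : √a = Real.exp (Real.log a / 2) := by
    rw [← Real.log_sqrt ha.le, Real.exp_log hx]
  have hrb : √b = Real.exp (Real.log b / 2) := by
    rw [← Real.log_sqrt hb.le, Real.exp_log hy]
  have hs : u ≤ Real.sinh u := Real.self_le_sinh_iff.2 hu0
  have e : a - b = √a * √b * (2 * Real.sinh u) := by
    have : a - b = √a ^ 2 - √b ^ 2 := by rw [ha2, hb2]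
    rw [this, Real.sinh_eq, hu, neg_sub, Real.exp_sub, Real.exp_sub, ← hra, ← hrb]
    field_simp
  rw [e]
  gcongr
  rw [hu] at hs ⊢
  linarith

/-- The positive part is monotone and 1-Lipschitz, so the logarithmic bound survives the cutoff.
This compares the transformed energy with ⟨∇G, ∇ψ_M⟩, which Green's formula evaluates exactly. -/
lemma sqrt_mul_grad_logCutoff_sq_le (hd : 3 ≤ d) (M : ℝ) (k l : Fin d → ℤ) :
    √(green k) * √(green l) * (logCutoff M k - logCutoff M l) ^ 2 ≤
      (green k - green l) * (logCutoff M k - logCutoff M l) := by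
  have main : ∀ k l : Fin d → ℤ, green l ≤ green k →
      √(green k) * √(green l) * (logCutoff M k - logCutoff M l) ^ 2 ≤
      (green k - green l) * (logCutoff M k - logCutoff M l) := by
    intro k l hkl
    have h1 := sqrt_mul_sqrt_mul_log_sub_le (green_pos hd l) hkl
    have hlog := Real.log_le_log (green_pos hd l) hkl
    have h2 : logCutoff M k - logCutoff M l ≤ Real.log (green k) - Real.log (green l) := by
      unfold logCutoff
      rcases le_total (Real.log (green k) + M) 0 with h | h
      · rw [max_eq_left h]
        have := le_max_left 0 (Real.log (green l) + M)
        linarith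
      · rw [max_eq_right h]
        have := le_max_right 0 (Real.log (green l) + M)
        linarith
    have h3 : 0 ≤ logCutoff M k - logCutoff M l :=
      sub_nonneg.2 (max_le_max le_rfl (by linarith))
    rw [pow_two, ← mul_assoc]
    refine mul_le_mul_of_nonneg_right (le_trans ?_ h1) h3
    gcongr
  rcases le_total (green l) (green k) with h | h
  · exact main k l h
  · have := main l k h
    nlinarith

lemma transformedEnergy_logCutoff_le (hd : 3 ≤ d) (M : ℝ) :
    transformedEnergy (fun k : Fin d → ℤ => √(green k)) (logCutoff M) ≤
      2 * d * logCutoff M (0 : Fin d → ℤ) := by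
  rw [← tsum_grad_green_mul_grad_logCutoff hd, transformedEnergy]
  have hfin := finite_support_logCutoff (d := d) hd M
  refine mul_le_mul_of_nonneg_left (Summable.tsum_le_tsum (fun k => Finset.sum_le_sum fun p _ =>
    sqrt_mul_grad_logCutoff_sq_le hd M k _) ?_ ?_) (by norm_num)
  · exact summable_sum fun p _ => summable_transformedEnergy _ hfin p
  · exact summable_sum fun p _ => summable_of_support_step hfin p fun k h1 h2 => by simp [h1, h2]

lemma logCutoff_zero (hd : 3 ≤ d) {M : ℝ} (hM : 0 ≤ M) :
    logCutoff M (0 : Fin d → ℤ) = Real.log (green (0 : Fin d → ℤ)) + M :=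
  max_eq_right (add_nonneg (Real.log_nonneg (one_le_green_zero hd)) hM)

lemma tendsto_logCutoff_div (k : Fin d → ℤ) :
    Filter.Tendsto (fun M => logCutoff M k / M) Filter.atTop (nhds 1) := by
  have h : Filter.Tendsto (fun M : ℝ => Real.log (green k) / M + 1) Filter.atTop (nhds (0 + 1)) :=
    (tendsto_const_nhds.div_atTop Filter.tendsto_id).add tendsto_const_nhds
  rw [zero_add] at h
  refine h.congr' ?_
  filter_upwards [Filter.eventually_gt_atTop 0,
    Filter.eventually_ge_atTop (-Real.log (green k))] with M h1 h2
  rw [logCutoff, max_eq_right (by linarith)]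
  field_simp

/-- Testing w' on √G·ψ_M leaves (w' - w)(x)G(x)ψ_M(x)² ≤ 2d·ψ_M(0). Division by M² sends the right
side to zero and the left side to (w' - w)(x)G(x). -/
theorem isCritical_hardyWeight (hd : 3 ≤ d) :
    IsCritical (latticeWeight (d := d)) hardyWeight := by
  intro w' hw' hle
  ext x
  refine le_antisymm ?_ (hle x)
  have hw'0 : ∀ k, 0 ≤ w' k := fun k => (hw'.1 k trivial).le
  have key : ∀ M, (w' x - hardyWeight x) * (√(green x) * logCutoff M x) ^ 2 ≤
      2 * d * logCutoff M (0 : Fin d → ℤ) := by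
    intro M
    have hfin := finite_support_logCutoff (d := d) hd M
    have hφ : (fun k : Fin d → ℤ => √(green k) * logCutoff M k).support.Finite :=
      hfin.subset fun k hk h => hk (by simp only [h, mul_zero])
    have h1 := hw'.2 _ hφ (Set.subset_univ _)
    rw [weightedNorm_sq hw'0, tsum_gradSq_mul (latticeWeight_laplacian_sqrt_green hd) hfin] at h1
    have hs : ∀ w : (Fin d → ℤ) → ℝ, Summable fun k => w k * (√(green k) * logCutoff M k) ^ 2 :=
      fun w => summable_of_support hfin fun k hk => by simp [hk]
    have h2 : ∑' k, (w' k - hardyWeight k) * (√(green k) * logCutoff M k) ^ 2 =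
        ∑' k, w' k * (√(green k) * logCutoff M k) ^ 2 -
          ∑' k : Fin d → ℤ, hardyWeight k * (√(green k) * logCutoff M k) ^ 2 := by
      rw [← (hs w').tsum_sub (hs hardyWeight)]
      simp_rw [sub_mul]
    have h3 := (hs fun k => w' k - hardyWeight k).le_tsum x
      (fun k _ => mul_nonneg (sub_nonneg.2 (hle k)) (sq_nonneg _))
    have h4 := transformedEnergy_logCutoff_le (d := d) hd M
    linarith
  have hlim1 : Filter.Tendsto (fun M => (w' x - hardyWeight x) * green x * (logCutoff M x / M) ^ 2)
      Filter.atTop (nhds ((w' x - hardyWeight x) * green x * 1 ^ 2)) :=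
    ((tendsto_logCutoff_div x).pow 2).const_mul _
  have hlim2 : Filter.Tendsto (fun M : ℝ => 2 * d * (logCutoff M (0 : Fin d → ℤ) / M) * M⁻¹)
      Filter.atTop (nhds (2 * d * 1 * 0)) :=
    ((tendsto_logCutoff_div 0).const_mul _).mul tendsto_inv_atTop_zero
  have h := le_of_tendsto_of_tendsto hlim1 hlim2 (by
    filter_upwards [Filter.eventually_gt_atTop 0] with M hM
    have h1 := key M
    rw [mul_pow, Real.sq_sqrt (green_nonneg x)] at h1
    have e1 : (w' x - hardyWeight x) * green x * (logCutoff M x / M) ^ 2 =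
        (w' x - hardyWeight x) * (green x * logCutoff M x ^ 2) / M ^ 2 := by field_simp
    have e2 : 2 * d * (logCutoff M (0 : Fin d → ℤ) / M) * M⁻¹ =
        2 * d * logCutoff M (0 : Fin d → ℤ) / M ^ 2 := by field_simp
    rw [e1, e2]
    gcongr)
  have hG := green_pos hd x
  simp only [one_pow, mul_one, mul_zero] at h
  by_contra hc
  have : 0 < (w' x - hardyWeight x) * green x := mul_pos (by linarith [not_le.1 hc]) hG
  linarith

/-- A converse to the logarithmic bound, valid for comparable a and b, from log y ≤ y - 1 at y =
√a/√b. -/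
lemma sub_mul_log_sub_le {a b c : ℝ} (hb : 0 < b) (hab : b ≤ a) (hc : a ≤ c * b) (hc1 : 1 ≤ c) :
    (a - b) * (Real.log a - Real.log b) ≤ 2 * (1 + c) * (√a - √b) ^ 2 := by
  have ha : 0 < a := by linarith
  have hx : 0 < √a := Real.sqrt_pos.2 ha
  have hy : 0 < √b := Real.sqrt_pos.2 hb
  have hxy : √b ≤ √a := Real.sqrt_le_sqrt hab
  have ha2 := Real.sq_sqrt ha.le
  have hb2 := Real.sq_sqrt hb.le
  have hxc : √a ≤ c * √b := by
    refine abs_le_of_sq_le_sq' ?_ (by positivity) |>.2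
    rw [mul_pow, ha2, hb2]
    nlinarith
  have hl : Real.log a - Real.log b ≤ 2 * ((√a - √b) / √b) := by
    have h1 := Real.log_le_sub_one_of_pos (div_pos hx hy)
    rw [Real.log_div hx.ne' hy.ne', Real.log_sqrt ha.le, Real.log_sqrt hb.le] at h1
    have : (√a - √b) / √b = √a / √b - 1 := by field_simp
    rw [this]; linarith
  calc _ ≤ (a - b) * (2 * ((√a - √b) / √b)) := by
        gcongr
    _ = 2 * (√a + √b) / √b * (√a - √b) ^ 2 := by
        rw [← ha2, ← hb2]
        simp only [Real.sqrt_sq hx.le, Real.sqrt_sq hy.le]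
        field_simp
        ring
    _ ≤ _ := by
        gcongr
        rw [div_le_iff₀ hy]
        nlinarith

lemma grad_green_mul_grad_logCutoff_le (hd : 3 ≤ d) (M : ℝ) {k l : Fin d → ℤ}
    (h1 : green k ≤ 2 * d * green l) (h2 : green l ≤ 2 * d * green k) :
    (green k - green l) * (logCutoff M k - logCutoff M l) ≤
      2 * (1 + 2 * d) * (√(green k) - √(green l)) ^ 2 := by
  have main : ∀ k l : Fin d → ℤ, green l ≤ green k → green k ≤ 2 * d * green l →
      (green k - green l) * (logCutoff M k - logCutoff M l) ≤
      2 * (1 + 2 * d) * (√(green k) - √(green l)) ^ 2 := by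
    intro k l hkl hle
    have hd0 : (3 : ℝ) ≤ d := by exact_mod_cast hd
    refine le_trans ?_ (sub_mul_log_sub_le (green_pos hd l) hkl hle (by linarith))
    refine mul_le_mul_of_nonneg_left ?_ (by linarith)
    have hlog := Real.log_le_log (green_pos hd l) hkl
    unfold logCutoff
    rcases le_total (Real.log (green k) + M) 0 with h | h
    · rw [max_eq_left h]
      have := le_max_left 0 (Real.log (green l) + M)
      linarith
    · rw [max_eq_right h]
      have := le_max_right 0 (Real.log (green l) + M)
      linarith
  rcases le_total (green l) (green k) with h | h
  · exact main k l h h1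
  · have := main l k h h2
    nlinarith

lemma green_le_step (hd : 3 ≤ d) (k : Fin d → ℤ) (p : Fin d × Bool) :
    green k ≤ 2 * d * green (k + unitStep p) := by
  have := green_step_le hd (k + unitStep p) (p.1, !p.2)
  rwa [unitStep_neg, add_neg_cancel_right] at this

/-- The flux 2d·ψ_M(0) = 2d(log G(0) + M) is unbounded in M, yet the converse comparison bounds it
by a fixed multiple of Σ wG. -/
lemma not_summable_hardyWeight_mul_green (hd : 3 ≤ d) :
    ¬ Summable fun k : Fin d → ℤ => hardyWeight k * green k := by
  intro hs
  have hd0 : (3 : ℝ) ≤ d := by exact_mod_cast hd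
  have key : ∀ M, 2 * d * logCutoff M (0 : Fin d → ℤ) ≤
      2 * (1 + 2 * d) * ∑' k : Fin d → ℤ, hardyWeight k * green k := by
    intro M
    have hfin := finite_support_logCutoff (d := d) hd M
    rw [← tsum_grad_green_mul_grad_logCutoff hd, ← tsum_mul_left, ← tsum_mul_left]
    refine Summable.tsum_le_tsum (fun k => ?_) ?_ (hs.mul_left _)
    · calc _ ≤ 1 / 2 * ∑ p, 2 * (1 + 2 * d) * (√(green k) - √(green (k + unitStep p))) ^ 2 := by
            exact mul_le_mul_of_nonneg_left (Finset.sum_le_sum fun p _ =>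
              grad_green_mul_grad_logCutoff_le hd M (green_le_step hd k p) (green_step_le hd k p))
              (by norm_num)
        _ = 2 * (1 + 2 * d) *
            (1 / 2 * ∑ p, (√(green k) - √(green (k + unitStep p))) ^ 2) := by
            rw [← Finset.mul_sum]; ring
        _ ≤ _ := mul_le_mul_of_nonneg_left (half_sum_sq_le hd k) (by positivity)
    · exact (summable_sum fun p _ => summable_of_support_step hfin p fun k h1 h2 => by
        simp [h1, h2]).mul_left _
  set S := 2 * (1 + 2 * d) * ∑' k : Fin d → ℤ, hardyWeight k * green k
  -- As log G(0) ≥ 0, this cutoff level already makes the left side exceed S.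
  have h := key (|S| + 1)
  rw [logCutoff_zero hd (by positivity)] at h
  have hl := Real.log_nonneg (one_le_green_zero hd)
  have hS := le_abs_self S
  have hS0 := abs_nonneg S
  nlinarith

theorem isNullCriticalWith_hardyWeight (hd : 3 ≤ d) :
    IsNullCriticalWith (latticeWeight (d := d)) hardyWeight (fun k => √(green k)) := by
  refine ⟨fun k => Real.sqrt_pos.2 (green_pos hd k), latticeWeight_laplacian_sqrt_green hd, ?_⟩
  simp_rw [Real.sq_sqrt (green_nonneg _)]
  exact not_summable_hardyWeight_mul_green hd

end GraphRellich

/-! ### Optimality at infinity. -/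

namespace GraphRellich

open Real

variable {d : ℕ}

lemma transformedEnergy_sub_le {v ψ χ : (Fin d → ℤ) → ℝ} (hv : ∀ k, 0 ≤ v k)
    (hψ : ψ.support.Finite) (hχ : χ.support.Finite) :
    transformedEnergy v (fun k => ψ k - χ k) ≤
      2 * transformedEnergy v ψ + 2 * transformedEnergy v χ := by
  have hd : (fun k => ψ k - χ k).support.Finite :=
    (hψ.union hχ).subset (Function.support_sub ψ χ)
  have s1 := summable_sum (s := Finset.univ) fun p _ => summable_transformedEnergy v hψ p
  have s2 := summable_sum (s := Finset.univ) fun p _ => summable_transformedEnergy v hχ p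
  have s3 := summable_sum (s := Finset.univ) fun p _ => summable_transformedEnergy v hd p
  have h := Summable.tsum_le_tsum (fun k => ?_) s3 ((s1.mul_left 2).add (s2.mul_left 2))
  · rw [Summable.tsum_add (s1.mul_left 2) (s2.mul_left 2), tsum_mul_left, tsum_mul_left] at h
    unfold transformedEnergy
    linarith
  · rw [Finset.mul_sum, Finset.mul_sum, ← Finset.sum_add_distrib]
    refine Finset.sum_le_sum fun p _ => ?_
    have h0 : 0 ≤ v k * v (k + unitStep p) := mul_nonneg (hv _) (hv _)
    nlinarith [mul_nonneg h0 (sq_nonneg (ψ k - ψ (k + unitStep p) + (χ k - χ (k + unitStep p))))]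

lemma transformedEnergy_le_sum {v χ : (Fin d → ℤ) → ℝ} (hv : ∀ k, 0 ≤ v k) (F : Finset (Fin d → ℤ))
    (hχ : ∀ k ∉ F, χ k = 0) :
    transformedEnergy v χ ≤ ∑ k ∈ F, (2 * v k * ∑ p, v (k + unitStep p)) * χ k ^ 2 := by
  have hfin : χ.support.Finite := F.finite_toSet.subset fun k hk => by
    by_contra hc; exact hk (hχ k hc)
  have h0 : ∀ p, Summable fun k => v k * v (k + unitStep p) * χ k ^ 2 := fun p =>
    summable_of_support hfin fun k hk => by simp [hk]
  obtain ⟨h1, h2⟩ := tsum_sum_unitStep_comm (fun k l => v k * v l * χ k ^ 2) h0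
  have s0 := summable_sum (s := Finset.univ) fun p _ => h0 p
  have s1 := summable_sum (s := Finset.univ) fun p _ => h1 p
  have s3 := summable_sum (s := Finset.univ) fun p _ => summable_transformedEnergy v hfin p
  have h := Summable.tsum_le_tsum (fun k => ?_) s3 ((s0.mul_left 2).add (s1.mul_left 2))
  · rw [Summable.tsum_add (s0.mul_left 2) (s1.mul_left 2), tsum_mul_left, tsum_mul_left, h2] at h
    have e : ∑ k ∈ F, (2 * v k * ∑ p, v (k + unitStep p)) * χ k ^ 2 =
        2 * ∑' k, ∑ p, v k * v (k + unitStep p) * χ k ^ 2 := by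
      rw [tsum_eq_sum (s := F) fun k hk => by simp [hχ k hk], Finset.mul_sum]
      refine Finset.sum_congr rfl fun k _ => ?_
      rw [Finset.mul_sum, Finset.mul_sum, Finset.sum_mul]
      exact Finset.sum_congr rfl fun p _ => by ring
    rw [e, transformedEnergy]
    linarith
  · rw [Finset.mul_sum, Finset.mul_sum, ← Finset.sum_add_distrib]
    refine Finset.sum_le_sum fun p _ => ?_
    have h0 : 0 ≤ v k * v (k + unitStep p) := mul_nonneg (hv _) (hv _)
    nlinarith [mul_nonneg h0 (sq_nonneg (χ k + χ (k + unitStep p)))]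

/-- A consequence of null-criticality: the cutoff set to zero on K is admissible for λw, and the
deleted values cost at most a fixed quadratic form in ψ_M restricted to K. -/
theorem isOptimalAtInfinity_hardyWeight (hd : 3 ≤ d) :
    IsOptimalAtInfinity (latticeWeight (d := d)) hardyWeight := by
  classical
  intro K lam hK hlam hH
  by_contra hgt
  rw [not_le] at hgt
  let v : (Fin d → ℤ) → ℝ := fun k => √(green k)
  have hv : ∀ k, 0 ≤ v k := fun k => Real.sqrt_nonneg _
  set F := hK.toFinset with hF
  set A := ∑ k ∈ F, (2 * v k * ∑ p, v (k + unitStep p)) with hA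
  have key : ∀ (M : ℝ) (S : Finset (Fin d → ℤ)), Disjoint S F →
      (lam - 1) * ∑ k ∈ S, hardyWeight k * green k * logCutoff M k ^ 2 ≤
        4 * d * logCutoff M (0 : Fin d → ℤ) +
          2 * ∑ k ∈ F, (2 * v k * ∑ p, v (k + unitStep p)) * logCutoff M k ^ 2 := by
    intro M S hS
    have hfin := finite_support_logCutoff (d := d) hd M
    let χ : (Fin d → ℤ) → ℝ := fun k => if k ∈ K then logCutoff M k else 0
    let ψ : (Fin d → ℤ) → ℝ := fun k => logCutoff M k - χ k
    have hχ : χ.support.Finite := hfin.subset fun k hk h => hk (by simp [χ, h])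
    have hψK : ∀ k ∈ K, ψ k = 0 := fun k hk => by simp [ψ, χ, hk]
    have hψK' : ∀ k ∉ K, ψ k = logCutoff M k := fun k hk => by simp [ψ, χ, hk]
    have hψ : ψ.support.Finite := hfin.subset fun k hk h => hk (by simp [ψ, χ, h])
    have hφ : (fun k => v k * ψ k).support.Finite :=
      hψ.subset fun k hk h => hk (by simp only [h, mul_zero])
    have hφK : (fun k => v k * ψ k).support ⊆ Kᶜ := fun k hk hkK =>
      hk (by simp only [hψK k hkK, mul_zero])
    have h1 := hH.2 _ hφ hφK
    rw [weightedNorm_sq fun k => mul_nonneg hlam.le (hardyWeight_pos hd k).le,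
      tsum_gradSq_mul (latticeWeight_laplacian_sqrt_green hd) hψ] at h1
    simp_rw [mul_assoc lam] at h1
    rw [tsum_mul_left] at h1
    have hs : Summable fun k => hardyWeight k * (v k * ψ k) ^ 2 :=
      summable_of_support hψ fun k hk => by simp [hk]
    have h2 := hs.sum_le_tsum S fun k _ => mul_nonneg (hardyWeight_pos hd k).le (sq_nonneg _)
    have h3 : ∑ k ∈ S, hardyWeight k * (v k * ψ k) ^ 2 =
        ∑ k ∈ S, hardyWeight k * green k * logCutoff M k ^ 2 := by
      refine Finset.sum_congr rfl fun k hk => ?_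
      have : k ∉ K := fun hkK => Finset.disjoint_left.1 hS hk (by simpa [hF] using hkK)
      rw [hψK' k this, mul_pow, Real.sq_sqrt (green_nonneg k)]; ring
    have h4 := transformedEnergy_sub_le hv hfin hχ
    have h5 := transformedEnergy_logCutoff_le (d := d) hd M
    have h6 := transformedEnergy_le_sum (χ := χ) hv F fun k hk => by
      have : k ∉ K := by simpa [hF] using hk
      simp [χ, this]
    have h7 : ∑ k ∈ F, (2 * v k * ∑ p, v (k + unitStep p)) * χ k ^ 2 =
        ∑ k ∈ F, (2 * v k * ∑ p, v (k + unitStep p)) * logCutoff M k ^ 2 := by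
      refine Finset.sum_congr rfl fun k hk => ?_
      have : k ∈ K := by simpa [hF] using hk
      simp [χ, this]
    rw [← h3]
    have h8 : (lam - 1) * ∑ k ∈ S, hardyWeight k * (v k * ψ k) ^ 2 ≤
        (lam - 1) * ∑' k, hardyWeight k * (v k * ψ k) ^ 2 :=
      mul_le_mul_of_nonneg_left h2 (by linarith)
    have h9 : transformedEnergy (fun k : Fin d → ℤ => √(green k)) ψ = transformedEnergy v ψ := rfl
    simp only [v, ψ] at *
    linarith
  -- Dividing by M² removes the O(M) energy and replaces each ψ_M/M by 1; A is the limiting cost of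
  -- the deletion on K.
  have bound : ∀ S : Finset (Fin d → ℤ), Disjoint S F →
      ∑ k ∈ S, hardyWeight k * green k ≤ 2 * A / (lam - 1) := by
    intro S hS
    have l1 : Filter.Tendsto (fun M => (lam - 1) * ∑ k ∈ S, hardyWeight k * green k *
        (logCutoff M k / M) ^ 2) Filter.atTop
        (nhds ((lam - 1) * ∑ k ∈ S, hardyWeight k * green k * 1 ^ 2)) :=
      (tendsto_finsetSum _ fun k _ => ((tendsto_logCutoff_div k).pow 2).const_mul _).const_mul _
    have l2 : Filter.Tendsto (fun M => 4 * d * (logCutoff M (0 : Fin d → ℤ) / M) * M⁻¹ +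
        2 * ∑ k ∈ F, (2 * v k * ∑ p, v (k + unitStep p)) * (logCutoff M k / M) ^ 2) Filter.atTop
        (nhds (4 * d * 1 * 0 + 2 * ∑ k ∈ F, (2 * v k * ∑ p, v (k + unitStep p)) * 1 ^ 2)) :=
      (((tendsto_logCutoff_div 0).const_mul _).mul tendsto_inv_atTop_zero).add
        ((tendsto_finsetSum _ fun k _ => ((tendsto_logCutoff_div k).pow 2).const_mul _).const_mul _)
    have h := le_of_tendsto_of_tendsto l1 l2 (by
      filter_upwards [Filter.eventually_gt_atTop 0] with M hM
      have h1 := key M S hS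
      have e : ∀ (T : Finset (Fin d → ℤ)) (f : (Fin d → ℤ) → ℝ),
          ∑ k ∈ T, f k * (logCutoff M k / M) ^ 2 = (∑ k ∈ T, f k * logCutoff M k ^ 2) / M ^ 2 := by
        intro T f
        rw [Finset.sum_div]
        exact Finset.sum_congr rfl fun k _ => by rw [div_pow, mul_div_assoc]
      rw [e, e]
      have e2 : 4 * d * (logCutoff M (0 : Fin d → ℤ) / M) * M⁻¹ =
        4 * d * logCutoff M (0 : Fin d → ℤ) / M ^ 2 := by field_simp
      rw [e2, ← mul_div_assoc, ← mul_div_assoc, ← add_div]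
      gcongr)
    simp only [one_pow, mul_one, mul_zero, zero_add] at h
    rw [le_div_iff₀ (by linarith)]
    rw [hA]
    linarith
  refine not_summable_hardyWeight_mul_green hd ?_
  refine summable_of_sum_le (c := 2 * A / (lam - 1) + ∑ k ∈ F, hardyWeight k * green k)
    (fun k => mul_nonneg (hardyWeight_pos hd k).le (green_nonneg k)) fun u => ?_
  have h1 := bound (u \ F) Finset.sdiff_disjoint
  have h2 : ∑ k ∈ u, hardyWeight k * green k ≤ ∑ k ∈ (u \ F) ∪ F, hardyWeight k * green k :=
    Finset.sum_le_sum_of_subset_of_nonneg (fun k hk => by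
      by_cases h : k ∈ F <;> simp [hk, h])
      fun k _ _ => mul_nonneg (hardyWeight_pos hd k).le (green_nonneg k)
  rw [Finset.sum_union Finset.sdiff_disjoint] at h2
  linarith

end GraphRellich

/-! ### The Rellich inequality. -/

namespace GraphRellich

open Real

variable {d : ℕ}

/-- Concavity makes the secant slope (1 - s^α)/(1 - s) nonincreasing in s, so its largest value on s
≥ c is taken at c. -/
lemma sq_one_sub_rpow_le {α c s : ℝ} (h0 : 0 < α) (h1 : α < 1) (hc : 0 < c) (hc1 : c < 1)
    (hs : c ≤ s) : (1 - s ^ α) ^ 2 ≤ ((1 - c ^ α) / (1 - c)) ^ 2 * (1 - s) ^ 2 := by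
  have hs0 : 0 < s := by linarith
  by_cases hs1 : s = 1
  · simp [hs1]
  have hslope := (Real.concaveOn_rpow h0.le h1.le).neg.secant_mono (a := 1) (x := c) (y := s)
    (by simp) hc.le hs0.le hc1.ne hs1 hs
  simp only [Pi.neg_apply, Real.one_rpow] at hslope
  have e1 : (-c ^ α - -1) / (c - 1) = -((1 - c ^ α) / (1 - c)) := by
    rw [← neg_div, ← neg_div_neg_eq]; congr 1 <;> ring
  have e2 : (-s ^ α - -1) / (s - 1) = -((1 - s ^ α) / (1 - s)) := by
    rw [← neg_div, ← neg_div_neg_eq]; congr 1 <;> ring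
  rw [e1, e2, neg_le_neg_iff] at hslope
  have hnn : 0 ≤ (1 - s ^ α) / (1 - s) := by
    rcases lt_or_gt_of_ne hs1 with h | h
    · have := Real.rpow_le_one hs0.le h.le h0.le
      exact div_nonneg (by linarith) (by linarith)
    · have := Real.one_le_rpow h.le h0.le
      exact div_nonneg_of_nonpos (by linarith) (by linarith)
  have hne : 1 - s ≠ 0 := fun h => hs1 (by linarith)
  calc (1 - s ^ α) ^ 2 = ((1 - s ^ α) / (1 - s)) ^ 2 * (1 - s) ^ 2 := by field_simp
    _ ≤ _ := by gcongr

/-- Here s = √b/√a, and the Harnack bound a ≤ 2d·b keeps s above (2d)^{-1/2}. This is the origin of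
the constant in the Rellich inequality. -/
lemma sq_rpow_sub_rpow_le (hd : 3 ≤ d) {α : ℝ} (h0 : 0 < α) (h1 : α < 1) {a b : ℝ} (ha : 0 < a)
    (hb : 0 < b) (hab : a ≤ 2 * d * b) : (a ^ (α / 2) - b ^ (α / 2)) ^ 2 ≤
      ((1 - (2 * (d : ℝ)) ^ (-α / 2)) / (1 - (2 * (d : ℝ)) ^ (-(1 : ℝ) / 2))) ^ 2 *
        (a ^ α / a * (√a - √b) ^ 2) := by
  have hd0 : (3 : ℝ) ≤ d := by exact_mod_cast hd
  have hx : 0 < √a := Real.sqrt_pos.2 ha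
  have hy : 0 < √b := Real.sqrt_pos.2 hb
  have hD : 0 < 2 * (d : ℝ) := by linarith
  set c : ℝ := (2 * (d : ℝ)) ^ (-(1 : ℝ) / 2) with hc
  have hc0 : 0 < c := Real.rpow_pos_of_pos hD _
  have hc1 : c < 1 := Real.rpow_lt_one_of_one_lt_of_neg (by linarith) (by norm_num)
  have hcα : c ^ α = (2 * (d : ℝ)) ^ (-α / 2) := by
    rw [hc, ← Real.rpow_mul hD.le]; congr 1; ring
  have hcs : c ≤ √b / √a := by
    rw [le_div_iff₀ hx]
    have h2 : √a ≤ √(2 * d) * √b := by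
      rw [← Real.sqrt_mul hD.le]; exact Real.sqrt_le_sqrt hab
    have h3 : c * √(2 * d) = 1 := by
      rw [hc, Real.sqrt_eq_rpow, ← Real.rpow_add hD]; norm_num
    calc c * √a ≤ c * (√(2 * d) * √b) := by gcongr
      _ = √b := by rw [← mul_assoc, h3, one_mul]
  have key := sq_one_sub_rpow_le h0 h1 hc0 hc1 hcs
  rw [hcα] at key
  have hs : ∀ x : ℝ, 0 < x → √x ^ α = x ^ (α / 2) := by
    intro x hx
    rw [Real.sqrt_eq_rpow, ← Real.rpow_mul hx.le]; congr 1; ring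
  have hA : 0 < a ^ (α / 2) := Real.rpow_pos_of_pos ha _
  rw [Real.div_rpow hy.le hx.le, hs a ha, hs b hb] at key
  have ha2 : a ^ α = (a ^ (α / 2)) ^ 2 := by
    rw [← Real.rpow_natCast, ← Real.rpow_mul ha.le]; congr 1; push_cast; ring
  have e1 : (a ^ (α / 2) - b ^ (α / 2)) ^ 2 =
      (a ^ (α / 2)) ^ 2 * (1 - b ^ (α / 2) / a ^ (α / 2)) ^ 2 := by field_simp
  have e2 : a ^ α / a * (√a - √b) ^ 2 = (a ^ (α / 2)) ^ 2 * (1 - √b / √a) ^ 2 := by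
    rw [ha2]
    have e3 : (1 - √b / √a) ^ 2 = (√a - √b) ^ 2 / a := by
      have e4 : 1 - √b / √a = (√a - √b) / √a := by field_simp
      rw [e4, div_pow, Real.sq_sqrt ha.le]
    rw [e3]; ring
  rw [e1, e2]
  calc _ ≤ (a ^ (α / 2)) ^ 2 * _ := mul_le_mul_of_nonneg_left key (by positivity)
    _ = _ := by ring

/-- The weighted lower bound for the quadratic form `⟨Δφ, f² φ⟩`. -/
lemma le_tsum_mul_laplacian (hd : 3 ≤ d) {f : (Fin d → ℤ) → ℝ} {γ : ℝ}
    (hf : ∀ k, 1 / 2 * ∑ p, (f k - f (k + unitStep p)) ^ 2 ≤ γ * (f k ^ 2 * hardyWeight k))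
    {φ : (Fin d → ℤ) → ℝ} (hφ : φ.support.Finite) :
    (1 - γ) * ∑' k, f k ^ 2 * hardyWeight k * φ k ^ 2 ≤
      ∑' k, f k ^ 2 * φ k * laplacian latticeWeight φ k := by
  have hfφ : (fun k => f k * φ k).support.Finite :=
    hφ.subset fun k hk h => hk (by simp only [h, mul_zero])
  have hffφ : (fun k => f k ^ 2 * φ k).support.Finite :=
    hφ.subset fun k hk h => hk (by simp only [h, mul_zero])
  have hH := (isHardyWeightOn_hardyWeight hd).2 _ hfφ (Set.subset_univ _)
  rw [weightedNorm_sq fun k => (hardyWeight_pos hd k).le, tsum_gradSq] at hH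
  have hG := tsum_grad_mul_grad φ hffφ
  have h0 : ∀ p, Summable fun k => (f k - f (k + unitStep p)) ^ 2 * φ k ^ 2 := fun p =>
    summable_of_support hφ fun k hk => by simp [hk]
  obtain ⟨h1, h2⟩ := tsum_sum_unitStep_comm (fun k l => (f k - f l) ^ 2 * φ k ^ 2) h0
  have s0 := summable_sum (s := Finset.univ) fun p _ => h0 p
  have s1 := summable_sum (s := Finset.univ) fun p _ => h1 p
  have s2 : Summable fun k => ∑ p, (f k * φ k - f (k + unitStep p) * φ (k + unitStep p)) ^ 2 :=
    summable_sum fun p _ => summable_of_support_step hφ p fun k ha hb => by simp [ha, hb]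
  have s3 : Summable fun k => ∑ p, (φ k - φ (k + unitStep p)) *
      (f k ^ 2 * φ k - f (k + unitStep p) ^ 2 * φ (k + unitStep p)) :=
    summable_sum fun p _ => summable_of_support_step hφ p fun k ha hb => by simp [ha, hb]
  have hpt := Summable.tsum_le_tsum (fun k => ?_) s2 (s3.add ((s0.add s1).mul_left (1 / 2)))
  · rw [Summable.tsum_add s3 ((s0.add s1).mul_left (1 / 2)), tsum_mul_left, Summable.tsum_add s0 s1,
      h2] at hpt
    have hγ : 1 / 2 * ∑' k, ∑ p, (f k - f (k + unitStep p)) ^ 2 * φ k ^ 2 ≤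
        γ * ∑' k, f k ^ 2 * hardyWeight k * φ k ^ 2 := by
      rw [← tsum_mul_left, ← tsum_mul_left]
      refine Summable.tsum_le_tsum (fun k => ?_) (s0.mul_left _)
        (summable_of_support hφ fun k hk => by simp [hk])
      rw [← Finset.sum_mul, ← mul_assoc, ← mul_assoc]
      exact mul_le_mul_of_nonneg_right (hf k) (sq_nonneg _)
    have e1 : ∑' k, hardyWeight k * (f k * φ k) ^ 2 =
        ∑' k, f k ^ 2 * hardyWeight k * φ k ^ 2 := tsum_congr fun k => by ring
    have e2 : ∑' k, f k ^ 2 * φ k * laplacian latticeWeight φ k =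
        ∑' k, f k ^ 2 * φ k * ∑ p, (φ k - φ (k + unitStep p)) :=
      tsum_congr fun k => by rw [laplacian_latticeWeight]
    rw [e1] at hH
    rw [e2]
    linarith
  · rw [← Finset.sum_add_distrib, Finset.mul_sum, ← Finset.sum_add_distrib]
    refine Finset.sum_le_sum fun p _ => ?_
    -- The difference of the two sides is exactly (f_k - f_l)²(φ_k - φ_l)²/2.
    nlinarith [mul_nonneg (sq_nonneg (f k - f (k + unitStep p)))
      (sq_nonneg (φ k - φ (k + unitStep p)))]

theorem rellich_inequality (hd : 3 ≤ d) {α : ℝ} (h0 : 0 < α) (h1 : α < 1)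
    {φ : (Fin d → ℤ) → ℝ} (hφ : φ.support.Finite) :
    (1 - ((1 - (2 * (d : ℝ)) ^ (-α / 2)) / (1 - (2 * (d : ℝ)) ^ (-(1 : ℝ) / 2))) ^ 2) *
        weightedNorm (fun k => green k ^ α * hardyWeight k) φ ≤
      weightedNorm (fun k => green k ^ α / hardyWeight k)
        (φ.support.indicator (laplacian latticeWeight φ)) := by
  set γ := ((1 - (2 * (d : ℝ)) ^ (-α / 2)) / (1 - (2 * (d : ℝ)) ^ (-(1 : ℝ) / 2))) ^ 2 with hγ
  have hf2 : ∀ k : Fin d → ℤ, (green k ^ (α / 2)) ^ 2 = green k ^ α := by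
    intro k
    rw [← Real.rpow_natCast, ← Real.rpow_mul (green_nonneg k)]; congr 1; push_cast; ring
  have hgα : ∀ k : Fin d → ℤ, 0 < green k ^ α := fun k => Real.rpow_pos_of_pos (green_pos hd k) _
  have hw := hardyWeight_pos (d := d) hd
  have hgrad : ∀ k : Fin d → ℤ, 1 / 2 * ∑ p, (green k ^ (α / 2) -
      green (k + unitStep p) ^ (α / 2)) ^ 2 ≤ γ * ((green k ^ (α / 2)) ^ 2 * hardyWeight k) := by
    intro k
    have hG := green_pos hd k
    calc _ ≤ 1 / 2 * ∑ p, γ * (green k ^ α / green k *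
          (√(green k) - √(green (k + unitStep p))) ^ 2) :=
          mul_le_mul_of_nonneg_left (Finset.sum_le_sum fun p _ =>
            sq_rpow_sub_rpow_le hd h0 h1 hG (green_pos hd _) (green_le_step hd k p)) (by norm_num)
      _ = γ * (green k ^ α / green k) *
          (1 / 2 * ∑ p, (√(green k) - √(green (k + unitStep p))) ^ 2) := by
          rw [← Finset.mul_sum, ← Finset.mul_sum]; ring
      _ ≤ γ * (green k ^ α / green k) * (hardyWeight k * green k) := by
          have : 0 ≤ γ * (green k ^ α / green k) := by positivity
          exact mul_le_mul_of_nonneg_left (half_sum_sq_le hd k) this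
      _ = _ := by rw [hf2]; field_simp
  have key := le_tsum_mul_laplacian hd hgrad hφ
  simp_rw [hf2] at key
  set F := hφ.toFinset
  have hF : ∀ k, k ∉ F → φ k = 0 := fun k hk => by simpa [F] using hk
  have hF' : ∀ k ∈ F, k ∈ φ.support := fun k hk => by simpa [F] using hk
  set N := weightedNorm (fun k => green k ^ α * hardyWeight k) φ with hN
  set R := weightedNorm (fun k => green k ^ α / hardyWeight k)
        (φ.support.indicator (laplacian latticeWeight φ)) with hR
  have hN0 : 0 ≤ N := Real.sqrt_nonneg _
  have hR0 : 0 ≤ R := Real.sqrt_nonneg _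
  have hNsq : N ^ 2 = ∑' k, green k ^ α * hardyWeight k * φ k ^ 2 :=
    weightedNorm_sq fun k => mul_nonneg (hgα k).le (hw k).le
  have hCS : ∑' k, green k ^ α * φ k * laplacian latticeWeight φ k ≤ N * R := by
    rw [tsum_eq_sum (s := F) fun k hk => by simp [hF k hk]]
    have h := Real.sum_mul_le_sqrt_mul_sqrt F (fun k => √(green k ^ α * hardyWeight k) * φ k)
      (fun k => √(green k ^ α / hardyWeight k) * laplacian latticeWeight φ k)
    have eN : N = √(∑ k ∈ F, (√(green k ^ α * hardyWeight k) * φ k) ^ 2) := by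
      rw [hN, weightedNorm, tsum_eq_sum (s := F) fun k hk => by simp [hF k hk]]
      congr 1
      refine Finset.sum_congr rfl fun k _ => ?_
      rw [mul_pow, Real.sq_sqrt (mul_nonneg (hgα k).le (hw k).le)]
    have eR : R = √(∑ k ∈ F, (√(green k ^ α / hardyWeight k) * laplacian latticeWeight φ k) ^ 2) := by
      rw [hR, weightedNorm, tsum_eq_sum (s := F) fun k hk => by
        rw [Set.indicator_of_notMem (by simpa using hF k hk)]; simp]
      congr 1
      refine Finset.sum_congr rfl fun k hk => ?_
      rw [mul_pow, Real.sq_sqrt (div_nonneg (hgα k).le (hw k).le),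
        Set.indicator_of_mem (hF' k hk)]
    rw [← eN, ← eR] at h
    refine (Finset.sum_congr rfl fun k _ => ?_).trans_le h
    have : √(green k ^ α * hardyWeight k) * √(green k ^ α / hardyWeight k) = green k ^ α := by
      rw [← Real.sqrt_mul (mul_nonneg (hgα k).le (hw k).le)]
      have : green k ^ α * hardyWeight k * (green k ^ α / hardyWeight k) = (green k ^ α) ^ 2 := by
        have := (hw k).ne'
        field_simp
      rw [this, Real.sqrt_sq (hgα k).le]
    calc _ = (√(green k ^ α * hardyWeight k) * √(green k ^ α / hardyWeight k)) * φ k *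
          laplacian latticeWeight φ k := by rw [this]
      _ = _ := by ring
  rw [← hNsq] at key
  -- Cauchy–Schwarz gives (1 - γ)N² ≤ NR; one factor N is cancelled unless N = 0, when the claim is
  -- trivial. The sign of 1 - γ plays no role.
  rcases hN0.eq_or_lt with h | h
  · rw [← h, mul_zero]; exact hR0
  · have : N * ((1 - γ) * N) ≤ N * R := by nlinarith
    exact le_of_mul_le_mul_left this h

end GraphRellich

/-! ### Asymptotics of w and of the Rellich weights. -/

namespace GraphRellich

open Real Filter Topology Asymptotics

variable {d : ℕ}

/-- The derivative of u^s - s·u is O(|u - 1|) near 1, so the mean value inequality on the ball of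
radius |u - 1| gains another factor. -/
lemma rpow_sub_linear_isBigO (s : ℝ) :
    (fun u : ℝ => u ^ s - 1 - s * (u - 1)) =O[𝓝 1] fun u => (u - 1) ^ 2 := by
  have hder : HasDerivAt (fun y : ℝ => s * y ^ (s - 1)) (s * ((s - 1) * 1 ^ (s - 1 - 1))) 1 :=
    (Real.hasDerivAt_rpow_const (Or.inl one_ne_zero)).const_mul s
  obtain ⟨C, hC0, hC⟩ := hder.isBigO_sub.exists_pos
  have hC' := hC.bound
  obtain ⟨δ, hδ, hball⟩ := Metric.eventually_nhds_iff_ball.1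
    (hC'.and (lt_mem_nhds (zero_lt_one (α := ℝ))))
  refine IsBigO.of_bound C ?_
  filter_upwards [Metric.ball_mem_nhds (1 : ℝ) hδ] with u hu
  have hsub : ∀ y ∈ Metric.closedBall (1 : ℝ) |u - 1|, y ∈ Metric.ball (1 : ℝ) δ := by
    intro y hy
    rw [Metric.mem_closedBall, Real.dist_eq] at hy
    rw [Metric.mem_ball, Real.dist_eq] at hu ⊢
    linarith
  have := (convex_closedBall (1 : ℝ) |u - 1|).norm_image_sub_le_of_norm_hasDerivWithin_le
    (f := fun y : ℝ => y ^ s - s * y) (f' := fun y => s * y ^ (s - 1) - s) (C := C * |u - 1|)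
    (x := 1) (y := u) (fun y hy => by
      have hy0 := (hball y (hsub y hy)).2
      have h1 := (Real.hasDerivAt_rpow_const (x := y) (p := s) (Or.inl hy0.ne')).sub
        ((hasDerivAt_id y).const_mul s)
      rw [mul_one] at h1
      exact HasDerivAt.hasDerivWithinAt h1)
    (fun y hy => by
      have h1 := (hball y (hsub y hy)).1
      rw [Metric.mem_closedBall, Real.dist_eq] at hy
      simp only [Real.one_rpow, mul_one] at h1
      refine h1.trans ?_
      rw [Real.norm_eq_abs]
      gcongr)
    (by simp) (by simp [Real.dist_eq])
  simp only [Real.one_rpow] at this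
  rw [norm_pow, Real.norm_eq_abs (u - 1), pow_two, ← mul_assoc]
  refine le_trans (le_of_eq ?_) this
  congr 1; ring

lemma tendsto_latticeNorm : Tendsto (latticeNorm (d := d)) (latticeAtInfinity d) atTop :=
  tendsto_comap

lemma eventually_ne_zero : ∀ᶠ k in latticeAtInfinity d, k ≠ 0 := by
  filter_upwards [tendsto_latticeNorm.eventually_gt_atTop 0] with k hk h0
  subst h0
  have : latticeNorm (0 : Fin d → ℤ) = 0 := by rw [← sq_eq_zero_iff, latticeNorm_sq]; simp
  linarith

lemma latticeNorm_add_unitStep_sq (k : Fin d → ℤ) (p : Fin d × Bool) :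
    latticeNorm (k + unitStep p) ^ 2 =
      latticeNorm k ^ 2 + 2 * ((if p.2 then 1 else -1) * (k p.1 : ℝ)) + 1 := by
  rw [latticeNorm_sq, latticeNorm_sq, ← Finset.add_sum_erase _ _ (Finset.mem_univ p.1),
    ← Finset.add_sum_erase _ (fun i => (k i : ℝ) ^ 2) (Finset.mem_univ p.1)]
  have : ∑ i ∈ Finset.univ.erase p.1, (((k + unitStep p) i : ℤ) : ℝ) ^ 2 =
      ∑ i ∈ Finset.univ.erase p.1, (k i : ℝ) ^ 2 := by
    refine Finset.sum_congr rfl fun i hi => ?_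
    simp [unitStep, Finset.ne_of_mem_erase hi]
  rw [this]
  rcases p with ⟨i, b⟩
  cases b <;> simp [unitStep] <;> ring

lemma latticeNorm_sub_one_le (k : Fin d → ℤ) (p : Fin d × Bool) :
    latticeNorm k - 1 ≤ latticeNorm (k + unitStep p) := by
  have h := latticeNorm_add_unitStep_sq k p
  have h1 := abs_le.1 (abs_coord_le_latticeNorm k p.1)
  have h2 := latticeNorm_nonneg (k + unitStep p)
  have h3 : (latticeNorm k - 1) ^ 2 ≤ latticeNorm (k + unitStep p) ^ 2 := by
    rw [h]; split_ifs <;> nlinarith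
  exact (abs_le_of_sq_le_sq' h3 h2).2

lemma tendsto_add_unitStep (p : Fin d × Bool) :
    Tendsto (fun k => k + unitStep p) (latticeAtInfinity d) (latticeAtInfinity d) := by
  refine tendsto_comap_iff.2 (tendsto_atTop_mono (fun k => latticeNorm_sub_one_le k p) ?_)
  exact tendsto_atTop_add_const_right _ (-1) tendsto_latticeNorm

lemma tendsto_inv_latticeNorm_pow {j : ℕ} (hj : j ≠ 0) :
    Tendsto (fun k => 1 / latticeNorm k ^ j) (latticeAtInfinity d) (𝓝 0) := by
  have := ((tendsto_pow_atTop hj).comp (tendsto_latticeNorm (d := d))).inv_tendsto_atTop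
  exact this.congr fun k => by simp

lemma inv_latticeNorm_step_isBigO (p : Fin d × Bool) (j : ℕ) :
    (fun k => 1 / latticeNorm (k + unitStep p) ^ j) =O[latticeAtInfinity d]
      fun k => 1 / latticeNorm k ^ j := by
  refine IsBigO.of_bound (2 ^ j) ?_
  filter_upwards [tendsto_latticeNorm.eventually_ge_atTop 2] with k hk
  have h := latticeNorm_sub_one_le k p
  have h0 : 0 < latticeNorm k := by linarith
  have h1 : latticeNorm k / 2 ≤ latticeNorm (k + unitStep p) := by linarith
  have h2 : 0 < latticeNorm (k + unitStep p) := by linarith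
  rw [Real.norm_of_nonneg (by positivity), Real.norm_of_nonneg (by positivity)]
  calc 1 / latticeNorm (k + unitStep p) ^ j ≤ 1 / (latticeNorm k / 2) ^ j := by gcongr
    _ = _ := by rw [div_pow]; field_simp

lemma inv_pow_isBigO_of_le {i j : ℕ} (h : i ≤ j) :
    (fun k => 1 / latticeNorm k ^ j) =O[latticeAtInfinity d] fun k => 1 / latticeNorm k ^ i := by
  refine IsBigO.of_bound 1 ?_
  filter_upwards [tendsto_latticeNorm.eventually_ge_atTop 1] with k hk
  have h0 : 0 < latticeNorm k := by linarith
  rw [Real.norm_of_nonneg (by positivity), Real.norm_of_nonneg (by positivity), one_mul]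
  gcongr

/-- `√G` divided by its leading asymptotics. -/
noncomputable def sqrtGreenRatio (C₁ : ℝ) (k : Fin d → ℤ) : ℝ :=
  √(green k * latticeNorm k ^ (d - 2) / C₁)

lemma sqrtGreenRatio_isBigO (hd : 3 ≤ d) {C₁ C : ℝ} (h1 : 0 < C₁)
    (h : ∀ k : Fin d → ℤ, k ≠ 0 →
      |green k - C₁ / latticeNorm k ^ (d - 2)| ≤ C / latticeNorm k ^ d) :
    (fun k : Fin d → ℤ => sqrtGreenRatio C₁ k - 1) =O[latticeAtInfinity d]
      fun k => 1 / latticeNorm k ^ 2 := by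
  refine IsBigO.of_bound (C / C₁) ?_
  filter_upwards [eventually_ne_zero] with k hk
  have hR := latticeNorm_pos hk
  have hk := h k hk
  have hG := green_nonneg k
  rw [Real.norm_of_nonneg (by positivity : 0 ≤ 1 / latticeNorm k ^ 2)]
  set R := latticeNorm k
  have hy : 0 ≤ green k * R ^ (d - 2) / C₁ := by positivity
  set y := green k * R ^ (d - 2) / C₁ with hydef
  have hs : |√y - 1| ≤ |y - 1| := by
    have e : y - 1 = (√y - 1) * (√y + 1) := by
      have := Real.sq_sqrt hy
      linear_combination -this
    rw [e, abs_mul]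
    refine le_mul_of_one_le_right (abs_nonneg _) ?_
    have := Real.sqrt_nonneg y
    rw [abs_of_nonneg (by linarith)]; linarith
  have e : y - 1 = (green k - C₁ / R ^ (d - 2)) * (R ^ (d - 2) / C₁) := by
    rw [hydef]; field_simp
  have hRd : R ^ d = R ^ (d - 2) * R ^ 2 := by rw [← pow_add]; congr 1; omega
  calc ‖√y - 1‖ ≤ |y - 1| := hs
    _ ≤ C / R ^ d * (R ^ (d - 2) / C₁) := by
        rw [e, abs_mul, abs_of_pos (by positivity : 0 < R ^ (d - 2) / C₁)]
        gcongr
    _ = _ := by rw [hRd]; field_simp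

/-- The ratio is u^s times a quotient of `sqrtGreenRatio` values, the latter being 1 + O(|k|^{-2}).
Only the leading order of G is needed. -/
lemma sqrt_green_step_isBigO (hd : 3 ≤ d) (p : Fin d × Bool) :
    (fun k => √(green (k + unitStep p)) / √(green k) - 1 +
      ((d : ℝ) - 2) / 2 * ((if p.2 then 1 else -1) * (k p.1 : ℝ)) / latticeNorm k ^ 2)
      =O[latticeAtInfinity d] fun k => 1 / latticeNorm k ^ 2 := by
  obtain ⟨C₁, C, h1, hC, h⟩ := abs_green_sub_leading_le hd
  have hH := sqrtGreenRatio_isBigO hd h1 h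
  have hHs := (hH.comp_tendsto (tendsto_add_unitStep p)).trans (inv_latticeNorm_step_isBigO p 2)
  have hHlim : Tendsto (fun k : Fin d → ℤ => sqrtGreenRatio C₁ k) (latticeAtInfinity d) (𝓝 1) := by
    have := (hH.trans_tendsto (tendsto_inv_latticeNorm_pow two_ne_zero)).add_const 1
    simpa using this
  have hη : (fun k => sqrtGreenRatio C₁ (k + unitStep p) / sqrtGreenRatio C₁ k - 1)
      =O[latticeAtInfinity d] fun k => 1 / latticeNorm k ^ 2 := by
    have hinv : (fun k : Fin d → ℤ => (sqrtGreenRatio C₁ k)⁻¹) =O[latticeAtInfinity d]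
        fun _ => (1 : ℝ) := (hHlim.inv₀ one_ne_zero).isBigO_one ℝ
    have := (hHs.sub hH).mul hinv
    simp only [mul_one] at this
    refine this.congr' ?_ EventuallyEq.rfl
    filter_upwards [hHlim.eventually_ne one_ne_zero] with k hk
    simp only [Function.comp_apply]
    field_simp
    ring
  let x : (Fin d → ℤ) → ℝ := fun k => (if p.2 then 1 else -1) * (k p.1 : ℝ)
  let u : (Fin d → ℤ) → ℝ := fun k => latticeNorm (k + unitStep p) ^ 2 / latticeNorm k ^ 2
  have hx : ∀ k, |x k| ≤ latticeNorm k := by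
    intro k
    simp only [x]
    rw [abs_mul]
    have : |(if p.2 then 1 else -1 : ℝ)| = 1 := by split_ifs <;> simp
    rw [this, one_mul]
    exact abs_coord_le_latticeNorm k p.1
  have hu : ∀ᶠ k in latticeAtInfinity d, u k - 1 = 2 * x k / latticeNorm k ^ 2 +
      1 / latticeNorm k ^ 2 := by
    filter_upwards [eventually_ne_zero] with k hk
    have hR := latticeNorm_pos hk
    simp only [u, x]
    rw [latticeNorm_add_unitStep_sq]
    field_simp
    ring
  have hxO : (fun k => 2 * x k / latticeNorm k ^ 2) =O[latticeAtInfinity d]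
      fun k => 1 / latticeNorm k ^ 1 := by
    refine IsBigO.of_bound 2 ?_
    filter_upwards [eventually_ne_zero] with k hk
    have hR := latticeNorm_pos hk
    rw [norm_div, norm_mul, Real.norm_eq_abs (x k), Real.norm_of_nonneg (by positivity),
      Real.norm_of_nonneg (by positivity : 0 ≤ latticeNorm k ^ 2),
      Real.norm_of_nonneg (by positivity : 0 ≤ 1 / latticeNorm k ^ 1), div_le_iff₀ (by positivity)]
    have := hx k
    calc 2 * |x k| ≤ 2 * latticeNorm k := by gcongr
      _ = _ := by field_simp
  have hu1 : (fun k => u k - 1) =O[latticeAtInfinity d] fun k => 1 / latticeNorm k ^ 1 :=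
    (hxO.add (inv_pow_isBigO_of_le one_le_two)).congr' (hu.mono fun k hk => hk.symm)
      EventuallyEq.rfl
  have hulim : Tendsto u (latticeAtInfinity d) (𝓝 1) := by
    have := (hu1.trans_tendsto (tendsto_inv_latticeNorm_pow one_ne_zero)).add_const 1
    simpa using this
  -- √G decays like |k|^{-(d-2)/2}, and u is a ratio of squared norms, hence the quarter.
  set s : ℝ := -((d : ℝ) - 2) / 4 with hs
  have hT : (fun k => u k ^ s - 1 - s * (u k - 1)) =O[latticeAtInfinity d]
      fun k => 1 / latticeNorm k ^ 2 := by
    refine ((rpow_sub_linear_isBigO s).comp_tendsto hulim).trans ?_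
    refine (hu1.pow 2).congr_right fun k => ?_
    rw [pow_one, one_div_pow]
  have hus : (fun k => u k ^ s) =O[latticeAtInfinity d] fun _ => (1 : ℝ) :=
    ((hulim.rpow_const (Or.inl one_ne_zero))).isBigO_one ℝ
  have hprod : (fun k => u k ^ s * (sqrtGreenRatio C₁ (k + unitStep p) / sqrtGreenRatio C₁ k - 1))
      =O[latticeAtInfinity d] fun k => 1 / latticeNorm k ^ 2 := by
    simpa only [one_mul] using hus.mul hη
  have hlin : (fun k => s * (1 / latticeNorm k ^ 2)) =O[latticeAtInfinity d]
      fun k => 1 / latticeNorm k ^ 2 := (isBigO_refl _ _).const_mul_left s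
  refine ((hT.add hlin).add hprod).congr' ?_ EventuallyEq.rfl
  filter_upwards [hu, eventually_ne_zero, (tendsto_add_unitStep p).eventually eventually_ne_zero]
    with k hk hk0 hk1
  have hR := latticeNorm_pos hk0
  have hR1 := latticeNorm_pos hk1
  have hG := green_pos hd k
  have hG1 := green_pos hd (k + unitStep p)
  have hratio : √(green (k + unitStep p)) / √(green k) = u k ^ s *
      (sqrtGreenRatio C₁ (k + unitStep p) / sqrtGreenRatio C₁ k) := by
    have hu0 : 0 < u k := by positivity
    have e1 : u k ^ s = √((latticeNorm k / latticeNorm (k + unitStep p)) ^ (d - 2)) := by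
      have e2 : u k = ((latticeNorm k / latticeNorm (k + unitStep p)) ^ (2 : ℝ))⁻¹ := by
        rw [Real.rpow_two]
        simp only [u]
        rw [div_pow, inv_div]
      rw [e2, Real.inv_rpow (by positivity), ← Real.rpow_neg (by positivity),
        ← Real.rpow_mul (by positivity), Real.sqrt_eq_rpow, ← Real.rpow_natCast,
        ← Real.rpow_mul (by positivity), Nat.cast_sub (by omega), hs]
      congr 1; push_cast; ring
    rw [e1, sqrtGreenRatio, sqrtGreenRatio, ← Real.sqrt_div (by positivity),
      ← Real.sqrt_div (by positivity), ← Real.sqrt_mul (by positivity), div_pow]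
    congr 1
    field_simp
  rw [hratio, hk]
  simp only [x]
  rw [hs]
  ring

/-- Off the origin the term ΔG drops out and w is a sum of squares. Squaring an O(|k|^{-1}) main
part known up to O(|k|^{-2}) leaves O(|k|^{-3}), and Σ k_i² = |k|² collects the main parts. -/
theorem hardyWeight_asymptotics (hd : 3 ≤ d) :
    (fun k : Fin d → ℤ => hardyWeight k - ((d : ℝ) - 2) ^ 2 / 4 * (1 / latticeNorm k ^ 2))
      =O[latticeAtInfinity d] fun k => 1 / latticeNorm k ^ 3 := by
  have hp : ∀ p : Fin d × Bool, (fun k => (√(green (k + unitStep p)) / √(green k) - 1) ^ 2 -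
      (((d : ℝ) - 2) / 2 * ((if p.2 then 1 else -1) * (k p.1 : ℝ)) / latticeNorm k ^ 2) ^ 2)
      =O[latticeAtInfinity d] fun k => 1 / latticeNorm k ^ 3 := by
    intro p
    have hq := sqrt_green_step_isBigO hd p
    have hx : (fun k : Fin d → ℤ => ((d : ℝ) - 2) / 2 * ((if p.2 then 1 else -1) * (k p.1 : ℝ)) /
        latticeNorm k ^ 2) =O[latticeAtInfinity d] fun k => 1 / latticeNorm k ^ 1 := by
      refine IsBigO.of_bound |((d : ℝ) - 2) / 2| ?_
      filter_upwards [eventually_ne_zero] with k hk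
      have hR := latticeNorm_pos hk
      rw [norm_div, norm_mul, norm_mul, Real.norm_eq_abs, Real.norm_eq_abs (k p.1 : ℝ),
        Real.norm_of_nonneg (by positivity : 0 ≤ latticeNorm k ^ 2),
        Real.norm_of_nonneg (by positivity : 0 ≤ 1 / latticeNorm k ^ 1), div_le_iff₀ (by positivity)]
      have : ‖(if p.2 then 1 else -1 : ℝ)‖ = 1 := by split_ifs <;> simp
      rw [this, one_mul]
      calc _ ≤ |((d : ℝ) - 2) / 2| * latticeNorm k := by
            gcongr; exact abs_coord_le_latticeNorm k p.1
        _ = _ := by field_simp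
    have := hq.mul ((hq.trans (inv_pow_isBigO_of_le one_le_two)).sub (hx.const_mul_left 2))
    refine this.congr (fun k => by ring) fun k => ?_
    rw [one_div_mul_one_div, ← pow_add]; rfl
  have hsum := (IsBigO.sum (s := Finset.univ) fun p _ => hp p).const_mul_left (1 / 2)
  refine hsum.congr' ?_ EventuallyEq.rfl
  filter_upwards [eventually_ne_zero] with k hk
  have hR := latticeNorm_pos hk
  have hG := green_pos hd k
  have hsG := Real.sqrt_pos.2 hG
  have hw := hardyWeight_mul_green hd k
  rw [if_neg hk, mul_zero, add_zero] at hw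
  have h1 : hardyWeight k = 1 / 2 * ∑ p, (√(green (k + unitStep p)) / √(green k) - 1) ^ 2 := by
    rw [← eq_div_iff hG.ne'] at hw
    rw [hw, mul_div_assoc, Finset.sum_div]
    congr 1
    refine Finset.sum_congr rfl fun p _ => ?_
    have e : √(green (k + unitStep p)) / √(green k) - 1 =
      (√(green (k + unitStep p)) - √(green k)) / √(green k) := by field_simp
    rw [e, div_pow, Real.sq_sqrt hG.le]
    ring
  have h2 : ∑ p : Fin d × Bool, (((d : ℝ) - 2) / 2 * ((if p.2 then 1 else -1) * (k p.1 : ℝ)) /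
      latticeNorm k ^ 2) ^ 2 = ((d : ℝ) - 2) ^ 2 / 2 * (1 / latticeNorm k ^ 2) := by
    rw [Fintype.sum_prod_type]
    have : ∀ i : Fin d, ∑ b : Bool, (((d : ℝ) - 2) / 2 * ((if b then 1 else -1) * (k i : ℝ)) /
      latticeNorm k ^ 2) ^ 2 = (k i : ℝ) ^ 2 * (((d : ℝ) - 2) ^ 2 / 2 / latticeNorm k ^ 4) := by
      intro i
      rw [Fintype.sum_bool]
      simp
      field_simp
      ring
    simp_rw [this]
    rw [← Finset.sum_mul, ← latticeNorm_sq]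
    field_simp
  rw [Finset.sum_apply, Finset.sum_sub_distrib, mul_sub, ← h1, h2]
  ring

lemma tendsto_hardyWeight_mul_sq (hd : 3 ≤ d) :
    Tendsto (fun k : Fin d → ℤ => hardyWeight k * latticeNorm k ^ 2) (latticeAtInfinity d)
      (𝓝 (((d : ℝ) - 2) ^ 2 / 4)) := by
  have h := (hardyWeight_asymptotics hd).mul
    (isBigO_refl (fun k : Fin d → ℤ => latticeNorm k ^ 2) (latticeAtInfinity d))
  have hlim : Tendsto (fun k : Fin d → ℤ => 1 / latticeNorm k ^ 3 * latticeNorm k ^ 2)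
      (latticeAtInfinity d) (𝓝 0) := by
    refine (tendsto_inv_latticeNorm_pow (d := d) one_ne_zero).congr' ?_
    filter_upwards [eventually_ne_zero] with k hk
    have hR := latticeNorm_pos hk
    field_simp
  have h2 := (h.trans_tendsto hlim).add_const (((d : ℝ) - 2) ^ 2 / 4)
  rw [zero_add] at h2
  refine h2.congr' ?_
  filter_upwards [eventually_ne_zero] with k hk
  have hR := latticeNorm_pos hk
  field_simp
  ring

lemma tendsto_green_mul_pow (hd : 3 ≤ d) : ∃ C₁ : ℝ, 0 < C₁ ∧
    Tendsto (fun k : Fin d → ℤ => green k * latticeNorm k ^ (d - 2)) (latticeAtInfinity d)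
      (𝓝 C₁) := by
  obtain ⟨C₁, C, h1, hC, h⟩ := abs_green_sub_leading_le hd
  refine ⟨C₁, h1, ?_⟩
  rw [tendsto_iff_dist_tendsto_zero]
  have hlim := (tendsto_inv_latticeNorm_pow (d := d) two_ne_zero).const_mul C
  rw [mul_zero] at hlim
  refine squeeze_zero' (Eventually.of_forall fun _ => dist_nonneg) ?_ hlim
  filter_upwards [eventually_ne_zero] with k hk
  have hR := latticeNorm_pos hk
  have hk := h k hk
  set R := latticeNorm k
  have hRd : R ^ d = R ^ (d - 2) * R ^ 2 := by rw [← pow_add]; congr 1; omega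
  have e : green k * R ^ (d - 2) - C₁ = (green k - C₁ / R ^ (d - 2)) * R ^ (d - 2) := by field_simp
  rw [Real.dist_eq, e, abs_mul, abs_of_pos (by positivity : 0 < R ^ (d - 2))]
  calc _ ≤ C / R ^ d * R ^ (d - 2) := by gcongr
    _ = _ := by rw [hRd]; field_simp

/-- The exponent 2/(d - 2) is the one turning the decay |k|^{-(d-2)} of G into |k|^{-2}, the decay
of w. -/
lemma tendsto_green_rpow_mul_sq (hd : 3 ≤ d) : ∃ C : ℝ, 0 < C ∧
    Tendsto (fun k : Fin d → ℤ => green k ^ ((2 : ℝ) / ((d : ℝ) - 2)) * latticeNorm k ^ 2)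
      (latticeAtInfinity d) (𝓝 C) := by
  obtain ⟨C₁, h1, h⟩ := tendsto_green_mul_pow hd
  have hd' : (3 : ℝ) ≤ d := by exact_mod_cast hd
  refine ⟨C₁ ^ ((2 : ℝ) / ((d : ℝ) - 2)), Real.rpow_pos_of_pos h1 _, ?_⟩
  refine (h.rpow_const (Or.inl h1.ne')).congr fun k => ?_
  rw [Real.mul_rpow (green_nonneg k) (pow_nonneg (latticeNorm_nonneg k) _), ← Real.rpow_natCast,
    ← Real.rpow_mul (latticeNorm_nonneg k), Nat.cast_sub (by omega)]
  have : ((d : ℝ) - (2 : ℕ)) * (2 / ((d : ℝ) - 2)) = (2 : ℕ) := by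
    have : (d : ℝ) - 2 ≠ 0 := by linarith
    push_cast; field_simp
  rw [this, Real.rpow_natCast]

end GraphRellich

/-! ### Assembly. -/

theorem mainTheorem11 (d : ℕ) (hd : 3 ≤ d) :
    -- the Green function is well defined and strictly positive
    (∀ k l : Fin d → ℤ, Summable (fun n => GraphRellich.transition n k l) ∧
      0 < GraphRellich.greenKernel k l) ∧
    -- `w` is a strictly positive Hardy weight, and it is optimal
    GraphRellich.IsHardyWeightOn (GraphRellich.latticeWeight (d := d)) Set.univ
      GraphRellich.hardyWeight ∧
    GraphRellich.IsCritical (GraphRellich.latticeWeight (d := d)) GraphRellich.hardyWeight ∧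
    GraphRellich.IsNullCriticalWith (GraphRellich.latticeWeight (d := d)) GraphRellich.hardyWeight
      (fun k => Real.sqrt (GraphRellich.green k)) ∧
    GraphRellich.IsOptimalAtInfinity (GraphRellich.latticeWeight (d := d))
      GraphRellich.hardyWeight ∧
    -- the Rellich-type inequality
    (∀ α : ℝ, 0 < α → α < 1 → ∀ φ : (Fin d → ℤ) → ℝ, φ.support.Finite →
      (1 - ((1 - (2 * (d : ℝ)) ^ (-α / 2)) / (1 - (2 * (d : ℝ)) ^ (-(1 : ℝ) / 2))) ^ 2) *
          GraphRellich.weightedNorm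
            (fun k => GraphRellich.green k ^ α * GraphRellich.hardyWeight k) φ ≤
        GraphRellich.weightedNorm
          (fun k => GraphRellich.green k ^ α / GraphRellich.hardyWeight k)
          (φ.support.indicator (GraphRellich.laplacian GraphRellich.latticeWeight φ))) ∧
    -- the asymptotics of `w`
    (fun k : Fin d → ℤ => GraphRellich.hardyWeight k -
        ((d : ℝ) - 2) ^ 2 / 4 * (1 / GraphRellich.latticeNorm k ^ 2))
      =O[GraphRellich.latticeAtInfinity d] (fun k => 1 / GraphRellich.latticeNorm k ^ 3) ∧
    -- the asymptotics of `G`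
    (∃ C₁ C₂ : ℝ, 0 < C₁ ∧ 0 < C₂ ∧
      (fun k : Fin d → ℤ => GraphRellich.green k -
          (C₁ / GraphRellich.latticeNorm k ^ (d - 2) +
            C₂ * ((∑ i, ((k i : ℝ) / GraphRellich.latticeNorm k) ^ 4) - 3 / ((d : ℝ) + 2)) *
              (1 / GraphRellich.latticeNorm k ^ d)))
        =O[GraphRellich.latticeAtInfinity d]
          (fun k => 1 / GraphRellich.latticeNorm k ^ (d + 2))) ∧
    -- for `d ≥ 5` and `α = 2 / (d - 2)`, the weights behave like `C` and `C' |k|⁻⁴`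
    (5 ≤ d → (2 : ℝ) / ((d : ℝ) - 2) < 1 ∧
      (∃ C : ℝ, 0 < C ∧
        Filter.Tendsto
          (fun k : Fin d → ℤ =>
            GraphRellich.green k ^ ((2 : ℝ) / ((d : ℝ) - 2)) / GraphRellich.hardyWeight k)
          (GraphRellich.latticeAtInfinity d) (nhds C)) ∧
      (∃ C' : ℝ, 0 < C' ∧
        Filter.Tendsto
          (fun k : Fin d → ℤ =>
            GraphRellich.green k ^ ((2 : ℝ) / ((d : ℝ) - 2)) * GraphRellich.hardyWeight k /
              (1 / GraphRellich.latticeNorm k ^ 4))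
          (GraphRellich.latticeAtInfinity d) (nhds C'))) := by
  open GraphRellich in
  refine ⟨fun k l => ⟨summable_transition hd k l, ?_⟩, isHardyWeightOn_hardyWeight hd,
    isCritical_hardyWeight hd, isNullCriticalWith_hardyWeight hd,
    isOptimalAtInfinity_hardyWeight hd, fun α h0 h1 φ hφ => rellich_inequality hd h0 h1 hφ,
    hardyWeight_asymptotics hd, ?_, fun hd5 => ⟨?_, ?_, ?_⟩⟩
  · rw [greenKernel_eq_green]; exact green_pos hd _
  · obtain ⟨C₁, C₂, C, h1, h2, -, h⟩ := abs_green_sub_le hd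
    refine ⟨C₁, C₂, h1, h2, Asymptotics.IsBigO.of_bound C ?_⟩
    filter_upwards [eventually_ne_zero] with k hk
    have hR := latticeNorm_pos hk
    rw [Real.norm_eq_abs, Real.norm_of_nonneg (by positivity), mul_one_div C]
    exact h k hk
  · have : (5 : ℝ) ≤ d := by exact_mod_cast hd5
    rw [div_lt_one (by linarith)]; linarith
  · obtain ⟨C, hC, h⟩ := tendsto_green_rpow_mul_sq hd
    have hd' : (3 : ℝ) ≤ d := by exact_mod_cast hd
    have hpos : 0 < ((d : ℝ) - 2) ^ 2 / 4 := by
      have : 0 < (d : ℝ) - 2 := by linarith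
      positivity
    refine ⟨C / (((d : ℝ) - 2) ^ 2 / 4), by positivity, ?_⟩
    refine (h.div (tendsto_hardyWeight_mul_sq hd) hpos.ne').congr' ?_
    filter_upwards [eventually_ne_zero] with k hk
    have hR := latticeNorm_pos hk
    exact mul_div_mul_right _ _ (by positivity)
  · obtain ⟨C, hC, h⟩ := tendsto_green_rpow_mul_sq hd
    have hd' : (3 : ℝ) ≤ d := by exact_mod_cast hd
    have hpos : 0 < ((d : ℝ) - 2) ^ 2 / 4 := by
      have : 0 < (d : ℝ) - 2 := by linarith
      positivity
    refine ⟨C * (((d : ℝ) - 2) ^ 2 / 4), by positivity, ?_⟩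
    refine (h.mul (tendsto_hardyWeight_mul_sq hd)).congr fun k => ?_
    rw [div_div_eq_mul_div, div_one]
    ring
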